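/- **Setting.** For a Coxeter group $W$ with simple reflections $s_i$ ($i\in S_W$) and a standard parabolic subgroup $P$, let ${}^PW$ be the set of minimal length representatives of the cosets in $P\backslash W$, ordered by the strong Bruhat order, and let $\varnothing=1\in{}^PW$. The Bruhat graph has the vertex set ${}^PW$ and an edge $\lambda\to\lambda s_i$ whenever $\lambda<\lambda s_i\in{}^PW$. The extended Bruhat graph is obtained by replacing each such edge by four edges labelled $i$, namely $\lambda\to\lambda$, $\lambda s_i\to\lambda s_i$, $\lambda\to\lambda s_i$, $\lambda s_i\to\lambda$; the last two have degree $0$, and a loop at $\nu$ labelled $i$ has degree $1$ if $\nu s_i>\nu$ and $-1$ if $\nu s_i<\nu$. The degree of a path is the sum of the degrees of its edges, its weight is the word of its edge labels, and a path from $\varnothing$ to $\mu$ is reduced if it is a shortest one. For a reduced path $\mathsf T^\mu$ from $\varnothing$ to $\mu$, $\mathrm{Path}(\lambda,\mathsf T^\mu)$ is the set of paths from $\varnothing$ to $\lambda$ that have the same weight as $\mathsf T^\mu$. Let $(W,P)$ be a simply-laced Hermitian symmetric pair: $(A_n,A_{k-1}\times A_{n-k})$ with $1\le k\le n$, $(D_n,A_{n-1})$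 or $(D_n,D_{n-1})$ with $n\ge 3$, $(E_6,D_5)$ or $(E_7,E_6)$. Let $\tau\in S_W$ and $\mathscr P^\tau_{(W,P)}=\{\mu\in{}^PW : \mu\tau<\mu\}$, with the induced order. Let $(W,P)^\tau=(W^\tau,P^\tau)$ be, respectively, $(A_{n-2},A_{k-2}\times A_{n-k-1})$, $(D_{n-2},A_{n-3})$, $(A_1,A_0)$, $(A_5,A_4)$, $(D_6,D_5)$; here $A_{-1}$, $A_0$, $D_1$ are trivial, and the first pair means $P^\tau=W^\tau$ if $k=1$ or $k=n$. Type $D_n$ has the nodes $1'',1,2,\dots,n-1$, where $1,\dots,n-1$ is a path and $1''$ is joined to $2$; $P$ omits the node $k$ in type $(A_n,A_{k-1}\times A_{n-k})$ and the node $1''$ in type $(D_n,A_{n-1})$. In these two types, elements of ${}^PW$ are represented by coset diagrams: $n+1$, respectively $n$, points on a line labelled $\wedge$ or $\vee$. The diagram of $\varnothing$ is $\wedge^k\vee^{n+1-k}$, respectively $\vee^n$; $W$ acts on labellings from the right, $s_i$ ($i\geq1$) exchanging the labels $i$ and $i+1$, and $s_{1''}$ exchanging and flipping the first two labels; the diagram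 of $\lambda$ is the image under $\lambda$ of that of $\varnothing$. To a word $i_1\cdots i_r$ attach the decorated tangle $e_{i_1}\cdots e_{i_r}$ (later factors on top, two beads on one strand cancel), where $e_i$ has one northern and one southern arc joining the vertices $i,i+1$ and otherwise vertical strands, and $e_{1''}$ is the same with arcs joining the vertices $1,2$, each carrying a bead. To a path $\mathsf S$ from $\varnothing$ to $\lambda$ attach the diagram $e_{\mathsf S}$: the tangle of its weight, with the coset diagram of $\varnothing$ on the southern and that of $\lambda$ on the northern boundary. It is an oriented Temperley–Lieb diagram if on every undecorated strand one of the two end arrows points into the strand and the other out of it, and on every decorated strand both point in or both point out. A northern arc has degree $1$ if its rightmost vertex is labelled $\vee$ and $0$ otherwise. **Theorem.** (i) There is an isomorphism of ordered sets $\psi_\tau:\mathscr P^\tau_{(W,P)}\to{}^{P^\tau}W^\tau$ which, in types $(A_n,A_{k-1}\times A_{n-k})$ and $(D_n,A_{n-1})$, deletes from the coset diagram the two labels in the positions exchanged by $\tau$. (In type $(D_n,A_{n-1})$ with $\tau\ne s_{1''}$ the deletion leaves an odd number of $\wedge$'s, and such a diagram is identified with the coset diagram of $(D_{n-2},A_{n-3})$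 obtained by flipping its first label.) (ii) For each such $\psi_\tau$, all $\lambda,\mu\in\mathscr P^\tau_{(W,P)}$ and all reduced paths $\mathsf T^\mu$ and $\mathsf T^{\psi_\tau(\mu)}$ there is a degree-preserving bijection $$\mathrm{Path}(\lambda,\mathsf T^\mu)\longrightarrow\mathrm{Path}(\psi_\tau(\lambda),\mathsf T^{\psi_\tau(\mu)}),\qquad \mathsf S\mapsto\mathsf S'.$$ (iii) In types $(A_n,A_{k-1}\times A_{n-k})$ and $(D_n,A_{n-1})$ this bijection deletes a degree-zero arc: $e_{\mathsf S}$ and $e_{\mathsf S'}$ are oriented Temperley–Lieb diagrams, $e_{\mathsf S}$ has a northern arc of degree $0$ joining the two vertices exchanged by $\tau$, which carries a bead if and only if $\tau=s_{1''}$, and the northern half of $e_{\mathsf S'}$ is obtained from the northern half of $e_{\mathsf S}$ by deleting this arc with its two end points. (In type $(D_n,A_{n-1})$ with $\tau\neq s_{1''}$ this holds up to the above identification, which flips the first label and adds or removes a bead on the strand at the first vertex.) -/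

import Mathlib

/-! ### Parabolic Coxeter systems, minimal coset representatives, Bruhat strolls -/

/-- A pair `(W, P)`: the Coxeter group `W` of a Coxeter matrix, with its parabolic subgroup `P`
generated by the simple reflections `s_i`, `i ∈ inP`. -/
structure CoxeterPair where
  Node : Type
  M : CoxeterMatrix Node
  inP : Set Node

namespace CoxeterPair

abbrev W (X : CoxeterPair) : Type := X.M.Group

abbrev cs (X : CoxeterPair) : CoxeterSystem X.M X.W := X.M.toCoxeterSystem

/-- The parabolic subgroup `P`. -/
def parabolic (X : CoxeterPair) : Subgroup X.W :=
  Subgroup.closure (X.cs.simple '' X.inP)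

/-- The strong Bruhat order on `W`: some reduced expression of `w` has a subword that is a
reduced expression of `y`. -/
def BruhatLE (X : CoxeterPair) (y w : X.W) : Prop :=
  ∃ ω : List X.Node, X.cs.IsReduced ω ∧ X.cs.wordProd ω = w ∧
    ∃ υ : List X.Node, List.Sublist υ ω ∧ X.cs.IsReduced υ ∧ X.cs.wordProd υ = y

def BruhatLT (X : CoxeterPair) (y w : X.W) : Prop :=
  X.BruhatLE y w ∧ y ≠ w

/-- `^PW`: the elements of minimal length in their coset `P w`. -/
@[ext]
structure Coset (X : CoxeterPair) where
  val : X.W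
  minimal : ∀ p ∈ X.parabolic, X.cs.length val ≤ X.cs.length (p * val)

instance (X : CoxeterPair) : LE X.Coset := ⟨fun a b => X.BruhatLE a.val b.val⟩

/-- The representative `∅` of the identity coset. -/
def origin (X : CoxeterPair) : X.Coset where
  val := 1
  minimal := by simp

/-- `𝒫^τ = {μ ∈ ^PW : μ τ < μ}`, with the order of `^PW`. -/
abbrev Wall (X : CoxeterPair) (τ : X.Node) : Type :=
  {μ : X.Coset // X.BruhatLT (μ.val * X.cs.simple τ) μ.val}

/-- The edges `a → b = a s_i`, `a < b`, of the Bruhat graph. -/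
def Edge (X : CoxeterPair) (i : X.Node) (a b : X.Coset) : Prop :=
  b.val = a.val * X.cs.simple i ∧ X.BruhatLT a.val b.val

/-- The edges of the extended Bruhat graph: each edge between `a` and `b` of the Bruhat graph is
replaced by the four edges `a → a`, `b → b`, `a → b`, `b → a`. -/
def ExtEdge (X : CoxeterPair) (i : X.Node) (x y : X.Coset) : Prop :=
  ∃ a b : X.Coset, X.Edge i a b ∧ (x = a ∨ x = b) ∧ (y = a ∨ y = b)

open Classical in
/-- The degree of an edge of the extended Bruhat graph. -/
noncomputable def edgeDeg (X : CoxeterPair) (i : X.Node) (x y : X.Coset) : ℤ :=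
  if x = y then (if X.BruhatLT x.val (x.val * X.cs.simple i) then 1 else -1) else 0

/-- Paths in the extended Bruhat graph that start at `∅` and end at the given coset. -/
inductive Path (X : CoxeterPair) : X.Coset → Type
  | nil : Path X X.origin
  | snoc {x y : X.Coset} (S : Path X x) (i : X.Node) (h : X.ExtEdge i x y) : Path X y

namespace Path

variable {X : CoxeterPair}

/-- The weight `w(S)`, as an expression. -/
def weight : {x : X.Coset} → X.Path x → List X.Node
  | _, .nil => []
  | _, .snoc S i _ => S.weight ++ [i]

noncomputable def deg : {x : X.Coset} → X.Path x → ℤ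
  | _, .nil => 0
  | _, @Path.snoc _ x y S i _ => S.deg + X.edgeDeg i x y

/-- A path is reduced if it is a shortest path from `∅` to its end point. -/
def IsReduced {x : X.Coset} (S : X.Path x) : Prop :=
  ∀ S' : X.Path x, S.weight.length ≤ S'.weight.length

end Path

/-- `Path(x, T)`: the paths that end at `x` and have the same weight as `T`. -/
abbrev PathOfWeight (X : CoxeterPair) (x : X.Coset) {y : X.Coset} (T : X.Path y) : Type :=
  {S : X.Path x // S.weight = T.weight}

end CoxeterPair

/-! ### The simply-laced Hermitian symmetric pairs -/

/-- The nodes of the Coxeter graph of type `D_n`: the value `0` stands for the node `1''` and the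
value `i ≥ 1` for the node `i ≤ n - 1`. The groups of type `D_0` and `D_1` are trivial.
(`CoxeterMatrix.D` is not used: it also joins its nodes `n - 2` and `n - 1`, which creates a
triangle.) -/
abbrev DNode (n : ℕ) : Type := {_i : Fin n // 2 ≤ n}

/-- Type `D_n`: the nodes `1, 2, …, n - 1` form a path and `1''` is joined to `2`. -/
def coxeterD (n : ℕ) : CoxeterMatrix (DNode n) where
  M := Matrix.of fun i j =>
    if i.1.val = j.1.val then 1
    else if (1 ≤ i.1.val ∧ i.1.val + 1 = j.1.val) ∨ (1 ≤ j.1.val ∧ j.1.val + 1 = i.1.val) ∨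
      (i.1.val = 0 ∧ j.1.val = 2) ∨ (j.1.val = 0 ∧ i.1.val = 2) then 3
    else 2
  isSymm := by
    ext i j
    simp only [Matrix.transpose_apply, Matrix.of_apply]
    split_ifs <;> omega
  diagonal := by simp
  off_diagonal := by
    intro i j h
    have h' : i.1.val ≠ j.1.val := fun e => h (Subtype.ext (Fin.ext e))
    simp only [Matrix.of_apply, if_neg h']
    split_ifs <;> omega

/-- `(A_{N-1}, A_{k-1} × A_{N-k-1})`: the symmetric group on `N` points and the stabiliser of the
first `k` points. The reflection `i : Fin (N - 1)` is the transposition of the points `i`, `i + 1`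
(counted from `0`), that is `s_{i+1}`, and `s_k` is omitted. For `k = 0` or `k = N` this is the
degenerate pair with `P = W`. -/
def pairA (N k : ℕ) : CoxeterPair where
  Node := Fin (N - 1)
  M := CoxeterMatrix.A (N - 1)
  inP := {i | i.val + 1 ≠ k}

/-- `(D_n, A_{n-1})`: the node `1''` is omitted. -/
def pairDA (n : ℕ) : CoxeterPair where
  Node := DNode n
  M := coxeterD n
  inP := {i | i.1.val ≠ 0}

/-- `(D_n, D_{n-1})`: the node `n - 1` is omitted. -/
def pairDD (n : ℕ) : CoxeterPair where
  Node := DNode n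
  M := coxeterD n
  inP := {i | i.1.val + 1 ≠ n}

/-- `(E_6, D_5)`. -/
def pairE6 : CoxeterPair where
  Node := Fin 6
  M := CoxeterMatrix.E₆
  inP := {i | i ≠ 5}

/-- `(E_7, E_6)`. -/
def pairE7 : CoxeterPair where
  Node := Fin 7
  M := CoxeterMatrix.E₇
  inP := {i | i ≠ 6}

/-- The types of simply-laced Hermitian symmetric pairs:
`(A_n, A_{k-1} × A_{n-k})`, `(D_n, A_{n-1})`, `(D_n, D_{n-1})`, `(E_6, D_5)`, `(E_7, E_6)`. -/
inductive HermitianType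
  | A (n k : ℕ) (one_le : 1 ≤ k) (le : k ≤ n)
  | DA (n : ℕ) (three_le : 3 ≤ n)
  | DD (n : ℕ) (three_le : 3 ≤ n)
  | E6
  | E7

namespace HermitianType

def pair : HermitianType → CoxeterPair
  | .A n k _ _ => pairA (n + 1) k
  | .DA n _ => pairDA n
  | .DD n _ => pairDD n
  | .E6 => pairE6
  | .E7 => pairE7

/-- The pair `(W, P)^τ` of smaller rank (its type does not depend on `τ`):
`(A_{n-2}, A_{k-2} × A_{n-k-1})`, `(D_{n-2}, A_{n-3})`, `(A_1, A_0)`, `(A_5, A_4)`,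
`(D_6, D_5)`. -/
def contract : HermitianType → CoxeterPair
  | .A n k _ _ => pairA (n - 1) (k - 1)
  | .DA n _ => pairDA (n - 2)
  | .DD _ _ => pairA 2 1
  | .E6 => pairA 6 5
  | .E7 => pairDD 6

end HermitianType

/-! ### Coset diagrams: labellings of points by `∧` (`true`) and `∨` (`false`) -/

/-- The involution of the signed points `±p` (with `(p, false)` for `p` and `(p, true)` for `-p`)
that exchanges `l` and `r`, and flips the two signs if `flip` is true. -/
def signedSwap {n : ℕ} (l r : Fin n) (flip : Bool) : Equiv.Perm (Fin n × Bool) where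
  toFun x := (Equiv.swap l r x.1, if x.1 = l ∨ x.1 = r then xor x.2 flip else x.2)
  invFun x := (Equiv.swap l r x.1, if x.1 = l ∨ x.1 = r then xor x.2 flip else x.2)
  left_inv := by
    rintro ⟨p, b⟩
    by_cases h1 : p = l
    · subst h1; cases b <;> cases flip <;> simp
    by_cases h2 : p = r
    · subst h2; cases b <;> cases flip <;> simp
    simp [Equiv.swap_apply_of_ne_of_ne h1 h2, h1, h2]
  right_inv := by
    rintro ⟨p, b⟩
    by_cases h1 : p = l
    · subst h1; cases b <;> cases flip <;> simp
    by_cases h2 : p = r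
    · subst h2; cases b <;> cases flip <;> simp
    simp [Equiv.swap_apply_of_ne_of_ne h1 h2, h1, h2]

/-- The (signed) permutation action of `W` behind the coset diagrams. The simple reflection `s`
exchanges the labels in the neighbouring positions `left s`, `right s`, and also flips them if
`beaded s`. -/
structure ArrowModel (X : CoxeterPair) where
  size : ℕ
  /-- the diagram of `∅` -/
  start : Fin size → Bool
  left : X.Node → Fin size
  right : X.Node → Fin size
  beaded : X.Node → Bool
  liftable : X.M.IsLiftable fun s => signedSwap (left s) (right s) (beaded s)

/-- The diagram of the coset `P w`: the labelling obtained from that of `∅` under the right action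
of `w`. -/
noncomputable def ArrowModel.diagram {X : CoxeterPair} (m : ArrowModel X) (w : X.W) :
    Fin m.size → Bool := fun p =>
  let y := X.cs.lift ⟨_, m.liftable⟩ w (p, false)
  xor (m.start y.1) y.2

theorem signedSwap_sq {n : ℕ} (l r : Fin n) (c : Bool) :
    signedSwap l r c * signedSwap l r c = 1 := by
  ext1 x
  exact (signedSwap l r c).left_inv x

theorem signedSwap_comm {n : ℕ} (l r l' r' : Fin n) (c c' : Bool)
    (h : l ≠ l' ∧ l ≠ r' ∧ r ≠ l' ∧ r ≠ r') :
    (signedSwap l r c * signedSwap l' r' c') ^ 2 = 1 := by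
  obtain ⟨h1, h2, h3, h4⟩ := h
  ext1 ⟨p, b⟩
  simp only [pow_two, Equiv.Perm.mul_apply, signedSwap, Equiv.coe_fn_mk, Equiv.swap_apply_def]
  by_cases e1 : p = l
  · subst e1; cases b <;> cases c <;> simp_all [Ne.symm]
  by_cases e2 : p = r
  · subst e2; cases b <;> cases c <;> simp_all [Ne.symm]
  by_cases e3 : p = l'
  · subst e3; cases b <;> cases c' <;> simp_all [Ne.symm]
  by_cases e4 : p = r'
  · subst e4; cases b <;> cases c' <;> simp_all [Ne.symm]
  simp_all

theorem signedSwap_same {n : ℕ} (l r : Fin n) (h : l ≠ r) (c c' : Bool) :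
    (signedSwap l r c * signedSwap l r c') ^ 2 = 1 := by
  ext1 ⟨p, b⟩
  simp only [pow_two, Equiv.Perm.mul_apply, signedSwap, Equiv.coe_fn_mk, Equiv.swap_apply_def]
  by_cases e1 : p = l
  · subst e1; cases b <;> cases c <;> cases c' <;> simp_all [Ne.symm]
  by_cases e2 : p = r
  · subst e2; cases b <;> cases c <;> cases c' <;> simp_all [Ne.symm]
  simp_all

theorem signedSwap_braid {n : ℕ} (l m r : Fin n) (h1 : l ≠ m) (h2 : m ≠ r) (h3 : l ≠ r)
    (c c' : Bool) : (signedSwap l m c * signedSwap m r c') ^ 3 = 1 := by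
  ext1 ⟨p, b⟩
  simp only [pow_succ, pow_zero, one_mul, Equiv.Perm.mul_apply, signedSwap, Equiv.coe_fn_mk,
    Equiv.swap_apply_def]
  by_cases e1 : p = l
  · subst e1; cases b <;> cases c <;> cases c' <;> simp_all [Ne.symm]
  by_cases e2 : p = r
  · subst e2; cases b <;> cases c <;> cases c' <;> simp_all [Ne.symm]
  by_cases e3 : p = m
  · subst e3; cases b <;> cases c <;> cases c' <;> simp_all [Ne.symm]
  simp_all

theorem signedSwap_braid' {n : ℕ} (l m r : Fin n) (h1 : l ≠ m) (h2 : m ≠ r) (h3 : l ≠ r)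
    (c c' : Bool) : (signedSwap m r c' * signedSwap l m c) ^ 3 = 1 := by
  have h := congrArg (·⁻¹) (signedSwap_braid l m r h1 h2 h3 c c')
  have e : ∀ (a b : Fin n) (d : Bool), (signedSwap a b d)⁻¹ = signedSwap a b d := fun a b d =>
    inv_eq_of_mul_eq_one_right (signedSwap_sq a b d)
  simpa [← inv_pow, mul_inv_rev, e] using h

/-- Coset diagrams of type `A`: `N` points, the first `k` of them labelled `∧` in `∅`. -/
def modelA (N k : ℕ) : ArrowModel (pairA N k) where
  size := N
  start p := decide (p.val < k)
  left (s : Fin (N - 1)) := ⟨s.val, by omega⟩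
  right (s : Fin (N - 1)) := ⟨s.val + 1, by omega⟩
  beaded _ := false
  liftable := by
    intro (s : Fin (N - 1)) (t : Fin (N - 1))
    change (_ : Equiv.Perm (Fin N × Bool)) ^ (if s = t then 1
      else (if (t : ℕ) + 1 = s ∨ (s : ℕ) + 1 = t then 3 else 2)) = 1
    by_cases h0 : s = t
    · subst h0
      simp [signedSwap_sq]
    have h0' : s.val ≠ t.val := fun e => h0 (Fin.ext e)
    rw [if_neg h0]
    by_cases h1 : (s : ℕ) + 1 = t
    · rw [if_pos (Or.inr h1)]
      have e : (⟨s.val + 1, by omega⟩ : Fin N) = ⟨t.val, by omega⟩ := Fin.ext h1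
      simp only [e]
      apply signedSwap_braid <;> simp only [ne_eq, Fin.mk.injEq] <;> omega
    by_cases h2 : (t : ℕ) + 1 = s
    · rw [if_pos (Or.inl h2)]
      have e : (⟨t.val + 1, by omega⟩ : Fin N) = ⟨s.val, by omega⟩ := Fin.ext h2
      simp only [e]
      apply signedSwap_braid' <;> simp only [ne_eq, Fin.mk.injEq] <;> omega
    rw [if_neg (by omega)]
    apply signedSwap_comm
    simp only [ne_eq, Fin.mk.injEq]
    omega

/-- Coset diagrams of type `(D_n, A_{n-1})`: `n` points, all labelled `∨` in `∅`. The reflection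
`s_i`, `i ≥ 1`, exchanges the labels of the `i`-th and the `(i+1)`-th point, and `s_{1''}` exchanges
and flips the labels of the first two points. -/
def modelDA (n : ℕ) : ArrowModel (pairDA n) where
  size := n
  start _ := false
  left (s : DNode n) := ⟨s.1.val - 1, by omega⟩
  right (s : DNode n) := ⟨s.1.val - 1 + 1, by have := s.2; omega⟩
  beaded (s : DNode n) := decide (s.1.val = 0)
  liftable := by
    intro (s : DNode n) (t : DNode n)
    have hn := s.2
    change (_ : Equiv.Perm (Fin n × Bool)) ^ (if s.1.val = t.1.val then 1
      else if (1 ≤ s.1.val ∧ s.1.val + 1 = t.1.val) ∨ (1 ≤ t.1.val ∧ t.1.val + 1 = s.1.val) ∨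
        (s.1.val = 0 ∧ t.1.val = 2) ∨ (t.1.val = 0 ∧ s.1.val = 2) then 3
      else 2) = 1
    by_cases h0 : s.1.val = t.1.val
    · have : s = t := Subtype.ext (Fin.ext h0)
      subst this
      simp [signedSwap_sq]
    rw [if_neg h0]
    by_cases h1 : (1 ≤ s.1.val ∧ s.1.val + 1 = t.1.val) ∨ (s.1.val = 0 ∧ t.1.val = 2)
    · rw [if_pos (by omega)]
      have e : (⟨s.1.val - 1 + 1, by omega⟩ : Fin n) = ⟨t.1.val - 1, by omega⟩ :=
        Fin.ext (by simp only; omega)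
      simp only [e]
      apply signedSwap_braid <;> simp only [ne_eq, Fin.mk.injEq] <;> omega
    by_cases h2 : (1 ≤ t.1.val ∧ t.1.val + 1 = s.1.val) ∨ (t.1.val = 0 ∧ s.1.val = 2)
    · rw [if_pos (by omega)]
      have e : (⟨t.1.val - 1 + 1, by omega⟩ : Fin n) = ⟨s.1.val - 1, by omega⟩ :=
        Fin.ext (by simp only; omega)
      simp only [e]
      apply signedSwap_braid' <;> simp only [ne_eq, Fin.mk.injEq] <;> omega
    rw [if_neg (by omega)]
    by_cases h3 : s.1.val - 1 = t.1.val - 1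
    · have e : (⟨s.1.val - 1, by omega⟩ : Fin n) = ⟨t.1.val - 1, by omega⟩ := Fin.ext h3
      have e' : (⟨s.1.val - 1 + 1, by omega⟩ : Fin n) = ⟨t.1.val - 1 + 1, by omega⟩ :=
        Fin.ext (by simp only; omega)
      simp only [e, e']
      apply signedSwap_same
      simp only [ne_eq, Fin.mk.injEq]
      omega
    apply signedSwap_comm
    simp only [ne_eq, Fin.mk.injEq]
    omega

/-! ### Oriented Temperley–Lieb diagrams -/

/-- A decorated tangle on `n` southern vertices (`Sum.inl`) and `n` northern vertices (`Sum.inr`)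
without closed loops, recorded by which vertices its strands join, and by whether the strand
through a vertex carries a bead. -/
@[ext]
structure Tangle (n : ℕ) where
  partner : Fin n ⊕ Fin n → Fin n ⊕ Fin n
  bead : Fin n ⊕ Fin n → Bool

namespace Tangle

/-- The identity tangle, with `n` undecorated propagating strands. -/
def one (n : ℕ) : Tangle n where
  partner := Sum.swap
  bead _ := false

/-- The product `d e`, with `e` placed above `d`, where `e` is the generator that has a northern and
a southern arc joining the vertices `l` and `r`, both with a bead if `c` is true, and `n - 2`
vertical strands. The southern arc of `e` connects the strands of `d` that end at `l` and `r`; two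
beads on the same strand cancel. (If `d` itself has a northern arc from `l` to `r`, then a closed
loop appears, and it is discarded.) -/
def stack {n : ℕ} (d : Tangle n) (l r : Fin n) (c : Bool) : Tangle n where
  partner x :=
    if x = Sum.inr l then Sum.inr r
    else if x = Sum.inr r then Sum.inr l
    else if x = d.partner (Sum.inr l) then d.partner (Sum.inr r)
    else if x = d.partner (Sum.inr r) then d.partner (Sum.inr l)
    else d.partner x
  bead x :=
    if x = Sum.inr l ∨ x = Sum.inr r then c
    else if x = d.partner (Sum.inr l) ∨ x = d.partner (Sum.inr r) then
      xor (xor (d.bead (Sum.inr l)) c) (d.bead (Sum.inr r))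
    else d.bead x

end Tangle

/-- The product `e_{i_1} e_{i_2} ⋯ e_{i_k}` of the generators along a word. -/
def ArrowModel.wordTangle {X : CoxeterPair} (m : ArrowModel X) (ω : List X.Node) :
    Tangle m.size :=
  ω.foldl (fun d s => d.stack (m.left s) (m.right s) (m.beaded s)) (Tangle.one m.size)

/-- A tangle with labels (`true` for `∧`, `false` for `∨`) on its two boundaries. -/
@[ext]
structure LabelledTangle (n : ℕ) extends Tangle n where
  south : Fin n → Bool
  north : Fin n → Bool

/-- The northern half of a labelled tangle: `partner j` is the other end of the northern arc at `j`,
or `none` if the strand at `j` is propagating. -/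
@[ext]
structure HalfDiagram (n : ℕ) where
  label : Fin n → Bool
  partner : Fin n → Option (Fin n)
  bead : Fin n → Bool

namespace LabelledTangle

variable {n : ℕ}

/-- Whether the arrow at a vertex points into its strand. -/
def pointsIn (D : LabelledTangle n) : Fin n ⊕ Fin n → Bool :=
  Sum.elim D.south (fun j => !D.north j)

/-- Every undecorated strand is oriented (one arrow points into it and the other out of it) and
every decorated strand is flip-oriented (both arrows point into it, or both out of it). -/
def IsOriented (D : LabelledTangle n) : Prop :=
  ∀ x, if D.bead x then D.pointsIn x = D.pointsIn (D.partner x)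
    else D.pointsIn x ≠ D.pointsIn (D.partner x)

def northernHalf (D : LabelledTangle n) : HalfDiagram n where
  label := D.north
  partner j := (D.partner (Sum.inr j)).elim (fun _ => none) some
  bead j := D.bead (Sum.inr j)

end LabelledTangle

/-- The labelled tangle `e_S = ∅ e_{w(S)} x` of a path `S` from `∅` to `x`. -/
noncomputable def ArrowModel.diagramOfPath {X : CoxeterPair} (m : ArrowModel X) {x : X.Coset}
    (S : X.Path x) : LabelledTangle m.size where
  toTangle := m.wordTangle S.weight
  south := m.diagram X.origin.val
  north := m.diagram x.val

/-- The order-preserving injection with image the complement of `{l, l + 1}`. -/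
def skipPair {n : ℕ} (l : ℕ) (j : Fin (n - 2)) : Fin n :=
  if j.val < l then ⟨j.val, by omega⟩ else ⟨j.val + 2, by omega⟩

/-- Flips the first label (if there is one). -/
def flipFirstLabel {n : ℕ} (x : Fin n → Bool) : Fin n → Bool :=
  fun j => if j.val = 0 then !x j else x j

namespace HalfDiagram

variable {n : ℕ}

/-- The degree of the strand at the northern vertex `j`: a northern arc has degree `1` if its
rightmost vertex is labelled `∨`, all other strands have degree `0`. -/
def strandDegree (H : HalfDiagram n) (j : Fin n) : ℤ :=
  match H.partner j with
  | none => 0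
  | some q => if H.label (max j q) then 0 else 1

/-- There is a northern arc of degree `0` from `l` to `r`, with a bead exactly if `c` is true. -/
def HasDegreeZeroArc (H : HalfDiagram n) (l r : Fin n) (c : Bool) : Prop :=
  H.partner l = some r ∧ H.partner r = some l ∧ H.bead l = c ∧ H.bead r = c ∧
    H.strandDegree l = 0

/-- `H'` is obtained from `H` by deleting the arc that joins the vertices `l` and `l + 1`, together
with these two vertices. -/
def IsArcDeletion (H : HalfDiagram n) (l : ℕ) (H' : HalfDiagram (n - 2)) : Prop :=
  ∀ j, H'.label j = H.label (skipPair l j) ∧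
    H.partner (skipPair l j) = (H'.partner j).map (skipPair l) ∧
    H'.bead j = H.bead (skipPair l j)

/-- Flips the first label, and adds a bead to the strand at the first vertex or removes it. -/
def flipFirst (H : HalfDiagram n) : HalfDiagram n where
  label := flipFirstLabel H.label
  partner := H.partner
  bead j := if j.val = 0 ∨ ∃ q, H.partner j = some q ∧ q.val = 0 then !H.bead j else H.bead j

end HalfDiagram

namespace HermitianType

/-- In the types `(A_n, A_{k-1} × A_{n-k})` and `(D_n, A_{n-1})`, `ψ` deletes the labels in the two
positions exchanged by `τ` from the coset diagram. In the second type, if `τ ≠ s_{1''}`, this leaves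
an odd number of `∧`; such diagrams stand for the cosets of the isomorphic copy of
`(D_{n-2}, A_{n-3})` in which the nodes `1` and `1''` are exchanged, and are identified with those
having an even number of `∧` by flipping the first label. In the other types there is no
condition. -/
def IsLabelDeletion : (H : HermitianType) → (τ : H.pair.Node) →
    (H.pair.Wall τ → H.contract.Coset) → Prop
  | .A n k _ _, τ, ψ => ∀ μ,
      (modelA (n - 1) (k - 1)).diagram (ψ μ).val =
        fun j : Fin (n + 1 - 2) =>
          (modelA (n + 1) k).diagram μ.1.val
            (skipPair ((modelA (n + 1) k).left τ).val j)
  | .DA n _, τ, ψ => ∀ μ,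
      let x : Fin (n - 2) → Bool := fun j =>
        (modelDA n).diagram μ.1.val (skipPair ((modelDA n).left τ).val j)
      (modelDA (n - 2)).diagram (ψ μ).val =
        if (modelDA n).beaded τ then x else flipFirstLabel x
  | .DD _ _, _, _ => True
  | .E6, _, _ => True
  | .E7, _, _ => True

/-- In the types `(A_n, A_{k-1} × A_{n-k})` and `(D_n, A_{n-1})`: the labelled tangles of the paths
`S` and `S'` are oriented Temperley–Lieb diagrams, the first has a northern arc of degree zero
joining the two vertices exchanged by `τ` (with a bead exactly for `τ = s_{1''}`), and the northern
half of the second is what remains of the northern half of the first when this arc is deleted (up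
to the identification of diagrams with an odd and an even number of `∧` in type `(D_n, A_{n-1})`,
`τ ≠ s_{1''}`). In the other types there is no condition. -/
def DeletesArc : (H : HermitianType) → (τ : H.pair.Node) →
    {x : H.pair.Coset} → H.pair.Path x → {y : H.contract.Coset} → H.contract.Path y → Prop
  | .A n k _ _, τ, _, S, _, S' =>
      let m := modelA (n + 1) k
      let D := m.diagramOfPath S
      let D' := (modelA (n - 1) (k - 1)).diagramOfPath S'
      D.IsOriented ∧ D'.IsOriented ∧
        D.northernHalf.HasDegreeZeroArc (m.left τ) (m.right τ) (m.beaded τ) ∧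
        D.northernHalf.IsArcDeletion (m.left τ).val D'.northernHalf
  | .DA n _, τ, _, S, _, S' =>
      let m := modelDA n
      let D := m.diagramOfPath S
      let D' := (modelDA (n - 2)).diagramOfPath S'
      D.IsOriented ∧ D'.IsOriented ∧
        D.northernHalf.HasDegreeZeroArc (m.left τ) (m.right τ) (m.beaded τ) ∧
        D.northernHalf.IsArcDeletion (m.left τ).val
          (if m.beaded τ then D'.northernHalf else D'.northernHalf.flipFirst)
  | .DD _ _, _, _, _, _, _ => True
  | .E6, _, _, _, _, _ => True
  | .E7, _, _, _, _, _ => True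

end HermitianType

/-! The cosets are the weights of a minuscule representation: every weight pairs with every simple
coroot to `-1`, `0` or `1`, and only the base point has no descent. `Minuscule` records exactly what
is needed of this. It follows that the reduced words of minimal representatives are the words that
climb from the base point, that the climbing words of a weight differ by commutations only
(`Climb.foldl_eq`), and that the Bruhat order is the weak order `Le` (`Climb.le_of_sublist`). An
edge labelled `i` starts at `x` exactly if the pairing `v x i` is nonzero; it is a loop of degree `v
x i`, or leads to `s i x` with degree `0`.

Hence the graded count of paths of a given weight, as a function of the end point, is produced by
linear operators `E` that satisfy Temperley–Lieb relations. Write `P y` for the count along a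
reduced path to `y`. Finite graded sets with the same Laurent polynomial are in degree-preserving
bijection, so (ii) amounts to `P (g b) (g a) = P b a` for an order isomorphism `g` from the weights
of the smaller pair onto the wall of `τ`. Such a `g` is a `Contraction`.

For adjacent nodes `τ`, `c` the relation `e_τ e_c e_τ = e_τ` makes `e_c` an isomorphism from the
image of `e_τ` onto that of `e_c`. On weights it is the bijection `phi` of the two walls, and it
respects the order and the counts (`Le.phi`, `P_phi`). As the Coxeter graphs are connected, one node
`τ` per pair is enough (`Contraction.transport`). At that node each generator of the smaller pair
acts on the wall like a word of the larger one (`Contraction.of_lift`): a letter commuting with `τ`,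
or, once in each of the types `E_6` and `E_7`, the five-letter word of `IsLift.of_branch` around the
branching node.

In the types without coset diagrams `ψ` is an arbitrary order isomorphism. Two of them differ by an
automorphism of the smaller poset, and these leave `P` invariant: a chain has only the identity, and
the quadric of `D_6` has in addition the one induced by the diagram automorphism.

In the types with coset diagrams, `phi` slides the arc at `τ` to the neighbouring pair of vertices,
so deletion of labels and arcs travels along the Coxeter graph together with the contraction
(`Deletes.phi`). The northern half of `e_S` depends only on the weight and the end point of `S`.
Therefore (iii) holds for every degree-preserving bijection as in (ii), and the deleted arc has
degree zero because `λ τ < λ` puts a `∧` at its right end. -/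

/-- Combinatorial data describing `P \ W` by weights with entries `-1, 0, 1`: the points of `Ω` are
the weights, `pt w` is the image of the base point under the right action of `w`, and `v x i` is the
pairing of the weight `x` with the simple coroot `i`. -/
structure Minuscule (X : CoxeterPair) where
  Ω : Type
  pt : X.W → Ω
  s : X.Node → Ω → Ω
  v : Ω → X.Node → ℤ
  L : Ω → ℤ
  pt_mul : ∀ w i, pt (w * X.cs.simple i) = s i (pt w)
  s_s : ∀ i x, s i (s i x) = x
  v_mem : ∀ x i, v x i = -1 ∨ v x i = 0 ∨ v x i = 1
  s_fix : ∀ x i, v x i = 0 → s i x = x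
  v_self : ∀ x i, v (s i x) i = - v x i
  v_comm : ∀ x i j, X.M i j = 2 → v (s i x) j = v x j
  v_adj : ∀ x i j, X.M i j = 3 → v (s i x) j = v x j + v x i
  simplyLaced : ∀ i j, i ≠ j → X.M i j = 2 ∨ X.M i j = 3
  L_s : ∀ x i, L (s i x) = L x + v x i
  L_one : L (pt 1) = 0
  L_bdd : ∃ B, ∀ x, B ≤ L x
  v_one_mem : ∀ i ∈ X.inP, v (pt 1) i = 0
  v_one_not_mem : ∀ i ∉ X.inP, v (pt 1) i = 1
  desc : ∀ x, x ≠ pt 1 → ∃ i, v x i = -1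

/-! ### Weights as minimal coset representatives -/

namespace Minuscule

variable {X : CoxeterPair} (m : Minuscule X)

/-- The base point. -/
abbrev o : m.Ω := m.pt 1

theorem L_o : m.L m.o = 0 := m.L_one

/-- A descent lowers the rank by one, the rank is bounded below, and only the base point, of rank
zero, has no descent. -/
theorem L_nonneg (x : m.Ω) : 0 ≤ m.L x := by
  obtain ⟨B, hB⟩ := m.L_bdd
  induction h : (m.L x - B).toNat using Nat.strong_induction_on generalizing x with
  | _ n ih =>
    by_cases hx : x = m.pt 1
    · rw [hx, m.L_one]
    obtain ⟨i, hi⟩ := m.desc x hx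
    have h1 := m.L_s x i
    have h2 := hB (m.s i x)
    have := ih ((m.L (m.s i x) - B).toNat) (by omega) (m.s i x) rfl
    omega

theorem eq_o_of_L {x : m.Ω} (h : m.L x ≤ 0) : x = m.o := by
  by_contra hx
  obtain ⟨i, hi⟩ := m.desc x hx
  have := m.L_s x i
  have := m.L_nonneg (m.s i x)
  omega

/-- Induction along descents. -/
theorem rec_L {p : m.Ω → Prop} (h : ∀ x, (∀ y, m.L y < m.L x → p y) → p x) (x : m.Ω) : p x := by
  induction hn : (m.L x).toNat using Nat.strong_induction_on generalizing x with
  | _ n ih =>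
    refine h x fun y hy => ih (m.L y).toNat ?_ y rfl
    have := m.L_nonneg x
    have := m.L_nonneg y
    omega

theorem v_down {x : m.Ω} {i : X.Node} (h : m.v x i = 1) : m.v (m.s i x) i = -1 := by
  rw [m.v_self, h]

theorem v_up {x : m.Ω} {i : X.Node} (h : m.v x i = -1) : m.v (m.s i x) i = 1 := by
  rw [m.v_self, h]; rfl

theorem s_ne {x : m.Ω} {i : X.Node} (h : m.v x i ≠ 0) : m.s i x ≠ x := by
  intro e
  have := m.L_s x i
  rw [e] at this
  omega

theorem M_symm (i j : X.Node) : X.M i j = X.M j i := X.M.symmetric i j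

/-- `Climb ω x`: the word `ω` climbs from the base point to `x`. -/
inductive Climb : List X.Node → m.Ω → Prop
  | nil : Climb [] m.o
  | snoc {ω x} (i : X.Node) (h : Climb ω x) (hv : m.v x i = 1) : Climb (ω ++ [i]) (m.s i x)

variable {m}

theorem Climb.length {ω : List X.Node} {x : m.Ω} (h : m.Climb ω x) : (ω.length : ℤ) = m.L x := by
  induction h with
  | nil => simp [m.L_one]
  | snoc i h hv ih => rw [m.L_s, hv]; simp [ih]

theorem Climb.pt {ω : List X.Node} {x : m.Ω} (h : m.Climb ω x) :
    m.pt (X.cs.wordProd ω) = x := by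
  induction h with
  | nil => simp
  | snoc i h hv ih => rw [X.cs.wordProd_append, X.cs.wordProd_singleton, m.pt_mul, ih]

theorem Climb.of_snoc {ω : List X.Node} {i : X.Node} {x : m.Ω} (h : m.Climb (ω ++ [i]) x) :
    m.Climb ω (m.s i x) ∧ m.v x i = -1 := by
  generalize e : ω ++ [i] = ω' at h
  cases h with
  | nil => simp at e
  | snoc j h hv =>
    obtain ⟨rfl, e2⟩ := List.append_inj' e rfl
    obtain rfl : i = j := by simpa using e2
    exact ⟨by rwa [m.s_s], m.v_down hv⟩

theorem exists_climb (x : m.Ω) : ∃ ω, m.Climb ω x := by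
  induction x using m.rec_L with
  | _ x ih =>
    by_cases hx : x = m.o
    · exact ⟨[], hx ▸ .nil⟩
    obtain ⟨i, hi⟩ := m.desc x hx
    obtain ⟨ω, h⟩ := ih (m.s i x) (by rw [m.L_s]; omega)
    exact ⟨_, by simpa [m.s_s] using Climb.snoc i h (m.v_up hi)⟩

theorem pt_surjective (x : m.Ω) : ∃ w, m.pt w = x :=
  let ⟨_, h⟩ := exists_climb x
  ⟨_, h.pt⟩

theorem comm_of_M {i j : X.Node} (h : X.M i j = 2) :
    X.cs.simple i * X.cs.simple j = X.cs.simple j * X.cs.simple i := by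
  have := X.cs.simple_mul_simple_pow i j
  rw [h, pow_two] at this
  have := mul_eq_one_iff_eq_inv.mp this
  rw [mul_inv_rev, X.cs.inv_simple, X.cs.inv_simple] at this
  exact this

theorem braid_of_M {i j : X.Node} (h : X.M i j = 3) :
    X.cs.simple i * X.cs.simple j * X.cs.simple i =
      X.cs.simple j * X.cs.simple i * X.cs.simple j := by
  have := X.cs.simple_mul_simple_pow i j
  rw [h, pow_succ, pow_two] at this
  have h2 : (X.cs.simple i * X.cs.simple j * X.cs.simple i) *
      (X.cs.simple j * X.cs.simple i * X.cs.simple j) = 1 := by simpa [mul_assoc] using this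
  have := mul_eq_one_iff_eq_inv.mp h2
  rw [mul_inv_rev, mul_inv_rev, X.cs.inv_simple, X.cs.inv_simple] at this
  rw [this, mul_assoc]

theorem s_comm {i j : X.Node} (h : X.M i j = 2) (x : m.Ω) :
    m.s j (m.s i x) = m.s i (m.s j x) := by
  obtain ⟨w, rfl⟩ := pt_surjective x
  rw [← m.pt_mul, ← m.pt_mul, ← m.pt_mul, ← m.pt_mul, mul_assoc, mul_assoc, comm_of_M h]

/-- Reflecting in one of two adjacent descents would bring the pairing with the other to `-2`. -/
theorem M_of_desc {x : m.Ω} {i j : X.Node} (hij : i ≠ j) (hi : m.v x i = -1)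
    (hj : m.v x j = -1) : X.M i j = 2 := by
  rcases m.simplyLaced i j hij with h | h
  · exact h
  have := m.v_adj x i j h
  have := m.v_mem (m.s i x) j
  omega

theorem M_of_asc {x : m.Ω} {i j : X.Node} (hij : i ≠ j) (hi : m.v x i = 1)
    (hj : m.v x j = 1) : X.M i j = 2 := by
  rcases m.simplyLaced i j hij with h | h
  · exact h
  have := m.v_adj x i j h
  have := m.v_mem (m.s i x) j
  omega

/-- Applying operators along a climbing word gives a result that depends only on the end point,
if the operators of commuting ascents commute. -/
theorem Climb.foldl_eq {Z : Type*} (a : Z → X.Node → Z) (z : Z)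
    (comm : ∀ (x : m.Ω) i j ω, i ≠ j → X.M i j = 2 → m.v x i = 1 → m.v x j = 1 → m.Climb ω x →
      a (a (ω.foldl a z) i) j = a (a (ω.foldl a z) j) i)
    {x : m.Ω} {ω ω' : List X.Node} (h : m.Climb ω x) (h' : m.Climb ω' x) :
    ω.foldl a z = ω'.foldl a z := by
  induction x using m.rec_L generalizing ω ω' with
  | _ x ih =>
    rcases List.eq_nil_or_concat' ω with rfl | ⟨ω, i, rfl⟩
    · have := h.length
      have h2 := h'.length
      rw [← this] at h2
      have : ω' = [] := by simpa using h2
      rw [this]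
    rcases List.eq_nil_or_concat' ω' with rfl | ⟨ω', j, rfl⟩
    · have := h.length
      have h2 := h'.length
      rw [← this] at h2
      simp at h2
      omega
    obtain ⟨h, hi⟩ := h.of_snoc
    obtain ⟨h', hj⟩ := h'.of_snoc
    simp only [List.foldl_append, List.foldl_cons, List.foldl_nil]
    by_cases hij : i = j
    · subst hij
      rw [ih _ (by rw [m.L_s]; omega) h h']
    have hM := M_of_desc hij hi hj
    have hM' := hM
    rw [M_symm] at hM'
    -- Diamond argument: both words may be replaced by words through the common lower vertex `s j (s
    -- i x)`, where the last two letters are commuting ascents.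
    obtain ⟨ω'', h''⟩ := exists_climb (m.s j (m.s i x))
    have v1 : m.v (m.s j (m.s i x)) j = 1 := by rw [m.v_self, m.v_comm _ _ _ hM, hj]; rfl
    have v2 : m.v (m.s j (m.s i x)) i = 1 := by
      rw [s_comm hM, m.v_self, m.v_comm _ _ _ hM', hi]; rfl
    have e1 := ih _ (by rw [m.L_s]; omega) h
      (show m.Climb (ω'' ++ [j]) (m.s i x) by simpa [m.s_s] using h''.snoc j v1)
    have e2 := ih _ (by rw [m.L_s]; omega) h'
      (show m.Climb (ω'' ++ [i]) (m.s j x) by simpa [s_comm hM, m.s_s] using h''.snoc i v2)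
    rw [e1, e2]
    simp only [List.foldl_append, List.foldl_cons, List.foldl_nil]
    exact (comm _ i j _ hij hM v2 v1 h'').symm

variable (m) in
/-- A climbing word to `x`. -/
noncomputable def word (x : m.Ω) : List X.Node := (exists_climb x).choose

theorem climb_word (x : m.Ω) : m.Climb (m.word x) x := (exists_climb x).choose_spec

variable (m) in
/-- The element of `W` given by the climbing words to `x`. -/
noncomputable def u (x : m.Ω) : X.W := X.cs.wordProd (m.word x)

theorem wordProd_eq_foldl (ω : List X.Node) :
    X.cs.wordProd ω = ω.foldl (fun w i => w * X.cs.simple i) 1 := by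
  induction ω using List.reverseRecOn with
  | nil => simp
  | append_singleton ω i ih => simp [X.cs.wordProd_append, ih]

/-- Right multiplications by commuting reflections commute, so the product along a climb depends on
its end point only. -/
theorem Climb.wordProd {x : m.Ω} {ω : List X.Node} (h : m.Climb ω x) :
    X.cs.wordProd ω = m.u x := by
  rw [u, wordProd_eq_foldl, wordProd_eq_foldl]
  refine h.foldl_eq _ _ (fun x i j ω _ hM _ _ _ => ?_) (climb_word x)
  simp only [mul_assoc, comm_of_M hM]

@[simp] theorem pt_u (x : m.Ω) : m.pt (m.u x) = x := (climb_word x).pt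

theorem u_s {x : m.Ω} {i : X.Node} (h : m.v x i = 1) : m.u (m.s i x) = m.u x * X.cs.simple i := by
  rw [← ((climb_word x).snoc i h).wordProd, X.cs.wordProd_append, X.cs.wordProd_singleton, u]

theorem u_s' {x : m.Ω} {i : X.Node} (h : m.v x i = -1) :
    m.u (m.s i x) = m.u x * X.cs.simple i := by
  have := u_s (m.v_up h)
  rw [m.s_s] at this
  rw [this, mul_assoc, X.cs.simple_mul_simple_self, mul_one]

@[simp] theorem u_o : m.u m.o = 1 := by
  rw [← (Climb.nil (m := m)).wordProd, X.cs.wordProd_nil]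

/-- `v` vanishing at `x` means that `s_i` stabilises the coset. -/
theorem u_mul_simple (x : m.Ω) (i : X.Node) :
    ∃ p ∈ X.parabolic, m.u x * X.cs.simple i = p * m.u (m.s i x) := by
  rcases m.v_mem x i with h | h | h
  · exact ⟨1, one_mem _, by rw [u_s' h, one_mul]⟩
  swap
  · exact ⟨1, one_mem _, by rw [u_s h, one_mul]⟩
  rw [m.s_fix x i h]
  induction x using m.rec_L generalizing i with
  | _ x ih =>
    by_cases hx : x = m.o
    · subst hx
      refine ⟨X.cs.simple i, Subgroup.subset_closure ⟨i, ?_, rfl⟩, by simp⟩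
      by_contra hi
      rw [m.v_one_not_mem i hi] at h
      exact one_ne_zero h
    obtain ⟨j, hj⟩ := m.desc x hx
    have hji : j ≠ i := by rintro rfl; omega
    have e1 : m.u x = m.u (m.s j x) * X.cs.simple j := by
      rw [u_s' hj, mul_assoc, X.cs.simple_mul_simple_self, mul_one]
    rcases m.simplyLaced j i hji with hM | hM
    · obtain ⟨p, hp, e⟩ := ih (m.s j x) (by rw [m.L_s]; omega) i (by rw [m.v_comm _ _ _ hM, h])
      refine ⟨p, hp, ?_⟩
      rw [e1, mul_assoc, comm_of_M hM, ← mul_assoc, e, mul_assoc]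
    -- Here `x` is reached by a climb ending in `i j`. The braid relation turns `i j i` into `j i
    -- j`, and the letter `j` is absorbed into `P` two steps further down.
    · have h1 : m.v (m.s j x) i = -1 := by rw [m.v_adj _ _ _ hM]; omega
      have hM' : X.M i j = 3 := by rw [M_symm, hM]
      have h2 : m.v (m.s i (m.s j x)) j = 0 := by
        rw [m.v_adj _ _ _ hM', m.v_self]; omega
      obtain ⟨p, hp, e⟩ := ih (m.s i (m.s j x)) (by rw [m.L_s, m.L_s]; omega) j h2
      have e2 : m.u x = m.u (m.s i (m.s j x)) * X.cs.simple i * X.cs.simple j := by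
        rw [e1, u_s' h1]
        simp only [mul_assoc, X.cs.simple_mul_simple_cancel_left]
      refine ⟨p, hp, ?_⟩
      have b := braid_of_M hM
      calc m.u x * X.cs.simple i
          = m.u (m.s i (m.s j x)) * (X.cs.simple i * X.cs.simple j * X.cs.simple i) := by
            rw [e2]; simp only [mul_assoc]
        _ = (m.u (m.s i (m.s j x)) * X.cs.simple j) * X.cs.simple i * X.cs.simple j := by
            rw [← b]; simp only [mul_assoc]
        _ = p * m.u x := by rw [e, e2]; simp only [mul_assoc]

theorem exists_eq_mul_u (w : X.W) : ∃ p ∈ X.parabolic, w = p * m.u (m.pt w) := by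
  induction w using X.cs.simple_induction_right with
  | one => exact ⟨1, one_mem _, by simp⟩
  | mul_simple_right w i ih =>
    obtain ⟨p, hp, e⟩ := ih
    obtain ⟨q, hq, e'⟩ := u_mul_simple (m.pt w) i
    refine ⟨p * q, mul_mem hp hq, ?_⟩
    rw [m.pt_mul, mul_assoc, ← e', ← mul_assoc, ← e]

theorem pt_parabolic {p : X.W} (hp : p ∈ X.parabolic) : m.pt p = m.o := by
  induction hp using Subgroup.closure_induction_right with
  | one => rfl
  | mul_right x hx y hy ih =>
    obtain ⟨i, hi, rfl⟩ := hy
    rw [m.pt_mul, ih, m.s_fix _ _ (m.v_one_mem i hi)]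
  | mul_inv_cancel x hx y hy ih =>
    obtain ⟨i, hi, rfl⟩ := hy
    rw [X.cs.inv_simple, m.pt_mul, ih, m.s_fix _ _ (m.v_one_mem i hi)]

theorem pt_parabolic_mul {p : X.W} (hp : p ∈ X.parabolic) (w : X.W) :
    m.pt (p * w) = m.pt w := by
  induction w using X.cs.simple_induction_right with
  | one => rw [mul_one, pt_parabolic hp]
  | mul_simple_right w i ih => rw [← mul_assoc, m.pt_mul, ih, m.pt_mul]

theorem L_pt_le (w : X.W) : m.L (m.pt w) ≤ X.cs.length w := by
  obtain ⟨ω, hω, rfl⟩ := X.cs.exists_isReduced w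
  rw [hω.eq]
  clear hω
  induction ω using List.reverseRecOn with
  | nil => simp [m.L_one]
  | append_singleton ω i ih =>
    rw [X.cs.wordProd_append, X.cs.wordProd_singleton, m.pt_mul, m.L_s]
    have := m.v_mem (m.pt (X.cs.wordProd ω)) i
    simp only [List.length_append, List.length_singleton]
    push_cast
    omega

/-- A letter raises the rank by at most one, so a word whose rank attains its length has to go up at
every letter. -/
theorem climb_of_length {ω : List X.Node} (h : (ω.length : ℤ) ≤ m.L (m.pt (X.cs.wordProd ω))) :
    m.Climb ω (m.pt (X.cs.wordProd ω)) := by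
  induction ω using List.reverseRecOn with
  | nil => simpa using Climb.nil
  | append_singleton ω i ih =>
    rw [X.cs.wordProd_append, X.cs.wordProd_singleton, m.pt_mul] at h ⊢
    rw [m.L_s] at h
    have h1 := m.v_mem (m.pt (X.cs.wordProd ω)) i
    have h2 := L_pt_le (m := m) (X.cs.wordProd ω)
    have h3 := X.cs.length_wordProd_le ω
    simp only [List.length_append, List.length_singleton] at h
    push_cast at h
    exact (ih (by omega)).snoc i (by omega)

theorem Climb.isReduced {ω : List X.Node} {x : m.Ω} (h : m.Climb ω x) : X.cs.IsReduced ω := by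
  have h1 := L_pt_le (m := m) (X.cs.wordProd ω)
  have h2 := X.cs.length_wordProd_le ω
  rw [h.pt, ← h.length] at h1
  exact le_antisymm h2 (by exact_mod_cast h1)

theorem length_u (x : m.Ω) : (X.cs.length (m.u x) : ℤ) = m.L x := by
  rw [u, (climb_word x).isReduced.eq, (climb_word x).length]

variable (m) in
/-- The minimal coset representative that corresponds to a weight. -/
noncomputable def coset (x : m.Ω) : X.Coset where
  val := m.u x
  minimal p hp := by
    have h := L_pt_le (m := m) (p * m.u x)
    rw [pt_parabolic_mul hp, pt_u, ← length_u] at h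
    exact_mod_cast h

variable (m) in
/-- The weight that corresponds to a minimal coset representative. -/
def wt (c : X.Coset) : m.Ω := m.pt c.val

@[simp] theorem wt_coset (x : m.Ω) : m.wt (m.coset x) = x := pt_u x

/-- The coset of `c` contains `u (wt c)`, whose length is the rank. Minimality of `c` gives one
inequality and `L_pt_le` the other. -/
theorem length_val (c : X.Coset) : (X.cs.length c.val : ℤ) = m.L (m.wt c) := by
  obtain ⟨p, hp, e⟩ := exists_eq_mul_u (m := m) c.val
  have h := c.minimal p⁻¹ (inv_mem hp)
  have e2 : p⁻¹ * c.val = m.u (m.pt c.val) := by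
    nth_rw 1 [e]
    rw [inv_mul_cancel_left]
  rw [e2] at h
  have h2 := L_pt_le (m := m) c.val
  have h3 := length_u (m.pt c.val)
  unfold wt
  omega

theorem climb_of_isReduced {c : X.Coset} {ω : List X.Node} (h : X.cs.IsReduced ω)
    (e : X.cs.wordProd ω = c.val) : m.Climb ω (m.wt c) := by
  have h1 := length_val (m := m) c
  have h2 := h.eq
  rw [e] at h2
  have := climb_of_length (m := m) (ω := ω) (by
    rw [e]
    unfold wt at h1
    omega)
  rwa [e] at this

/-- Reduced words of minimal representatives are climbing words, and all climbing words to a weight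
have the same product. -/
theorem val_eq_u (c : X.Coset) : c.val = m.u (m.wt c) := by
  obtain ⟨ω, h, e⟩ := X.cs.exists_isReduced c.val
  rw [e, (climb_of_isReduced (m := m) h e.symm).wordProd]

@[simp] theorem coset_wt (c : X.Coset) : m.coset (m.wt c) = c :=
  CoxeterPair.Coset.ext (val_eq_u c).symm

variable (m) in
/-- Minimal coset representatives correspond to weights. -/
noncomputable def cosetEquiv : m.Ω ≃ X.Coset := ⟨m.coset, m.wt, wt_coset, coset_wt⟩

theorem wt_injective : Function.Injective m.wt := m.cosetEquiv.symm.injective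

@[simp] theorem wt_origin : m.wt X.origin = m.o := rfl

/-! ### The weak order -/

variable (m) in
/-- The weak order on weights. -/
inductive Le (x : m.Ω) : m.Ω → Prop
  | refl : Le x x
  | step {y : m.Ω} (i : X.Node) (h : Le x y) (hv : m.v y i = 1) : Le x (m.s i y)

theorem Le.trans {x y z : m.Ω} (h : m.Le x y) (h' : m.Le y z) : m.Le x z := by
  induction h' with
  | refl => exact h
  | step i _ hv ih => exact ih.step i hv

theorem Le.L_le {x y : m.Ω} (h : m.Le x y) : m.L x ≤ m.L y ∧ (m.L x = m.L y → x = y) := by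
  induction h with
  | refl => simp
  | step i _ hv ih => rw [m.L_s, hv]; constructor <;> omega

theorem Le.antisymm {x y : m.Ω} (h : m.Le x y) (h' : m.Le y x) : x = y :=
  h.L_le.2 (by have := h.L_le.1; have := h'.L_le.1; omega)

theorem le_s {x : m.Ω} {i : X.Node} (h : m.v x i = 1) : m.Le x (m.s i x) := .step i .refl h

theorem s_le {x : m.Ω} {i : X.Node} (h : m.v x i = -1) : m.Le (m.s i x) x := by
  simpa [m.s_s] using le_s (m.v_up h)

theorem o_le (x : m.Ω) : m.Le m.o x := by
  obtain ⟨ω, h⟩ := exists_climb x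
  induction h with
  | nil => exact .refl
  | snoc i h hv ih => exact ih.step i hv

/-- The lifting property for a common ascent. -/
theorem Le.lift_up {x y : m.Ω} (h : m.Le x y) {i : X.Node} (hx : m.v x i = 1) :
    m.Le (m.s i x) y ∨ (m.v y i = 1 ∧ m.Le (m.s i x) (m.s i y)) := by
  induction h with
  | refl => exact .inr ⟨hx, .refl⟩
  | @step y j h hv ih =>
    rcases ih with ih | ⟨h1, ih⟩
    · exact .inl (ih.step j hv)
    by_cases hij : i = j
    · subst hij
      exact .inl ih
    have hM := M_of_asc (Ne.symm hij) hv h1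
    have hM' := M_of_asc hij h1 hv
    refine .inr ⟨by rw [m.v_comm _ _ _ hM, h1], ?_⟩
    rw [s_comm hM]
    exact ih.step j (by rw [m.v_comm _ _ _ hM', hv])

/-- The lifting property for a common descent. -/
theorem Le.lift_down {x y : m.Ω} (h : m.Le x y) {i : X.Node} (hy : m.v y i = -1) :
    m.Le x (m.s i y) ∨ (m.v x i = -1 ∧ m.Le (m.s i x) (m.s i y)) := by
  induction h with
  | refl => exact .inr ⟨hy, .refl⟩
  | @step y j h hv ih =>
    by_cases hij : i = j
    · subst hij
      exact .inl (by rwa [m.s_s])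
    have hM := M_of_desc hij hy (m.v_down hv)
    have hM' := hM
    rw [M_symm] at hM'
    have hy' : m.v y i = -1 := by rwa [m.v_comm _ _ _ hM'] at hy
    have hv' : m.v (m.s i y) j = 1 := by rwa [m.v_comm _ _ _ hM]
    rw [s_comm hM']
    rcases ih hy' with ih | ⟨h1, ih⟩
    · exact .inl (ih.step j hv')
    · exact .inr ⟨h1, ih.step j hv'⟩

theorem bruhatLE_of_le {x y : m.Ω} (h : m.Le x y) : X.BruhatLE (m.u x) (m.u y) := by
  suffices h' : ∃ ω υ, m.Climb ω y ∧ List.Sublist υ ω ∧ m.Climb υ x by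
    obtain ⟨ω, υ, h1, h2, h3⟩ := h'
    exact ⟨ω, h1.isReduced, h1.wordProd, υ, h2, h3.isReduced, h3.wordProd⟩
  induction h with
  | refl => exact ⟨_, _, climb_word x, List.Sublist.refl _, climb_word x⟩
  | step i _ hv ih =>
    obtain ⟨ω, υ, h1, h2, h3⟩ := ih
    exact ⟨_, υ, h1.snoc i hv, h2.trans (List.sublist_append_left _ _), h3⟩

/-- This makes the Bruhat order on the minuscule quotient agree with the weak order. If the subword
uses the last letter, that letter is removed from both words and put back by the lifting property.
-/
theorem Climb.le_of_sublist {ω υ : List X.Node} {x y : m.Ω} (hω : m.Climb ω y)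
    (h : List.Sublist υ ω) (hυ : m.Climb υ x) : m.Le x y := by
  induction hω generalizing υ x with
  | nil =>
    obtain rfl := List.sublist_nil.mp h
    have := hυ.length
    rw [m.eq_o_of_L (x := x) (by simp [← this])]
    exact .refl
  | @snoc ω y i hω hv ih =>
    obtain ⟨υ₁, υ₂, rfl, h1, h2⟩ := List.sublist_append_iff.mp h
    rcases List.eq_nil_or_concat' υ₂ with rfl | ⟨υ₃, j, rfl⟩
    · exact (ih h1 (by simpa using hυ)).step i hv
    · have h3 := h2.length_le
      simp only [List.length_append, List.length_singleton] at h3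
      obtain rfl : υ₃ = [] := by
        apply List.eq_nil_of_length_eq_zero
        omega
      obtain rfl : j = i := by simpa using h2
      simp only [List.nil_append] at hυ
      obtain ⟨h4, h5⟩ := hυ.of_snoc
      rcases (ih h1 h4).lift_up (m.v_up h5) with h6 | h6
      · rw [m.s_s] at h6
        exact h6.step j hv
      · rw [m.s_s] at h6
        exact h6.2

theorem le_of_bruhatLE {a b : X.Coset} (h : X.BruhatLE a.val b.val) : m.Le (m.wt a) (m.wt b) := by
  obtain ⟨ω, h1, h2, υ, h3, h4, h5⟩ := h
  exact (climb_of_isReduced h1 h2).le_of_sublist h3 (climb_of_isReduced h4 h5)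

theorem coset_le_iff {a b : X.Coset} : a ≤ b ↔ m.Le (m.wt a) (m.wt b) := by
  refine ⟨le_of_bruhatLE, fun h => ?_⟩
  have := bruhatLE_of_le h
  rwa [← val_eq_u, ← val_eq_u] at this

theorem length_le_of_bruhatLE {y w : X.W} (h : X.BruhatLE y w) :
    X.cs.length y ≤ X.cs.length w := by
  obtain ⟨ω, h1, h2, υ, h3, h4, h5⟩ := h
  rw [← h2, ← h5, h1.eq, h4.eq]
  exact h3.length_le

theorem val_mul_simple {c : X.Coset} {i : X.Node} (h : m.v (m.wt c) i ≠ 0) :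
    c.val * X.cs.simple i = m.u (m.s i (m.wt c)) := by
  rw [val_eq_u (m := m) c]
  rcases m.v_mem (m.wt c) i with h' | h' | h'
  · rw [u_s' h']
  · exact absurd h' h
  · rw [u_s h']

theorem bruhatLT_down_iff {c : X.Coset} {i : X.Node} :
    X.BruhatLT (c.val * X.cs.simple i) c.val ↔ m.v (m.wt c) i = -1 := by
  constructor
  · intro h
    by_cases h0 : m.v (m.wt c) i = 0
    -- If `s_i` fixes the weight, then the rank bounds the length of `c s_i` below by the length of
    -- `c`. The two lengths differ by one, so multiplication by `s_i` lengthens `c`.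
    · exfalso
      have h1 := length_le_of_bruhatLE h.1
      have h2 := L_pt_le (m := m) (c.val * X.cs.simple i)
      rw [m.pt_mul] at h2
      have h3 := length_val (m := m) c
      unfold wt at h0 h3
      rw [m.s_fix _ _ h0] at h2
      have := X.cs.length_mul_simple c.val i
      omega
    · have h1 := h.1
      rw [val_mul_simple h0, val_eq_u (m := m) c] at h1
      have h2 := length_le_of_bruhatLE h1
      have h3 := length_u (m.s i (m.wt c))
      have h4 := length_u (m.wt c)
      rw [m.L_s] at h3
      have := m.v_mem (m.wt c) i
      omega
  · intro h
    have h0 : m.v (m.wt c) i ≠ 0 := by omega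
    refine ⟨?_, fun e => ?_⟩
    · rw [val_mul_simple h0]
      rw [val_eq_u (m := m) c]
      exact bruhatLE_of_le (s_le h)
    · have := congrArg m.pt e
      rw [m.pt_mul] at this
      exact m.s_ne h0 this

theorem bruhatLT_up_iff {c : X.Coset} {i : X.Node} (h0 : m.v (m.wt c) i ≠ 0) :
    X.BruhatLT c.val (c.val * X.cs.simple i) ↔ m.v (m.wt c) i = 1 := by
  rw [val_mul_simple h0, val_eq_u (m := m) c]
  constructor
  · intro h
    have h2 := length_le_of_bruhatLE h.1
    have h3 := length_u (m.s i (m.wt c))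
    have h4 := length_u (m.wt c)
    rw [m.L_s] at h3
    have := m.v_mem (m.wt c) i
    omega
  · intro h
    refine ⟨bruhatLE_of_le (le_s h), fun e => ?_⟩
    have := congrArg m.pt e
    simp only [pt_u] at this
    exact m.s_ne h0 this.symm

theorem edge_iff {i : X.Node} {a b : X.Coset} :
    X.Edge i a b ↔ m.v (m.wt a) i = 1 ∧ m.wt b = m.s i (m.wt a) := by
  constructor
  · rintro ⟨h1, h2⟩
    have e : m.wt b = m.s i (m.wt a) := by
      rw [wt, h1, m.pt_mul, wt]
    refine ⟨?_, e⟩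
    have h3 := le_of_bruhatLE (m := m) h2.1
    have h0 : m.v (m.wt a) i ≠ 0 := by
      intro h0
      rw [m.s_fix _ _ h0] at e
      exact h2.2 (by rw [wt_injective e])
    have := h3.L_le.1
    rw [e, m.L_s] at this
    have := m.v_mem (m.wt a) i
    omega
  · rintro ⟨h1, h2⟩
    have h0 : m.v (m.wt a) i ≠ 0 := by omega
    have e : b.val = a.val * X.cs.simple i := by
      rw [val_mul_simple h0, val_eq_u (m := m) b, h2]
    exact ⟨e, by rw [e]; exact (bruhatLT_up_iff h0).2 h1⟩

/-- When the pairing is nonzero, exactly one Bruhat edge labelled `i` passes through `x`, with other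
end `s i x`. An extended edge chooses both of its ends freely on it. -/
theorem extEdge_iff {i : X.Node} {x y : X.Coset} :
    X.ExtEdge i x y ↔
      m.v (m.wt x) i ≠ 0 ∧ (m.wt y = m.wt x ∨ m.wt y = m.s i (m.wt x)) := by
  constructor
  · rintro ⟨a, b, h, hx, hy⟩
    obtain ⟨h1, h2⟩ := edge_iff (m := m).1 h
    have h3 := m.v_self (m.wt a) i
    rcases hx with rfl | rfl <;> rcases hy with rfl | rfl
    · exact ⟨by omega, .inl rfl⟩
    · exact ⟨by omega, .inr h2⟩
    · exact ⟨by rw [h2]; omega, .inr (by rw [h2, m.s_s])⟩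
    · exact ⟨by rw [h2]; omega, .inl rfl⟩
  · rintro ⟨h0, h⟩
    have hy : y = x ∨ y = m.coset (m.s i (m.wt x)) := by
      rcases h with h | h
      · exact .inl (wt_injective h)
      · exact .inr (by rw [← h, coset_wt])
    rcases m.v_mem (m.wt x) i with h1 | h1 | h1
    · exact ⟨m.coset (m.s i (m.wt x)), x,
        edge_iff.2 ⟨by rw [wt_coset, m.v_up h1], by rw [wt_coset, m.s_s]⟩, .inr rfl, hy.symm⟩
    · exact absurd h1 h0
    · exact ⟨x, m.coset (m.s i (m.wt x)), edge_iff.2 ⟨h1, by rw [wt_coset]⟩, .inl rfl, hy⟩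

open Classical in
theorem edgeDeg_eq {i : X.Node} {x y : X.Coset} (h : m.v (m.wt x) i ≠ 0) :
    X.edgeDeg i x y = if x = y then m.v (m.wt x) i else 0 := by
  unfold CoxeterPair.edgeDeg
  by_cases hxy : x = y
  · rw [if_pos hxy, if_pos hxy]
    by_cases h1 : m.v (m.wt x) i = 1
    · rw [if_pos ((bruhatLT_up_iff h).2 h1), h1]
    · rw [if_neg (mt (bruhatLT_up_iff h).1 h1)]
      have := m.v_mem (m.wt x) i
      omega
  · rw [if_neg hxy, if_neg hxy]

end Minuscule

/-! ### Graded path counts as Laurent polynomials -/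

namespace Minuscule

open LaurentPolynomial

variable {X X' : CoxeterPair} {m : Minuscule X} {m' : Minuscule X'}

variable (m) in
/-- The action of the Temperley–Lieb generator of node `i` on graded path counts. -/
noncomputable def E (f : m.Ω → ℤ[T;T⁻¹]) (i : X.Node) (x : m.Ω) : ℤ[T;T⁻¹] :=
  if m.v x i = 0 then 0 else T (m.v x i) * f x + f (m.s i x)

open Classical in
variable (m) in
/-- The graded count of paths of weight `ω`, by end point. -/
noncomputable def pathPoly (ω : List X.Node) : m.Ω → ℤ[T;T⁻¹] :=
  ω.foldl m.E fun x => if x = m.o then 1 else 0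

theorem pathPoly_snoc (ω : List X.Node) (i : X.Node) :
    m.pathPoly (ω ++ [i]) = m.E (m.pathPoly ω) i := by
  simp [pathPoly]

/-! ### Paths and path polynomials -/

variable (X) in
/-- The paths of a given weight. -/
abbrev Paths (c : X.Coset) (ω : List X.Node) : Type := {S : X.Path c // S.weight = ω}

section
variable (m)

/-- Both ends of an edge labelled `i` have nonzero pairing with `i`. -/
theorem paths_snoc_eq_zero {c : X.Coset} {i : X.Node} (h : m.v (m.wt c) i = 0) (ω : List X.Node) :
    IsEmpty (Paths X c (ω ++ [i])) := by
  constructor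
  rintro ⟨S, hS⟩
  cases S with
  | nil => simp [CoxeterPair.Path.weight] at hS
  | snoc S j hj =>
    simp only [CoxeterPair.Path.weight] at hS
    obtain rfl : j = i := by simpa using (List.append_inj' hS rfl).2
    obtain ⟨h1, h2 | h2⟩ := (extEdge_iff (m := m)).1 hj
    · rw [h2] at h
      exact h1 h
    · rw [h2, m.v_self] at h
      omega

/-- Extending paths by an edge that ends at `c`. -/
noncomputable def snocPath {c : X.Coset} {i : X.Node} (h : m.v (m.wt c) i ≠ 0) (ω : List X.Node) :
    Paths X c ω ⊕ Paths X (m.coset (m.s i (m.wt c))) ω → Paths X c (ω ++ [i])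
  | .inl S => ⟨.snoc S.1 i (extEdge_iff.2 ⟨h, .inl rfl⟩), by
      rw [CoxeterPair.Path.weight, S.2]⟩
  | .inr S => ⟨.snoc S.1 i (extEdge_iff (m := m).2 ⟨by rw [wt_coset, m.v_self]; omega, .inr (by
      rw [wt_coset, m.s_s])⟩), by rw [CoxeterPair.Path.weight, S.2]⟩

theorem coset_s_ne {c : X.Coset} {i : X.Node} (h : m.v (m.wt c) i ≠ 0) :
    m.coset (m.s i (m.wt c)) ≠ c := by
  intro e
  have := congrArg m.wt e
  rw [wt_coset] at this
  exact m.s_ne h this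

theorem snocPath_bijective {c : X.Coset} {i : X.Node} (h : m.v (m.wt c) i ≠ 0)
    (ω : List X.Node) : Function.Bijective (m.snocPath h ω) := by
  constructor
  · rintro (⟨S, hS⟩ | ⟨S, hS⟩) (⟨S', hS'⟩ | ⟨S', hS'⟩) e <;>
      simp only [snocPath, Subtype.mk.injEq, CoxeterPair.Path.snoc.injEq] at e
    · obtain ⟨-, e, -⟩ := e
      obtain rfl := eq_of_heq e
      rfl
    · exact absurd e.1.symm (m.coset_s_ne h)
    · exact absurd e.1 (m.coset_s_ne h)
    · obtain ⟨-, e, -⟩ := e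
      obtain rfl := eq_of_heq e
      rfl
  · rintro ⟨S, hS⟩
    cases S with
    | nil => simp [CoxeterPair.Path.weight] at hS
    | @snoc y _ S j hj =>
      simp only [CoxeterPair.Path.weight] at hS
      obtain ⟨h1, h2⟩ := List.append_inj' hS rfl
      obtain rfl : j = i := by simpa using h2
      obtain ⟨h3, h4 | h4⟩ := (extEdge_iff (m := m)).1 hj
      · obtain rfl := wt_injective h4
        exact ⟨.inl ⟨S, h1⟩, rfl⟩
      · obtain rfl : y = m.coset (m.s j (m.wt c)) := by
          rw [h4, m.s_s, coset_wt]
        exact ⟨.inr ⟨S, h1⟩, rfl⟩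

/-- The last edge of a path is a loop at its end point, of degree `v`, or comes from the reflected
vertex with degree zero. This is the recursion in `E`; finiteness is established by the same
induction. -/
theorem sum_paths (ω : List X.Node) (c : X.Coset) :
    ∃ _ : Fintype (Paths X c ω), ∑ S : Paths X c ω, T S.1.deg = m.pathPoly ω (m.wt c) := by
  induction ω using List.reverseRecOn generalizing c with
  | nil =>
    by_cases hc : c = X.origin
    · subst hc
      let _ : Unique (Paths X X.origin []) :=
        { default := ⟨.nil, rfl⟩
          uniq := by
            rintro ⟨S, hS⟩
            cases S with
            | nil => rfl
            | snoc S j hj => simp [CoxeterPair.Path.weight] at hS }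
      refine ⟨inferInstance, ?_⟩
      rw [Fintype.sum_unique]
      simp only [pathPoly, List.foldl_nil, wt_origin, if_true]
      exact T_zero
    · have : IsEmpty (Paths X c []) := by
        constructor
        rintro ⟨S, hS⟩
        cases S with
        | nil => exact hc rfl
        | snoc S j hj => simp [CoxeterPair.Path.weight] at hS
      refine ⟨Fintype.ofIsEmpty, ?_⟩
      simp only [pathPoly, List.foldl_nil, Finset.univ_eq_empty, Finset.sum_empty]
      rw [if_neg]
      exact fun e => hc (wt_injective (m := m) (by rw [e, wt_origin]))
  | append_singleton ω i ih =>
    rw [pathPoly_snoc, E]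
    by_cases h : m.v (m.wt c) i = 0
    · have := m.paths_snoc_eq_zero h ω
      exact ⟨Fintype.ofIsEmpty, by simp [h]⟩
    obtain ⟨_, h1⟩ := ih c
    obtain ⟨_, h2⟩ := ih (m.coset (m.s i (m.wt c)))
    let e := Equiv.ofBijective _ (m.snocPath_bijective h ω)
    refine ⟨Fintype.ofEquiv _ e, ?_⟩
    let _ := Fintype.ofEquiv _ e
    rw [if_neg h, ← h1, ← e.sum_comp, Fintype.sum_sum_type, Finset.mul_sum]
    congr 1
    · refine Finset.sum_congr rfl fun S _ => ?_
      rw [← T_add, add_comm]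
      congr 1
      change S.1.deg + X.edgeDeg i c c = _
      rw [edgeDeg_eq h, if_pos rfl]
    · rw [wt_coset] at h2
      rw [← h2]
      refine Finset.sum_congr rfl fun S _ => ?_
      congr 1
      change S.1.deg + X.edgeDeg i (m.coset (m.s i (m.wt c))) c = _
      rw [edgeDeg_eq (m := m) (by rw [wt_coset, m.v_self]; omega), if_neg (m.coset_s_ne h), add_zero]

end

theorem coeff_sum_T {A : Type*} [Fintype A] (f : A → ℤ) (d : ℤ) :
    (∑ a, T (f a) : ℤ[T;T⁻¹]).coeff d = Nat.card {a // f a = d} := by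
  classical
  rw [AddMonoidAlgebra.coeff_sum, Finset.sum_apply']
  simp only [T_apply, Nat.card_eq_fintype_card, Fintype.card_subtype, Finset.card_filter]
  push_cast
  rfl

/-- Graded finite sets with the same Poincaré polynomial are isomorphic. -/
theorem exists_equiv_of_sum_T_eq {A B : Type*} [Fintype A] [Fintype B] (f : A → ℤ) (g : B → ℤ)
    (h : (∑ a, T (f a) : ℤ[T;T⁻¹]) = ∑ b, T (g b)) : ∃ e : A ≃ B, ∀ a, g (e a) = f a := by
  have key (d : ℤ) : Nonempty ({a // f a = d} ≃ {b // g b = d}) := by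
    have := congrArg (fun p => p.coeff d) h
    simp only [coeff_sum_T] at this
    classical
    simp only [Nat.card_eq_fintype_card] at this
    exact ⟨Fintype.equivOfCardEq (by exact_mod_cast this)⟩
  let k := fun d => (key d).some
  refine ⟨(Equiv.sigmaFiberEquiv f).symm.trans
    ((Equiv.sigmaCongrRight fun d => k d).trans (Equiv.sigmaFiberEquiv g)), fun a => ?_⟩
  exact (k (f a) ⟨a, rfl⟩).2

end Minuscule

namespace Minuscule

open LaurentPolynomial

variable {X X' : CoxeterPair} {m : Minuscule X} {m' : Minuscule X'}

/-! ### The canonical basis -/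

theorem E_comm {i j : X.Node} (h : X.M i j = 2) (f : m.Ω → ℤ[T;T⁻¹]) :
    m.E (m.E f i) j = m.E (m.E f j) i := by
  have h' : X.M j i = 2 := by rw [M_symm, h]
  funext x
  simp only [E, m.v_comm _ _ _ h, m.v_comm _ _ _ h', s_comm h]
  split_ifs
  · rfl
  · simp
  · simp
  · ring

variable (m) in
/-- The graded numbers of paths that have the weight of a reduced path to `y`. -/
noncomputable def P (y : m.Ω) : m.Ω → ℤ[T;T⁻¹] := m.pathPoly (m.word y)

/-- Needed because the theorem allows any reduced path: operators of commuting nodes commute, so the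
counts depend on the end point of the climb only. -/
theorem Climb.pathPoly_eq {ω : List X.Node} {y : m.Ω} (h : m.Climb ω y) :
    m.pathPoly ω = m.P y :=
  h.foldl_eq _ _ (fun _ _ _ _ _ hM _ _ _ => E_comm hM _) (climb_word y)

theorem P_s {y : m.Ω} {i : X.Node} (h : m.v y i = 1) : m.P (m.s i y) = m.E (m.P y) i := by
  rw [← ((climb_word y).snoc i h).pathPoly_eq, pathPoly_snoc, P]

open Classical in
theorem P_o (x : m.Ω) : m.P m.o x = if x = m.o then 1 else 0 := by
  rw [← (Climb.nil (m := m)).pathPoly_eq]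
  rfl

theorem E_zero {f : m.Ω → ℤ[T;T⁻¹]} {i : X.Node} {x : m.Ω} (h : m.v x i = 0) :
    m.E f i x = 0 := if_pos h

theorem E_up {f : m.Ω → ℤ[T;T⁻¹]} {i : X.Node} {x : m.Ω} (h : m.v x i = 1) :
    m.E f i x = T 1 * f x + f (m.s i x) := by
  rw [E, if_neg (by omega), h]

theorem E_down {f : m.Ω → ℤ[T;T⁻¹]} {i : X.Node} {x : m.Ω} (h : m.v x i = -1) :
    m.E f i x = T (-1) * f x + f (m.s i x) := by
  rw [E, if_neg (by omega), h]

/-- With `P_self` this is unitriangularity for the weak order. Each letter of the climb either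
reflects the end point of the path or leaves it in place, and the lifting property keeps it below
the end point of the climb. -/
theorem P_le {y x : m.Ω} (h : m.P y x ≠ 0) : m.Le x y := by
  obtain ⟨ω, hω⟩ := exists_climb y
  induction hω generalizing x with
  | nil =>
    rw [P_o] at h
    have : x = m.o := by
      by_contra hx
      exact h (if_neg hx)
    exact this ▸ .refl
  | @snoc _ y i _ hv ih =>
    rw [P_s hv] at h
    have h0 : m.v x i ≠ 0 := fun h0 => h (E_zero h0)
    by_cases hx : m.P y x = 0
    · by_cases hx' : m.P y (m.s i x) = 0
      · exact absurd (by rw [E, hx, hx']; simp) h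
      have h1 := ih hx'
      rcases m.v_mem x i with h2 | h2 | h2
      · rcases h1.lift_up (m.v_up h2) with h3 | h3
        · rw [m.s_s] at h3
          exact h3.step i hv
        · rw [m.s_s] at h3
          exact h3.2
      · exact absurd h2 h0
      · exact ((le_s h2).trans h1).step i hv
    · exact (ih hx).step i hv

theorem P_self (y : m.Ω) : m.P y y = 1 := by
  obtain ⟨ω, hω⟩ := exists_climb y
  induction hω with
  | nil => rw [P_o, if_pos rfl]
  | @snoc _ y i _ hv ih =>
    rw [P_s hv, E_down (m.v_down hv), m.s_s, ih]
    have : m.P y (m.s i y) = 0 := by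
      by_contra h
      have := (P_le h).L_le.1
      rw [m.L_s] at this
      omega
    rw [this, mul_zero, zero_add]

/-- Membership in the image of the Temperley–Lieb generator of node `τ`. -/
def InIm (τ : X.Node) (f : m.Ω → ℤ[T;T⁻¹]) : Prop :=
  ∀ x, (m.v x τ = 0 → f x = 0) ∧ (m.v x τ = 1 → f x = T 1 * f (m.s τ x))

theorem inIm_E (τ : X.Node) (f : m.Ω → ℤ[T;T⁻¹]) : InIm τ (m.E f τ) := by
  intro x
  refine ⟨E_zero, fun h => ?_⟩
  rw [E_up h, E_down (m.v_down h), m.s_s, mul_add, ← mul_assoc, ← T_add]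
  simp [add_comm]

theorem inIm_P {y : m.Ω} {τ : X.Node} (h : m.v y τ = -1) : InIm τ (m.P y) := by
  have := P_s (m.v_up h)
  rw [m.s_s] at this
  rw [this]
  exact inIm_E _ _

/-! ### Walls of adjacent nodes -/

variable (m) in
/-- The bijection between the walls of two adjacent nodes `τ` and `c`. -/
noncomputable def phi (τ c : X.Node) (x : m.Ω) : m.Ω :=
  if m.v x c = 1 then m.s c x else m.s τ x

/-- The value `-1` is excluded, since reflection in `τ` would lower the pairing with `c` to `-2`. -/
theorem v_adj_wall {τ c : X.Node} (h : X.M τ c = 3) {x : m.Ω} (hx : m.v x τ = -1) :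
    m.v x c = 1 ∨ m.v x c = 0 := by
  have h1 := m.v_adj x τ c h
  have h2 := m.v_mem (m.s τ x) c
  have h3 := m.v_mem x c
  omega

theorem phi_up {τ c : X.Node} {x : m.Ω} (h : m.v x c = 1) : m.phi τ c x = m.s c x := if_pos h

theorem phi_down {τ c : X.Node} {x : m.Ω} (h : m.v x c = 0) : m.phi τ c x = m.s τ x :=
  if_neg (by omega)

theorem v_phi {τ c : X.Node} (h : X.M τ c = 3) {x : m.Ω} (hx : m.v x τ = -1) :
    m.v (m.phi τ c x) c = -1 := by
  rcases v_adj_wall h hx with h1 | h1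
  · rw [phi_up h1, m.v_down h1]
  · rw [phi_down h1, m.v_adj _ _ _ h]
    omega

/-- The two cases of `phi` are interchanged: after moving up by `c` the pairing with `τ` is `0`, and
after moving down by `τ` it is `1`. -/
theorem phi_phi {τ c : X.Node} (h : X.M τ c = 3) {x : m.Ω} (hx : m.v x τ = -1) :
    m.phi c τ (m.phi τ c x) = x := by
  have h' : X.M c τ = 3 := by rw [M_symm, h]
  rcases v_adj_wall h hx with h1 | h1
  · rw [phi_up h1, phi_down (by rw [m.v_adj _ _ _ h']; omega), m.s_s]
  · rw [phi_down h1, phi_up (m.v_up hx), m.s_s]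

/-- The local form of `e_τ e_c e_τ = e_τ`. One of the two summands of `E` vanishes because its
argument pairs to zero with `τ`. The other is `f x`, directly if `phi` goes up, and after `T 1`
cancels `T (-1)` if it goes down. -/
theorem E_phi {τ c : X.Node} (h : X.M τ c = 3) {f : m.Ω → ℤ[T;T⁻¹]} (hf : InIm τ f) {x : m.Ω}
    (hx : m.v x τ = -1) : m.E f c (m.phi τ c x) = f x := by
  have h' : X.M c τ = 3 := by rw [M_symm, h]
  rw [E_down (v_phi h hx)]
  rcases v_adj_wall h hx with h1 | h1
  · have h2 : m.v (m.s c x) τ = 0 := by rw [m.v_adj _ _ _ h']; omega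
    rw [phi_up h1, m.s_s, (hf _).1 h2, mul_zero, zero_add]
  · have h2 : m.v (m.s τ x) c = -1 := by rw [m.v_adj _ _ _ h]; omega
    have h3 : m.v (m.s c (m.s τ x)) τ = 0 := by
      rw [m.v_adj _ _ _ h', m.v_self]
      omega
    rw [phi_down h1, (hf _).1 h3, (hf _).2 (m.v_up hx), m.s_s, ← mul_assoc, ← T_add]
    simp

/-- If `phi` goes up at `y`, this is `E_phi` for one further letter `c` of the climb. If it goes
down, then `y` lies one letter `τ` above its image, and the same argument applies with `τ` and `c`
exchanged. -/
theorem P_phi {τ c : X.Node} (h : X.M τ c = 3) {x y : m.Ω} (hx : m.v x τ = -1)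
    (hy : m.v y τ = -1) : m.P (m.phi τ c y) (m.phi τ c x) = m.P y x := by
  have h' : X.M c τ = 3 := by rw [M_symm, h]
  rcases v_adj_wall h hy with h1 | h1
  · rw [phi_up h1, P_s h1, E_phi h (inIm_P hy) hx]
  · have h2 := v_phi h hy
    have h3 : y = m.s τ (m.phi τ c y) := by rw [phi_down h1, m.s_s]
    have h4 : m.v (m.phi τ c y) τ = 1 := by rw [phi_down h1, m.v_up hy]
    have := E_phi h' (inIm_P h2) (v_phi h hx)
    rw [phi_phi h hx, ← P_s h4, ← h3] at this
    exact this.symm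

/-- At each end `phi` goes up by `c` or down by `τ`. Every combination follows from transitivity and
the two lifting properties, with alternatives ruled out by the pairings on the wall. -/
theorem Le.phi {τ c : X.Node} (h : X.M τ c = 3) {x y : m.Ω} (hx : m.v x τ = -1)
    (hy : m.v y τ = -1) (hxy : m.Le x y) : m.Le (m.phi τ c x) (m.phi τ c y) := by
  have h' : X.M c τ = 3 := by rw [M_symm, h]
  rcases v_adj_wall h hx with h1 | h1 <;> rcases v_adj_wall h hy with h2 | h2
  · rw [phi_up h1, phi_up h2]
    rcases hxy.lift_up h1 with h3 | h3
    · exact h3.step c h2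
    · exact h3.2
  · rw [phi_up h1, phi_down h2]
    have h3 : m.Le (m.s c x) y := by
      rcases hxy.lift_up h1 with h3 | h3
      · exact h3
      · omega
    have h4 := m.v_adj x c τ h'
    rcases h3.lift_down hy with h5 | h5
    · exact h5
    · omega
  · rw [phi_down h1, phi_up h2]
    exact ((s_le hx).trans hxy).step c h2
  · rw [phi_down h1, phi_down h2]
    rcases hxy.lift_down hy with h3 | h3
    · exact (s_le hx).trans h3
    · exact h3.2

/-- `g` identifies the weights of a smaller pair with the wall of `τ`, compatibly with the orders
and with the graded path counts. -/
structure Contraction (m : Minuscule X) (m' : Minuscule X') (τ : X.Node) (g : m'.Ω → m.Ω) :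
    Prop where
  wall : ∀ y, m.v (g y) τ = -1
  inj : Function.Injective g
  surj : ∀ x, m.v x τ = -1 → ∃ y, g y = x
  le_iff : ∀ a b, m'.Le a b ↔ m.Le (g a) (g b)
  P_eq : ∀ a b, m.P (g b) (g a) = m'.P b a

/-- `phi` is an isomorphism of walls for both the order and the counts, with inverse the `phi` of
the exchanged nodes. So a contraction at one node yields one at each neighbour. -/
theorem Contraction.transport {τ c : X.Node} {g : m'.Ω → m.Ω} (hg : Contraction m m' τ g)
    (h : X.M τ c = 3) : Contraction m m' c (m.phi τ c ∘ g) := by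
  have h' : X.M c τ = 3 := by rw [M_symm, h]
  refine ⟨fun y => v_phi h (hg.wall y), fun a b e => hg.inj ?_, fun x hx => ?_, fun a b => ?_,
    fun a b => ?_⟩
  · have := congrArg (m.phi c τ) e
    simpa [phi_phi h (hg.wall _)] using this
  · obtain ⟨y, hy⟩ := hg.surj _ (v_phi h' hx)
    exact ⟨y, by rw [Function.comp_apply, hy, phi_phi h' hx]⟩
  · rw [hg.le_iff]
    refine ⟨fun e => e.phi h (hg.wall _) (hg.wall _), fun e => ?_⟩
    have := e.phi h' (v_phi h (hg.wall _)) (v_phi h (hg.wall _))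
    rwa [phi_phi h (hg.wall _), phi_phi h (hg.wall _)] at this
  · rw [Function.comp_apply, Function.comp_apply, P_phi h (hg.wall _) (hg.wall _), hg.P_eq]

/-! ### Lifting words to the wall -/

variable (m) in
/-- `ClimbFrom x ω y`: the word `ω` climbs from `x` to `y`. -/
def ClimbFrom (x : m.Ω) : List X.Node → m.Ω → Prop
  | [], y => x = y
  | i :: ω, y => m.v x i = 1 ∧ ClimbFrom (m.s i x) ω y

theorem ClimbFrom.le {x y : m.Ω} {ω : List X.Node} (h : m.ClimbFrom x ω y) : m.Le x y := by
  induction ω generalizing x with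
  | nil => exact h ▸ .refl
  | cons i ω ih => exact (le_s h.1).trans (ih h.2)

theorem ClimbFrom.P {x y : m.Ω} {ω : List X.Node} (h : m.ClimbFrom x ω y) :
    m.P y = ω.foldl m.E (m.P x) := by
  induction ω generalizing x with
  | nil => exact h ▸ rfl
  | cons i ω ih => rw [ih h.2, P_s h.1, List.foldl_cons]

/-- The word `ω` acts on the wall of `τ` like the node `j` of the smaller pair. -/
structure IsLift (m : Minuscule X) (m' : Minuscule X') (τ : X.Node) (g : m'.Ω → m.Ω)
    (j : X'.Node) (ω : List X.Node) : Prop where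
  climb : ∀ y, m'.v y j = 1 → m.ClimbFrom (g y) ω (g (m'.s j y))
  foldl : ∀ f, InIm τ f → ∀ y, ω.foldl m.E f (g y) = m'.E (fun z => f (g z)) j y

theorem Contraction.of_lift {τ : X.Node} {g : m'.Ω → m.Ω} (wall : ∀ y, m.v (g y) τ = -1)
    (inj : Function.Injective g) (surj : ∀ x, m.v x τ = -1 → ∃ y, g y = x)
    (lift : ∀ j, ∃ ω, IsLift m m' τ g j ω) (refl : ∀ a b, m.Le (g a) (g b) → m'.Le a b) :
    Contraction m m' τ g := by
  refine ⟨wall, inj, surj, fun a b => ⟨fun h => ?_, refl a b⟩, fun a b => ?_⟩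
  · induction h with
    | refl => exact .refl
    | step j _ hv ih =>
      obtain ⟨ω, hω⟩ := lift j
      exact ih.trans (hω.climb _ hv).le
  · obtain ⟨ω, hω⟩ := exists_climb b
    induction hω generalizing a with
    | nil =>
      rw [P_o]
      by_cases ha : a = m'.o
      · rw [if_pos ha, ha, P_self]
      · rw [if_neg ha]
        by_contra h
        exact ha ((refl _ _ (P_le h)).antisymm (o_le a))
    | snoc j _ hv ih =>
      obtain ⟨ω, hω⟩ := lift j
      rw [(hω.climb _ hv).P, hω.foldl _ (inIm_P (wall _)), P_s hv]
      simp only [ih]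

theorem IsLift.of_comm {τ i : X.Node} {g : m'.Ω → m.Ω} {j : X'.Node}
    (hv : ∀ y, m'.v y j = m.v (g y) i) (hs : ∀ y, g (m'.s j y) = m.s i (g y)) :
    IsLift m m' τ g j [i] := by
  refine ⟨fun y hy => ⟨by rw [← hv, hy], (hs y).symm⟩, fun f _ y => ?_⟩
  simp only [List.foldl_cons, List.foldl_nil, E, hv, hs]

/-- For `f` in the image of the generator of `c`, the generators of the two neighbours `a`, `b` of
`c` followed by that of `c` act like the generator of the reflection in the root `a + c + b`. -/
theorem foldl_E_neighbours {a b c : X.Node} (ha : X.M a c = 3) (hb : X.M b c = 3)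
    (hab : X.M a b = 2) {f : m.Ω → ℤ[T;T⁻¹]} (hf : InIm c f) {z : m.Ω} (hz : m.v z c = -1) :
    [a, b, c].foldl m.E f z =
      if m.v z a + m.v z b = 1 then 0
      else T (m.v z a + m.v z b - 1) * f z +
        f (if m.v z a = 1 then m.s c (m.s b (m.s a z)) else m.s a (m.s b (m.s c z))) := by
  have ha' : X.M c a = 3 := by rw [M_symm, ha]
  have hb' : X.M c b = 3 := by rw [M_symm, hb]
  have hab' : X.M b a = 2 := by rw [M_symm, hab]
  simp only [List.foldl_cons, List.foldl_nil]
  rw [E_down hz]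
  have w1 := m.v_adj z c a ha'
  have w2 := m.v_adj z c b hb'
  have w3 := m.v_adj z a c ha
  have w4 := m.v_adj z b c hb
  -- The pairings with `a` and `b` are `0` or `1`, so that with the root `a + b + c` is `1`, `0`,
  -- `0`, `-1` in the four cases.
  rcases v_adj_wall ha' hz with h1 | h1 <;> rcases v_adj_wall hb' hz with h2 | h2
  · rw [if_neg (by omega), if_pos h1, h1, h2, E_zero (x := m.s c z) (by omega), E_up h2, E_up h1,
      E_up (by rw [m.v_comm _ _ _ hab', h1]), (hf (m.s a z)).1 (by omega),
      (hf (m.s b z)).1 (by omega), (hf (m.s a (m.s b z))).2 (by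
        rw [m.v_adj _ _ _ ha, m.v_comm _ _ _ hab']
        omega), s_comm hab']
    rw [show T (-1) * (T 1 * (T 1 * f z + 0) + (T 1 * 0 + T 1 * f (m.s c (m.s b (m.s a z))))) + 0 =
      (T (-1) * T 1) * (T 1 * f z) + (T (-1) * T 1) * f (m.s c (m.s b (m.s a z))) by ring, ← T_add]
    simp
  · rw [if_pos (by omega), E_zero (x := z) h2, E_down (x := m.s c z) (by omega),
      E_zero (x := m.s c z) (by omega), E_zero (x := m.s b (m.s c z)) (by
        rw [m.v_comm _ _ _ hab']; omega)]
    simp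
  · rw [if_pos (by omega), E_up (x := z) h2, E_zero (x := z) h1, E_zero (x := m.s b z) (by
        rw [m.v_comm _ _ _ hab']; omega), E_zero (x := m.s c z) (by omega)]
    simp
  · have w5 := m.v_adj (m.s c z) a c ha
    have w6 := m.v_adj (m.s c z) b c hb
    have w7 := m.v_self z c
    rw [if_neg (by omega), if_neg (by omega), h1, h2, E_zero (x := z) h2,
      E_down (x := m.s c z) (by omega), E_down (x := m.s c z) (by omega),
      E_down (x := m.s b (m.s c z)) (by rw [m.v_comm _ _ _ hab']; omega),
      (hf (m.s a (m.s c z))).1 (by omega), (hf (m.s b (m.s c z))).1 (by omega),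
      (hf (m.s c z)).2 (by omega), m.s_s]
    rw [show T (-1) * 0 + (T (-1) * (T (-1) * (T 1 * f z) + 0) +
        (T (-1) * 0 + f (m.s a (m.s b (m.s c z))))) =
      (T (-1) * T 1) * (T (-1) * f z) + f (m.s a (m.s b (m.s c z))) by ring, ← T_add]
    simp

/-- The root `a + b + 2c + τ` is orthogonal to `τ`, and the pairing of `x` with it equals the
pairing of `phi τ c x` with `a + b + c`. Accordingly the letter `c` carries the wall of `τ` to that
of `c`, the letters `a`, `b`, `c` act there like a single generator, and `τ` carries the result
back. -/
theorem IsLift.of_branch {τ a b c : X.Node} (hτ : X.M τ c = 3) (ha : X.M a c = 3)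
    (hb : X.M b c = 3) (hab : X.M a b = 2) (haτ : X.M a τ = 2) (hbτ : X.M b τ = 2)
    {g : m'.Ω → m.Ω} {j : X'.Node} (wall : ∀ y, m.v (g y) τ = -1)
    (hv : ∀ y, m'.v y j = m.v (m.phi τ c (g y)) a + m.v (m.phi τ c (g y)) b - 1)
    (hs : ∀ y, m'.v y j ≠ 0 → m.phi τ c (g (m'.s j y)) =
      if m.v (m.phi τ c (g y)) a = 1 then m.s c (m.s b (m.s a (m.phi τ c (g y))))
      else m.s a (m.s b (m.s c (m.phi τ c (g y))))) :
    IsLift m m' τ g j [c, a, b, c, τ] := by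
  have hτ' : X.M c τ = 3 := by rw [M_symm, hτ]
  refine ⟨fun y hy => ?_, fun f hf y => ?_⟩
  · have hs := hs y (by omega)
    have hv := hv y
    have hz := v_phi hτ (wall y)
    have hx := wall y
    have e := phi_phi hτ (wall (m'.s j y))
    set x := g y
    set z := m.phi τ c x with hzdef
    have w1 := m.v_mem z a
    have w2 := m.v_mem z b
    have w3 : m.v (m.s a z) b = m.v z b := m.v_comm _ _ _ hab
    have w4 := m.v_adj (m.s a z) b c hb
    have w5 := m.v_adj z a c ha
    have w6 := m.v_comm (m.s a z) b τ hbτ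
    have w7 := m.v_comm z a τ haτ
    have w8 := m.v_adj (m.s b (m.s a z)) c τ hτ'
    have w9 := m.v_adj x c τ hτ'
    rw [if_pos (by omega)] at hs
    rw [hs] at e
    rcases v_adj_wall hτ hx with h1 | h1
    · have hz' : z = m.s c x := by rw [hzdef, phi_up h1]
      have hzτ : m.v z τ = 0 := by rw [hz']; omega
      rw [phi_up (by omega)] at e
      refine ⟨h1, ?_⟩
      rw [← hz']
      exact ⟨by omega, by omega, by omega, by omega, e⟩
    -- This case cannot occur: `z` pairs to `1` with `τ`, and climbing along `a`, `b`, `c` would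
    -- raise this to `2`.
    · have hz' : z = m.s τ x := by rw [hzdef, phi_down h1]
      have w10 := m.v_self x τ
      rw [← hz'] at w10
      have := m.v_mem (m.s c (m.s b (m.s a z))) τ
      omega
  have e : [c, a, b, c, τ].foldl m.E f = m.E ([a, b, c].foldl m.E (m.E f c)) τ := rfl
  have hz := v_phi hτ (wall y)
  have := E_phi hτ' (f := [a, b, c].foldl m.E (m.E f c)) (inIm_E _ _) hz
  rw [phi_phi hτ (wall y)] at this
  rw [e, this, foldl_E_neighbours ha hb hab (inIm_E _ _) hz]
  by_cases h0 : m'.v y j = 0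
  · rw [if_pos (by rw [hv] at h0; omega), E_zero h0]
  · rw [if_neg (by rw [hv] at h0; omega),
      show m'.E (fun z => f (g z)) j y = _ from if_neg h0, ← hs y h0, ← hv, E_phi hτ hf (wall _),
      E_phi hτ hf (wall _)]

/-! ### Reduced paths -/

theorem exists_path {ω : List X.Node} {x : m.Ω} (h : m.Climb ω x) :
    ∃ S : X.Path (m.coset x), S.weight = ω := by
  induction h with
  | nil =>
    have e : m.coset m.o = X.origin := wt_injective (m := m) (by simp)
    rw [e]
    exact ⟨.nil, rfl⟩
  | snoc i h hv ih =>
    obtain ⟨S, hS⟩ := ih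
    refine ⟨.snoc S i (extEdge_iff (m := m).2 ⟨by rw [wt_coset]; omega, .inr (by simp)⟩), ?_⟩
    rw [CoxeterPair.Path.weight, hS]

theorem L_le_weight {c : X.Coset} (S : X.Path c) : m.L (m.wt c) ≤ S.weight.length := by
  induction S with
  | nil => simp [L_one]
  | @snoc x y S i h ih =>
    obtain ⟨h1, h2⟩ := (extEdge_iff (m := m)).1 h
    rw [CoxeterPair.Path.weight, List.length_append, List.length_singleton]
    push_cast
    have := m.v_mem (m.wt x) i
    rcases h2 with h2 | h2
    · rw [h2]
      omega
    · rw [h2, m.L_s]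
      omega

theorem climb_weight {c : X.Coset} (S : X.Path c) (hS : S.weight.length ≤ m.L (m.wt c)) :
    m.Climb S.weight (m.wt c) := by
  induction S with
  | nil => exact .nil
  | @snoc x y S i h ih =>
    obtain ⟨h1, h2⟩ := (extEdge_iff (m := m)).1 h
    rw [CoxeterPair.Path.weight, List.length_append, List.length_singleton] at hS
    push_cast at hS
    have h3 := m.v_mem (m.wt x) i
    have h4 := L_le_weight (m := m) S
    rw [CoxeterPair.Path.weight]
    rcases h2 with h2 | h2
    · rw [h2] at hS
      omega
    · rw [h2, m.L_s] at hS
      rw [h2]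
      exact (ih (by omega)).snoc i (by omega)

/-- Some path follows a climb, so a shortest path has as many edges as the rank of its end point,
and each of them must go up. -/
theorem climb_of_path_isReduced {c : X.Coset} {S : X.Path c} (hS : S.IsReduced) :
    m.Climb S.weight (m.wt c) := by
  obtain ⟨ω, hω⟩ := exists_climb (m.wt c)
  apply climb_weight
  obtain ⟨S', hS'⟩ : ∃ S' : X.Path c, S'.weight = ω := by
    have := exists_path hω
    rwa [coset_wt] at this
  have := hS S'
  have := hω.length
  rw [hS'] at *
  omega

/-- No explicit bijection is needed: equal polynomials give equally many paths in every degree. -/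
theorem exists_equiv_paths {lam mu : X.Coset} {lam' mu' : X'.Coset} {S : X.Path mu}
    {S' : X'.Path mu'} (hS : S.IsReduced) (hS' : S'.IsReduced)
    (h : m.P (m.wt mu) (m.wt lam) = m'.P (m'.wt mu') (m'.wt lam')) :
    ∃ Φ : X.PathOfWeight lam S ≃ X'.PathOfWeight lam' S', ∀ R, (Φ R).1.deg = R.1.deg := by
  obtain ⟨_, h1⟩ := m.sum_paths S.weight lam
  obtain ⟨_, h2⟩ := m'.sum_paths S'.weight lam'
  rw [(climb_of_path_isReduced hS).pathPoly_eq] at h1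
  rw [(climb_of_path_isReduced hS').pathPoly_eq] at h2
  exact exists_equiv_of_sum_T_eq _ _ (h1.trans (h.trans h2.symm))

end Minuscule

namespace Minuscule

open LaurentPolynomial

variable {X X' : CoxeterPair} {m : Minuscule X} {m' : Minuscule X'}

/-- Contractions can be transported along the Coxeter graph, together with a relation `Q`. -/
theorem Contraction.transport_of_reachable (Q : X.Node → m.Ω → m'.Ω → Prop)
    (hQ : ∀ τ c x y, X.M τ c = 3 → m.v x τ = -1 → Q τ x y → Q c (m.phi τ c x) y)
    {τ₀ τ : X.Node} (h : Relation.ReflTransGen (fun i j => X.M i j = 3) τ₀ τ)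
    (h₀ : ∃ g, Contraction m m' τ₀ g ∧ ∀ y, Q τ₀ (g y) y) :
    ∃ g, Contraction m m' τ g ∧ ∀ y, Q τ (g y) y := by
  induction h with
  | refl => exact h₀
  | tail _ h ih =>
    obtain ⟨g, hg, hq⟩ := ih
    exact ⟨_, hg.transport h, fun y => hQ _ _ _ _ h (hg.wall y) (hq y)⟩

/-- The order isomorphism given by a contraction. -/
theorem Contraction.exists_orderIso {τ : X.Node} {g : m'.Ω → m.Ω} (hg : Contraction m m' τ g) :
    ∃ ψ : X.Wall τ ≃o X'.Coset, ∀ μ, g (m'.wt (ψ μ)) = m.wt μ.1 := by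
  let f : X'.Coset → X.Wall τ := fun c =>
    ⟨m.coset (g (m'.wt c)), bruhatLT_down_iff.2 (by rw [wt_coset, hg.wall])⟩
  have hf : ∀ c, m.wt (f c).1 = g (m'.wt c) := fun c => wt_coset _
  have hb : Function.Bijective f := by
    refine ⟨fun a b e => ?_, fun μ => ?_⟩
    · have := congrArg (fun μ => m.wt μ.1) e
      simp only [hf] at this
      exact wt_injective (hg.inj this)
    · obtain ⟨y, hy⟩ := hg.surj _ (bruhatLT_down_iff.1 μ.2)
      refine ⟨m'.coset y, Subtype.ext (wt_injective (m := m) ?_)⟩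
      rw [hf, wt_coset, hy]
  let ψ : X'.Coset ≃o X.Wall τ :=
    { Equiv.ofBijective f hb with
      map_rel_iff' := by
        intro a b
        change (f a).1 ≤ (f b).1 ↔ a ≤ b
        rw [coset_le_iff (m := m), coset_le_iff (m := m'), hf, hf, ← hg.le_iff] }
  refine ⟨ψ.symm, fun μ => ?_⟩
  rw [← hf]
  change m.wt (ψ (ψ.symm μ)).1 = _
  rw [OrderIso.apply_symm_apply]

theorem Contraction.exists_equiv_paths {τ : X.Node} {g : m'.Ω → m.Ω} (hg : Contraction m m' τ g)
    {lam mu : X.Coset} {lam' mu' : X'.Coset} (hlam : g (m'.wt lam') = m.wt lam)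
    (hmu : g (m'.wt mu') = m.wt mu) {S : X.Path mu} {S' : X'.Path mu'} (hS : S.IsReduced)
    (hS' : S'.IsReduced) :
    ∃ Φ : X.PathOfWeight lam S ≃ X'.PathOfWeight lam' S', ∀ R, (Φ R).1.deg = R.1.deg :=
  Minuscule.exists_equiv_paths hS hS' (by rw [← hlam, ← hmu, hg.P_eq])

/-! ### Thin weight posets -/

variable (m) in
/-- The weak order is determined by the rank function. -/
def Thin : Prop := ∀ a b, m.L b = m.L a + 1 → ∃ i, m.v a i = 1 ∧ m.s i a = b

theorem Thin.le (h : m.Thin) {a b : m.Ω} (hab : m.L a < m.L b) : m.Le a b := by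
  induction b using m.rec_L with
  | _ b ih =>
    by_cases h1 : m.L b = m.L a + 1
    · obtain ⟨i, hi, rfl⟩ := h a b h1
      exact le_s hi
    · have hb : b ≠ m.o := by
        rintro rfl
        have := m.L_nonneg a
        have := m.L_o
        omega
      obtain ⟨i, hi⟩ := m.desc b hb
      have := m.L_s b i
      exact (ih _ (by omega) (by omega)).trans (s_le hi)

theorem Le.L_lt {a b : m.Ω} (h : m.Le a b) (hab : a ≠ b) : m.L a < m.L b := by
  have := h.L_le
  by_contra h2
  exact hab (this.2 (by omega))

/-- A chain that descends one rank at a time to the base point is mapped to a strictly decreasing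
chain of the same length. -/
theorem L_le_of_order_embedding {α : m.Ω → m.Ω} (inj : Function.Injective α)
    (hα : ∀ a b, m.Le a b → m.Le (α a) (α b)) (a : m.Ω) : m.L a ≤ m.L (α a) := by
  induction a using m.rec_L with
  | _ a ih =>
    by_cases ha : a = m.o
    · rw [ha, m.L_one]
      exact m.L_nonneg _
    obtain ⟨i, hi⟩ := m.desc a ha
    have h1 := m.L_s a i
    have h2 := ih _ (by omega : m.L (m.s i a) < m.L a)
    have h3 := (hα _ _ (s_le hi)).L_lt (fun e => m.s_ne (by omega) (inj e))
    omega

theorem L_aut (α : m.Ω ≃ m.Ω) (hα : ∀ a b, m.Le a b ↔ m.Le (α a) (α b))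
    (a : m.Ω) : m.L (α a) = m.L a := by
  have h1 := L_le_of_order_embedding α.injective (fun a b => (hα a b).1) a
  have h2 := L_le_of_order_embedding α.symm.injective
    (fun a b e => (hα _ _).2 (by simpa using e)) (α a)
  simp only [Equiv.symm_apply_apply] at h2
  omega

variable (m) in
/-- The graded path counts are invariant under all order automorphisms. -/
def AutInvariant : Prop :=
  ∀ α : m.Ω ≃ m.Ω, (∀ a b, m.Le a b ↔ m.Le (α a) (α b)) → ∀ a b, m.P (α b) (α a) = m.P b a

theorem autInvariant_of_L_injective (inj : Function.Injective m.L) :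
    m.AutInvariant := by
  intro α hα a b
  rw [inj (L_aut α hα a), inj (L_aut α hα b)]

theorem P_symmetry (σ : m.Ω ≃ m.Ω) (κ : X.Node → X.Node) (ho : σ m.o = m.o)
    (hv : ∀ x j, m.v (σ x) (κ j) = m.v x j) (hs : ∀ x j, σ (m.s j x) = m.s (κ j) (σ x))
    (a b : m.Ω) : m.P (σ b) (σ a) = m.P b a := by
  obtain ⟨ω, hω⟩ := exists_climb b
  induction hω generalizing a with
  | nil =>
    rw [ho, P_o, P_o]
    have : σ a = m.o ↔ a = m.o := by
      rw [← σ.injective.eq_iff (a := a), ho]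
    by_cases ha : a = m.o
    · rw [if_pos ha, if_pos (this.2 ha)]
    · rw [if_neg ha, if_neg (mt this.1 ha)]
  | snoc i _ h ih =>
    rw [hs, P_s h, P_s (by rw [hv, h])]
    simp only [E, hv, ← hs, ih]

/-- In a thin poset weights of different rank are comparable, so reflection of the order can only
fail at equal ranks, which `hL` excludes, or at reversed ones, where antisymmetry gives equality. -/
theorem Contraction.of_lift_thin {τ : X.Node} {g : m'.Ω → m.Ω} (h : m'.Thin)
    (wall : ∀ y, m.v (g y) τ = -1)
    (inj : Function.Injective g) (surj : ∀ x, m.v x τ = -1 → ∃ y, g y = x)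
    (lift : ∀ j, ∃ ω, IsLift m m' τ g j ω)
    (hL : ∀ a b, m'.L a = m'.L b → m.L (g a) = m.L (g b)) :
    Contraction m m' τ g := by
  refine .of_lift wall inj surj lift fun a b hab => ?_
  have up : ∀ {a b}, m'.Le a b → m.Le (g a) (g b) := by
    intro a b h
    induction h with
    | refl => exact .refl
    | step j _ hv ih =>
      obtain ⟨ω, hω⟩ := lift j
      exact ih.trans (hω.climb _ hv).le
  rcases lt_trichotomy (m'.L a) (m'.L b) with h1 | h1 | h1
  · exact h.le h1
  · rw [inj (hab.L_le.2 (hL _ _ h1))]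
    exact .refl
  · rw [inj (hab.antisymm (up (h.le h1)))]
    exact .refl

/-- A given `ψ` differs from the isomorphism `ψ₀` of the contraction by the automorphism `α` of the
smaller poset, which does not change the counts. -/
theorem Contraction.exists_equiv_paths_of_autInvariant {τ : X.Node} {g : m'.Ω → m.Ω}
    (hg : Contraction m m' τ g) (inv : m'.AutInvariant) (ψ : X.Wall τ ≃o X'.Coset)
    (lam mu : X.Wall τ) {S : X.Path mu.1} {S' : X'.Path (ψ mu)} (hS : S.IsReduced)
    (hS' : S'.IsReduced) :
    ∃ Φ : X.PathOfWeight lam.1 S ≃ X'.PathOfWeight (ψ lam) S', ∀ R, (Φ R).1.deg = R.1.deg := by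
  obtain ⟨ψ₀, h₀⟩ := hg.exists_orderIso
  apply Minuscule.exists_equiv_paths (m := m) (m' := m') hS hS'
  let α : m'.Ω ≃ m'.Ω := (m'.cosetEquiv.trans (ψ₀.symm.trans ψ).toEquiv).trans m'.cosetEquiv.symm
  have hα : ∀ μ, α (m'.wt (ψ₀ μ)) = m'.wt (ψ μ) := by
    intro μ
    change m'.wt (ψ (ψ₀.symm (m'.coset (m'.wt (ψ₀ μ))))) = _
    rw [coset_wt, OrderIso.symm_apply_apply]
  have hle : ∀ a b, m'.Le a b ↔ m'.Le (α a) (α b) := by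
    intro a b
    change _ ↔ m'.Le (m'.wt (ψ (ψ₀.symm (m'.coset a)))) (m'.wt (ψ (ψ₀.symm (m'.coset b))))
    rw [← coset_le_iff, OrderIso.le_iff_le, OrderIso.le_iff_le, coset_le_iff (m := m'), wt_coset,
      wt_coset]
  rw [← h₀, ← h₀, hg.P_eq, ← hα, ← hα, inv α hle]

/-! ### Constructions -/

/-- Weight data from an action by permutations. -/
noncomputable def ofPerm (X : CoxeterPair) {Ω : Type} (f : X.Node → Equiv.Perm Ω)
    (hf : X.M.IsLiftable f)
    (o : Ω) (v : Ω → X.Node → ℤ) (L : Ω → ℤ) (L_bdd : ∃ B, ∀ x, B ≤ L x)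
    (s_s : ∀ i x, f i (f i x) = x) (v_mem : ∀ x i, v x i = -1 ∨ v x i = 0 ∨ v x i = 1)
    (s_fix : ∀ x i, v x i = 0 → f i x = x) (v_self : ∀ x i, v (f i x) i = - v x i)
    (v_comm : ∀ x i j, X.M i j = 2 → v (f i x) j = v x j)
    (v_adj : ∀ x i j, X.M i j = 3 → v (f i x) j = v x j + v x i)
    (simplyLaced : ∀ i j, i ≠ j → X.M i j = 2 ∨ X.M i j = 3)
    (L_s : ∀ x i, L (f i x) = L x + v x i) (L_one : L o = 0)
    (v_one_mem : ∀ i ∈ X.inP, v o i = 0) (v_one_not_mem : ∀ i ∉ X.inP, v o i = 1)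
    (desc : ∀ x, x ≠ o → ∃ i, v x i = -1) : Minuscule X where
  Ω := Ω
  -- The inverse turns the left action by permutations into a right action.
  pt w := (X.cs.lift ⟨f, hf⟩ w)⁻¹ o
  s i := f i
  v := v
  L := L
  pt_mul w i := by
    have hi : (f i)⁻¹ = f i := inv_eq_of_mul_eq_one_right (Equiv.ext (s_s i))
    rw [map_mul, X.cs.lift_apply_simple, mul_inv_rev, hi, Equiv.Perm.mul_apply]
  s_s := s_s
  v_mem := v_mem
  s_fix := s_fix
  v_self := v_self
  v_comm := v_comm
  v_adj := v_adj
  simplyLaced := simplyLaced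
  L_s := L_s
  L_one := by simpa using L_one
  L_bdd := L_bdd
  v_one_mem := by simpa using v_one_mem
  v_one_not_mem := by simpa using v_one_not_mem
  desc := by simpa using desc

/-- The involution that exchanges the two members of each of the given pairs. -/
def pairSwap {N : ℕ} : List (Fin N × Fin N) → Fin N → Fin N
  | [], x => x
  | (a, b) :: l, x => if x = a then b else if x = b then a else pairSwap l x

/-- `1` on the first and `-1` on the second members of the given pairs. -/
def pairSign {N : ℕ} : List (Fin N × Fin N) → Fin N → ℤ
  | [], _ => 0
  | (a, b) :: l, x => if x = a then 1 else if x = b then -1 else pairSign l x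

theorem isLiftable_of_braid {B Ω : Type} (M : CoxeterMatrix B) (s : B → Ω → Ω)
    (s_s : ∀ i, Function.Involutive (s i))
    (h2 : ∀ i j, i ≠ j → M i j = 2 ∨ M i j = 3)
    (comm : ∀ i j x, M i j = 2 → s i (s j (s i (s j x))) = x)
    (braid : ∀ i j x, M i j = 3 → s i (s j (s i (s j (s i (s j x))))) = x) :
    M.IsLiftable fun i => (s_s i).toPerm := by
  intro i j
  by_cases hij : i = j
  · subst hij
    rw [M.diagonal, pow_one]
    exact Equiv.ext (s_s i)
  rcases h2 i j hij with h | h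
  · rw [h]
    exact Equiv.ext fun x => comm i j x h
  · rw [h]
    exact Equiv.ext fun x => braid i j x h

/-- Weight data on a finite set, from the edges of the Bruhat graph. -/
noncomputable def ofEdges (X : CoxeterPair) {N : ℕ} (e : X.Node → List (Fin N × Fin N))
    (o : Fin N) (L : Fin N → ℤ) (s_s : ∀ i, Function.Involutive (pairSwap (e i)))
    (comm : ∀ i j x, X.M i j = 2 → pairSwap (e i) (pairSwap (e j) (pairSwap (e i)
      (pairSwap (e j) x))) = x)
    (braid : ∀ i j x, X.M i j = 3 → pairSwap (e i) (pairSwap (e j) (pairSwap (e i)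
      (pairSwap (e j) (pairSwap (e i) (pairSwap (e j) x))))) = x)
    (v_self : ∀ x i, pairSign (e i) (pairSwap (e i) x) = - pairSign (e i) x)
    (v_comm : ∀ x i j, X.M i j = 2 → pairSign (e j) (pairSwap (e i) x) = pairSign (e j) x)
    (v_adj : ∀ x i j, X.M i j = 3 → pairSign (e j) (pairSwap (e i) x) =
      pairSign (e j) x + pairSign (e i) x)
    (simplyLaced : ∀ i j, i ≠ j → X.M i j = 2 ∨ X.M i j = 3)
    (L_s : ∀ x i, L (pairSwap (e i) x) = L x + pairSign (e i) x) (L_one : L o = 0)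
    (v_one_mem : ∀ i ∈ X.inP, pairSign (e i) o = 0)
    (v_one_not_mem : ∀ i ∉ X.inP, pairSign (e i) o = 1)
    (desc : ∀ x, x ≠ o → ∃ i, pairSign (e i) x = -1) : Minuscule X :=
  ofPerm X (fun i => (s_s i).toPerm)
    (isLiftable_of_braid X.M _ s_s simplyLaced comm braid) o (fun x i => pairSign (e i) x) L
    (by
      obtain ⟨B, hB⟩ := (Set.finite_range L).bddBelow
      exact ⟨B, fun x => hB ⟨x, rfl⟩⟩)
    s_s
    (by
      intro x i
      induction e i with
      | nil => simp [pairSign]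
      | cons p l ih =>
        simp only [pairSign]
        split_ifs
        · simp
        · simp
        · exact ih)
    (by
      intro x i
      change pairSign (e i) x = 0 → pairSwap (e i) x = x
      induction e i with
      | nil => simp [pairSwap]
      | cons p l ih =>
        simp only [pairSign, pairSwap]
        split_ifs
        · simp
        · simp
        · exact ih)
    v_self v_comm v_adj simplyLaced L_s L_one v_one_mem v_one_not_mem desc

end Minuscule

namespace Minuscule

/-! ### The quadrics `(D_n, D_{n-1})` -/

/-- The pairing of the signed point `±p` with the coroot of a node of `D_n`. -/
def quadricWeight (n : ℕ) (x : Fin n × Bool) (i : DNode n) : ℤ :=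
  (if x.2 then -1 else 1) *
    if i.1.val = 0 then (if x.1.val ≤ 1 then 1 else 0)
    else if x.1.val = i.1.val then 1 else if x.1.val + 1 = i.1.val then -1 else 0

/-- The rank of a signed point. -/
def quadricRank (n : ℕ) (x : Fin n × Bool) : ℤ :=
  n - 1 + if x.2 then (x.1.val : ℤ) else - x.1.val

/-- The reflections of `D_n` as signed permutations. -/
def quadricPerm (n : ℕ) (i : DNode n) : Equiv.Perm (Fin n × Bool) :=
  signedSwap ((modelDA n).left i) ((modelDA n).right i) ((modelDA n).beaded i)

theorem quadricPerm_apply {n : ℕ} (i : DNode n) (x : Fin n × Bool) :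
    ((quadricPerm n i x).1.val =
      if i.1.val = 0 then (if x.1.val = 0 then 1 else if x.1.val = 1 then 0 else x.1.val)
      else if x.1.val = i.1.val then i.1.val - 1 else if x.1.val + 1 = i.1.val then i.1.val
        else x.1.val) ∧
    ((quadricPerm n i x).2 =
      if i.1.val = 0 then (if x.1.val = 0 then !x.2 else if x.1.val = 1 then !x.2 else x.2)
      else x.2) := by
  obtain ⟨p, b⟩ := x
  simp only [quadricPerm, signedSwap, modelDA, Equiv.coe_fn_mk, Equiv.swap_apply_def, Fin.ext_iff]
  constructor
  · split_ifs <;> (try simp only) <;> omega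
  · by_cases h : i.1.val = 0
    · simp only [h, if_true, decide_true, Bool.xor_true]
      split_ifs <;> first | rfl | omega
    · simp [h]

theorem coxeterD_two {n : ℕ} {i j : DNode n} (h : coxeterD n i j = 2) :
    i.1.val ≠ j.1.val ∧ ¬(1 ≤ i.1.val ∧ i.1.val + 1 = j.1.val) ∧
      ¬(1 ≤ j.1.val ∧ j.1.val + 1 = i.1.val) ∧ ¬(i.1.val = 0 ∧ j.1.val = 2) ∧
      ¬(j.1.val = 0 ∧ i.1.val = 2) := by
  change (if _ then _ else _) = 2 at h
  split_ifs at h <;> omega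

theorem coxeterD_three {n : ℕ} {i j : DNode n} (h : coxeterD n i j = 3) :
    (1 ≤ i.1.val ∧ i.1.val + 1 = j.1.val) ∨ (1 ≤ j.1.val ∧ j.1.val + 1 = i.1.val) ∨
      (i.1.val = 0 ∧ j.1.val = 2) ∨ (j.1.val = 0 ∧ i.1.val = 2) := by
  change (if _ then _ else _) = 3 at h
  split_ifs at h <;> omega

theorem coxeterD_eq_three {n : ℕ} {i j : DNode n}
    (h : (1 ≤ i.1.val ∧ i.1.val + 1 = j.1.val) ∨ (1 ≤ j.1.val ∧ j.1.val + 1 = i.1.val) ∨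
      (i.1.val = 0 ∧ j.1.val = 2) ∨ (j.1.val = 0 ∧ i.1.val = 2)) : coxeterD n i j = 3 := by
  change (if _ then _ else _) = 3
  split_ifs <;> omega

theorem coxeterD_simplyLaced {n : ℕ} (i j : DNode n) (h : i ≠ j) :
    coxeterD n i j = 2 ∨ coxeterD n i j = 3 := by
  have h' : i.1.val ≠ j.1.val := fun e => h (Subtype.ext (Fin.ext e))
  change (if _ then _ else _) = 2 ∨ (if _ then _ else _) = 3
  simp only [if_neg h']
  split_ifs
  · exact .inr rfl
  · exact .inl rfl

theorem quadricWeight_perm {n : ℕ} (x : Fin n × Bool) (i j : DNode n) :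
    quadricWeight n (quadricPerm n i x) j =
      if i.1.val = j.1.val then - quadricWeight n x i
      else if coxeterD n i j = 3 then quadricWeight n x j + quadricWeight n x i
      else quadricWeight n x j := by
  obtain ⟨h1, h2⟩ := quadricPerm_apply i x
  obtain ⟨p, b⟩ := x
  unfold quadricWeight
  rw [h1, h2]
  by_cases hij : i.1.val = j.1.val
  · rw [if_pos hij]
    cases b <;> grind
  · rw [if_neg hij]
    by_cases h3 : coxeterD n i j = 3
    · rw [if_pos h3]
      have := coxeterD_three h3
      cases b <;> grind
    · rw [if_neg h3]
      have := (coxeterD_simplyLaced i j (fun e => hij (by rw [e]))).resolve_right h3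
      have := coxeterD_two this
      cases b <;> grind

theorem quadricPerm_self {n : ℕ} (i : DNode n) (x : Fin n × Bool) :
    quadricPerm n i (quadricPerm n i x) = x :=
  (quadricPerm n i).left_inv x

theorem quadricPerm_fix {n : ℕ} (i : DNode n) (x : Fin n × Bool) (h : quadricWeight n x i = 0) :
    quadricPerm n i x = x := by
  obtain ⟨h1, h2⟩ := quadricPerm_apply i x
  refine Prod.ext (Fin.ext ?_) ?_
  · rw [h1]
    unfold quadricWeight at h
    grind
  · rw [h2]
    unfold quadricWeight at h
    grind

/-- The weights of `(D_n, D_{n-1})`. -/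
noncomputable def quadric (n : ℕ) (hn : 3 ≤ n) : Minuscule (pairDD n) :=
  ofPerm (pairDD n) (quadricPerm n) (modelDA n).liftable (⟨n - 1, by omega⟩, false)
    (quadricWeight n) (quadricRank n)
    ⟨0, fun x => by unfold quadricRank; have := x.1.2; split_ifs <;> omega⟩
    quadricPerm_self
    (fun x i => by
      unfold quadricWeight
      cases x.2 <;> split_ifs <;> simp)
    (fun x i => quadricPerm_fix i x)
    (fun x i => (quadricWeight_perm x i i).trans (if_pos rfl))
    (fun x i j h => (quadricWeight_perm x i j).trans ((if_neg (coxeterD_two h).1).trans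
      (if_neg fun h' => by have := h'.symm.trans h; omega)))
    (fun x i j h => (quadricWeight_perm x i j).trans ((if_neg fun h' => by
      have := coxeterD_three h; omega).trans (if_pos h)))
    coxeterD_simplyLaced
    (fun x i => by
      obtain ⟨h1, h2⟩ := quadricPerm_apply (n := n) i x
      obtain ⟨p, b⟩ := x
      unfold quadricRank quadricWeight
      rw [h1, h2]
      cases b <;> grind)
    (by simp only [quadricRank]; grind)
    (fun i hi => by
      have h1 : i.1.val + 1 ≠ n := hi
      have h2 := i.1.2
      simp only [quadricWeight]
      grind)
    (fun i hi => by
      have h1 : i.1.val + 1 = n := by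
        by_contra h
        exact hi h
      simp only [quadricWeight]
      grind)
    -- A positive point `p` other than the last has the descent `p + 1`. A negative point has the
    -- descent `p`, which for the first point is the node `1''`.
    (fun x hx => by
      obtain ⟨⟨p, hp⟩, b⟩ := x
      cases b
      · have h1 : p + 1 < n := by
          by_contra h
          exact hx (Prod.ext (Fin.ext (by simp only; omega)) rfl)
        refine ⟨⟨⟨p + 1, h1⟩, by omega⟩, ?_⟩
        simp [quadricWeight]
      · refine ⟨⟨⟨p, hp⟩, by omega⟩, ?_⟩
        simp only [quadricWeight]
        grind)

end Minuscule

namespace Minuscule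

/-- The entries of a Coxeter matrix, as natural numbers. -/
def coxeterEntry {n : ℕ} (M : CoxeterMatrix (Fin n)) (i j : Fin n) : ℕ := M i j

/-! ### The projective spaces `(A_1, A_0)` and `(A_5, A_4)` -/

/-- The weights of `(A_1, A_0)`. -/
noncomputable def chain₂ : Minuscule (pairA 2 1) :=
  ofEdges (pairA 2 1) (N := 2) (fun _ => [(0, 1)]) 0 (fun x => x.val)
    (by change ∀ _ : Fin 1, _; unfold Function.Involutive; decide)
    (by change ∀ i j : Fin 1, ∀ _, coxeterEntry (CoxeterMatrix.A 1) i j = 2 → _; decide)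
    (by change ∀ i j : Fin 1, ∀ _, coxeterEntry (CoxeterMatrix.A 1) i j = 3 → _; decide)
    (by change ∀ _, ∀ _ : Fin 1, _; decide)
    (by change ∀ _, ∀ i j : Fin 1, coxeterEntry (CoxeterMatrix.A 1) i j = 2 → _; decide)
    (by change ∀ _, ∀ i j : Fin 1, coxeterEntry (CoxeterMatrix.A 1) i j = 3 → _; decide)
    (by
      change ∀ i j : Fin 1, i ≠ j → coxeterEntry (CoxeterMatrix.A 1) i j = 2 ∨
        coxeterEntry (CoxeterMatrix.A 1) i j = 3
      decide)
    (by change ∀ _, ∀ _ : Fin 1, _; decide)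
    (by decide)
    (by change ∀ i : Fin 1, i.val + 1 ≠ 1 → _; decide)
    (by change ∀ i : Fin 1, ¬(i.val + 1 ≠ 1) → _; decide)
    (by change ∀ x, x ≠ 0 → ∃ i : Fin 1, _; decide)

/-- The edges of the Bruhat graph of `(A_5, A_4)`, listed by their labels. -/
def chainEdges : Fin 5 → List (Fin 6 × Fin 6) :=
  ![[(4, 5)], [(3, 4)], [(2, 3)], [(1, 2)], [(0, 1)]]

/-- The weights of `(A_5, A_4)`. -/
noncomputable def chain₆ : Minuscule (pairA 6 5) :=
  ofEdges (pairA 6 5) (N := 6) chainEdges 0 (fun x => x.val)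
    (by change ∀ _ : Fin 5, _; unfold Function.Involutive; decide +kernel)
    (by change ∀ i j : Fin 5, ∀ _, coxeterEntry (CoxeterMatrix.A 5) i j = 2 → _; decide +kernel)
    (by change ∀ i j : Fin 5, ∀ _, coxeterEntry (CoxeterMatrix.A 5) i j = 3 → _; decide +kernel)
    (by change ∀ _, ∀ _ : Fin 5, _; decide +kernel)
    (by change ∀ _, ∀ i j : Fin 5, coxeterEntry (CoxeterMatrix.A 5) i j = 2 → _; decide +kernel)
    (by change ∀ _, ∀ i j : Fin 5, coxeterEntry (CoxeterMatrix.A 5) i j = 3 → _; decide +kernel)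
    (by
      change ∀ i j : Fin 5, i ≠ j → coxeterEntry (CoxeterMatrix.A 5) i j = 2 ∨
        coxeterEntry (CoxeterMatrix.A 5) i j = 3
      decide +kernel)
    (by change ∀ _, ∀ _ : Fin 5, _; decide +kernel)
    (by decide)
    (by change ∀ i : Fin 5, i.val + 1 ≠ 5 → _; decide +kernel)
    (by change ∀ i : Fin 5, ¬(i.val + 1 ≠ 5) → _; decide +kernel)
    (by change ∀ x, x ≠ 0 → ∃ i : Fin 5, _; decide +kernel)

theorem thin_chain₂ : chain₂.Thin := by
  change ∀ a b : Fin 2, (b.val : ℤ) = a.val + 1 →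
    ∃ _ : Fin 1, pairSign [(0, 1)] a = 1 ∧ pairSwap [(0, 1)] a = b
  decide

theorem thin_chain₆ : chain₆.Thin := by
  change ∀ a b : Fin 6, (b.val : ℤ) = a.val + 1 →
    ∃ i : Fin 5, pairSign (chainEdges i) a = 1 ∧ pairSwap (chainEdges i) a = b
  decide +kernel

theorem autInvariant_chain₂ : chain₂.AutInvariant :=
  autInvariant_of_L_injective fun _ _ h => Fin.ext (Int.natCast_inj.1 h)

theorem autInvariant_chain₆ : chain₆.AutInvariant :=
  autInvariant_of_L_injective fun _ _ h => Fin.ext (Int.natCast_inj.1 h)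

/-! ### The exceptional pairs -/

/-- The edges of the Bruhat graph of `(E_6, D_5)`, listed by their labels. -/
def e6Edges : Fin 6 → List (Fin 27 × Fin 27) :=
  ![[(5, 7), (6, 8), (9, 10), (11, 13), (14, 16), (25, 26)],
    [(3, 4), (5, 6), (7, 8), (17, 19), (20, 21), (22, 23)],
    [(3, 5), (4, 6), (10, 12), (13, 15), (16, 18), (24, 25)],
    [(2, 3), (6, 9), (8, 10), (15, 17), (18, 20), (23, 24)],
    [(1, 2), (9, 11), (10, 13), (12, 15), (20, 22), (21, 23)],
    [(0, 1), (11, 14), (13, 16), (15, 18), (17, 20), (19, 21)]]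

/-- The ranks of the vertices of the Bruhat graph of `(E_6, D_5)`. -/
def e6Rank : Fin 27 → ℤ :=
  ![0, 1, 2, 3, 4, 4, 5, 5, 6, 6, 7, 7, 8, 8, 8, 9, 9, 10, 10, 11, 11, 12, 12, 13, 14, 15, 16]

/-- The edges of the Bruhat graph of `(E_7, E_6)`, listed by their labels. -/
def e7Edges : Fin 7 → List (Fin 56 × Fin 56) :=
  ![[(6, 8), (7, 9), (10, 11), (12, 14), (15, 17), (18, 21), (34, 37), (38, 40), (41, 43), (44, 45),
    (46, 47), (48, 49)],
    [(4, 5), (6, 7), (8, 9), (19, 22), (23, 25), (26, 28), (27, 29), (30, 32), (33, 36), (46, 48),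
    (47, 49), (50, 51)],
    [(4, 6), (5, 7), (11, 13), (14, 16), (17, 20), (21, 24), (31, 34), (35, 38), (39, 41), (42, 44),
    (47, 50), (49, 51)],
    [(3, 4), (7, 10), (9, 11), (16, 19), (20, 23), (24, 27), (28, 31), (32, 35), (36, 39), (44, 46),
    (45, 47), (51, 52)],
    [(2, 3), (10, 12), (11, 14), (13, 16), (23, 26), (25, 28), (27, 30), (29, 32), (39, 42), (41,
    44), (43, 45), (52, 53)],
    [(1, 2), (12, 15), (14, 17), (16, 20), (19, 23), (22, 25), (30, 33), (32, 36), (35, 39), (38,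
    41), (40, 43), (53, 54)],
    [(0, 1), (15, 18), (17, 21), (20, 24), (23, 27), (25, 29), (26, 30), (28, 32), (31, 35), (34,
    38), (37, 40), (54, 55)]]

/-- The ranks of the vertices of the Bruhat graph of `(E_7, E_6)`. -/
def e7Rank : Fin 56 → ℤ :=
  ![0, 1, 2, 3, 4, 5, 5, 6, 6, 7, 7, 8, 8, 9, 9, 9, 10, 10, 10, 11, 11, 11, 12, 12, 12, 13, 13, 13,
    14, 14, 14, 15, 15, 15, 16, 16, 16, 17, 17, 17, 18, 18, 18, 19, 19, 20, 20, 21, 21, 22, 22, 23,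
    24, 25, 26, 27]

/-- The weights of `(E_6, D_5)`. -/
noncomputable def e6 : Minuscule pairE6 :=
  ofEdges pairE6 (N := 27) e6Edges 0 e6Rank
    (by change ∀ _ : Fin 6, _; unfold Function.Involutive; decide +kernel)
    (by change ∀ i j : Fin 6, ∀ _, coxeterEntry CoxeterMatrix.E₆ i j = 2 → _; decide +kernel)
    (by change ∀ i j : Fin 6, ∀ _, coxeterEntry CoxeterMatrix.E₆ i j = 3 → _; decide +kernel)
    (by change ∀ _, ∀ _ : Fin 6, _; decide +kernel)
    (by change ∀ _, ∀ i j : Fin 6, coxeterEntry CoxeterMatrix.E₆ i j = 2 → _; decide +kernel)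
    (by change ∀ _, ∀ i j : Fin 6, coxeterEntry CoxeterMatrix.E₆ i j = 3 → _; decide +kernel)
    (by
      change ∀ i j : Fin 6, i ≠ j → coxeterEntry CoxeterMatrix.E₆ i j = 2 ∨
        coxeterEntry CoxeterMatrix.E₆ i j = 3
      decide +kernel)
    (by change ∀ _, ∀ _ : Fin 6, _; decide +kernel)
    (by decide +kernel)
    (by change ∀ i : Fin 6, i ≠ 5 → _; decide +kernel)
    (by change ∀ i : Fin 6, ¬(i ≠ 5) → _; decide +kernel)
    (by change ∀ x, x ≠ 0 → ∃ i : Fin 6, _; decide +kernel)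

/-- The weights of `(E_7, E_6)`. -/
noncomputable def e7 : Minuscule pairE7 :=
  ofEdges pairE7 (N := 56) e7Edges 0 e7Rank
    (by change ∀ _ : Fin 7, _; unfold Function.Involutive; decide +kernel)
    (by change ∀ i j : Fin 7, ∀ _, coxeterEntry CoxeterMatrix.E₇ i j = 2 → _; decide +kernel)
    (by change ∀ i j : Fin 7, ∀ _, coxeterEntry CoxeterMatrix.E₇ i j = 3 → _; decide +kernel)
    (by change ∀ _, ∀ _ : Fin 7, _; decide +kernel)
    (by change ∀ _, ∀ i j : Fin 7, coxeterEntry CoxeterMatrix.E₇ i j = 2 → _; decide +kernel)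
    (by change ∀ _, ∀ i j : Fin 7, coxeterEntry CoxeterMatrix.E₇ i j = 3 → _; decide +kernel)
    (by
      change ∀ i j : Fin 7, i ≠ j → coxeterEntry CoxeterMatrix.E₇ i j = 2 ∨
        coxeterEntry CoxeterMatrix.E₇ i j = 3
      decide +kernel)
    (by change ∀ _, ∀ _ : Fin 7, _; decide +kernel)
    (by decide +kernel)
    (by change ∀ i : Fin 7, i ≠ 6 → _; decide +kernel)
    (by change ∀ i : Fin 7, ¬(i ≠ 6) → _; decide +kernel)
    (by change ∀ x, x ≠ 0 → ∃ i : Fin 7, _; decide +kernel)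

end Minuscule

namespace Minuscule

/-! ### Contractions of quadrics -/

/-- The wall of `1''` consists of the negatives of the first two points. The node `1`, which
commutes with `1''`, exchanges them. -/
theorem contraction_quadric_zero (n : ℕ) (hn : 3 ≤ n) :
    ∃ g, Contraction (quadric n hn) chain₂ ⟨⟨0, by omega⟩, by omega⟩ g := by
  let g : Fin 2 → Fin n × Bool := fun y => (⟨y.val, by omega⟩, true)
  have hv : ∀ y : Fin 2, ∀ j : Fin 1, pairSign [(0, 1)] y =
      quadricWeight n (g y) ⟨⟨1, by omega⟩, by omega⟩ := by
    intro y _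
    fin_cases y <;> simp [g, pairSign, quadricWeight]
  have hs : ∀ y : Fin 2, g (pairSwap [(0, 1)] y) =
      quadricPerm n ⟨⟨1, by omega⟩, by omega⟩ (g y) := by
    intro y
    obtain ⟨h1, h2⟩ := quadricPerm_apply (n := n) ⟨⟨1, by omega⟩, by omega⟩ (g y)
    refine Prod.ext (Fin.ext ?_) ?_
    · rw [h1]
      fin_cases y <;> simp [g, pairSwap]
    · rw [h2]
      simp [g]
  refine ⟨g, .of_lift_thin thin_chain₂ ?_ ?_ ?_ (fun j => ⟨_, .of_comm (fun y => hv y j) hs⟩) ?_⟩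
  · intro (y : Fin 2)
    change quadricWeight n (g y) _ = -1
    simp only [quadricWeight, g]
    grind
  · intro (a : Fin 2) (b : Fin 2) e
    have := congrArg (fun x : Fin n × Bool => x.1.val) e
    exact Fin.ext this
  · intro (x : Fin n × Bool) hx
    change quadricWeight n x _ = -1 at hx
    obtain ⟨p, b⟩ := x
    have hp : p.val < 2 := by
      simp only [quadricWeight] at hx
      grind
    refine ⟨(⟨p.val, hp⟩ : Fin 2), ?_⟩
    refine Prod.ext rfl ?_
    simp only [quadricWeight] at hx
    cases b <;> grind
  · intro (a : Fin 2) (b : Fin 2) e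
    obtain rfl : a = b := Fin.ext (Int.natCast_inj.1 e)
    rfl

theorem coxeterD_reachable_two {n : ℕ} (hn : 3 ≤ n) (τ : DNode n) :
    Relation.ReflTransGen (fun i j : DNode n => coxeterD n i j = 3)
      ⟨⟨2, by omega⟩, by omega⟩ τ := by
  obtain ⟨⟨t, ht⟩, h2⟩ := τ
  by_cases h0 : t = 0
  · subst h0
    exact .single (coxeterD_eq_three (by simp))
  by_cases h1 : t = 1
  · subst h1
    exact .single (coxeterD_eq_three (by simp))
  induction t with
  | zero => exact absurd rfl h0
  | succ t ih =>
    by_cases h3 : t = 1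
    · subst h3
      exact .refl
    · exact .tail (ih (by omega) (by omega) h3) (coxeterD_eq_three (by simp; omega))

theorem reflTransGen_symm {α : Type*} {r : α → α → Prop} (hr : ∀ a b, r a b → r b a) {a b : α}
    (h : Relation.ReflTransGen r a b) : Relation.ReflTransGen r b a := by
  induction h with
  | refl => exact .refl
  | tail _ h ih => exact .head (hr _ _ h) ih

theorem coxeterD_reachable {n : ℕ} (hn : 3 ≤ n) (σ τ : DNode n) :
    Relation.ReflTransGen (fun i j : DNode n => coxeterD n i j = 3) σ τ :=
  (reflTransGen_symm (fun i j h => by rw [(coxeterD n).symmetric]; exact h)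
    (coxeterD_reachable_two hn σ)).trans (coxeterD_reachable_two hn τ)

theorem exists_contraction_quadric (n : ℕ) (hn : 3 ≤ n) (τ : DNode n) :
    ∃ g, Contraction (quadric n hn) chain₂ τ g := by
  obtain ⟨g, hg⟩ := contraction_quadric_zero n hn
  obtain ⟨g', hg', -⟩ := Contraction.transport_of_reachable (m := quadric n hn) (m' := chain₂)
    (fun _ _ _ => True) (fun _ _ _ _ _ _ _ => trivial) (coxeterD_reachable hn _ τ)
    ⟨g, hg, fun _ => trivial⟩
  exact ⟨g', hg'⟩

/-- The weights of `(D_6, D_5)`. -/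
noncomputable abbrev quadric₆ : Minuscule (pairDD 6) := quadric 6 (by omega)

/-- The quadric of `(D_6, D_5)` is thin. -/
theorem thin_quadric_six : quadric₆.Thin := by
  suffices h : ∀ (p : Fin 6) (b : Bool) (q : Fin 6) (c : Bool),
      quadricRank 6 (q, c) = quadricRank 6 (p, b) + 1 → ∃ i : Fin 6,
        quadricWeight 6 (p, b) ⟨i, by omega⟩ = 1 ∧ quadricPerm 6 ⟨i, by omega⟩ (p, b) = (q, c) by
    rintro ⟨p, b⟩ ⟨q, c⟩ e
    obtain ⟨i, hi⟩ := h p b q c e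
    exact ⟨(⟨i, by omega⟩ : DNode 6), hi⟩
  decide +kernel

/-- The symmetry of the quadric of `(D_6, D_5)` that exchanges `p` and `-p` for the first point. -/
def quadricFlip (x : Fin 6 × Bool) : Fin 6 × Bool := if x.1 = 0 then (x.1, !x.2) else x

/-- The diagram automorphism of `D_6`. -/
def nodeFlip (i : DNode 6) : DNode 6 :=
  if i.1 = 0 then ⟨1, by omega⟩ else if i.1 = 1 then ⟨0, by omega⟩ else i

theorem quadricFlip_flip (x : Fin 6 × Bool) : quadricFlip (quadricFlip x) = x := by
  obtain ⟨p, b⟩ := x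
  revert p b
  decide +kernel

theorem quadricWeight_flip (x : Fin 6 × Bool) (i : DNode 6) :
    quadricWeight 6 (quadricFlip x) (nodeFlip i) = quadricWeight 6 x i := by
  obtain ⟨p, b⟩ := x
  obtain ⟨i, hi⟩ := i
  revert p b i hi
  decide +kernel

theorem quadricPerm_flip (x : Fin 6 × Bool) (i : DNode 6) :
    quadricFlip (quadricPerm 6 i x) = quadricPerm 6 (nodeFlip i) (quadricFlip x) := by
  obtain ⟨p, b⟩ := x
  obtain ⟨i, hi⟩ := i
  revert p b i hi
  decide +kernel

theorem eq_of_quadricRank_eq (x y : Fin 6 × Bool) (h : quadricRank 6 x = quadricRank 6 y) :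
    x = y ∨ (x.1 = 0 ∧ y = quadricFlip x) := by
  obtain ⟨p, b⟩ := x
  obtain ⟨q, c⟩ := y
  revert p b q c
  decide +kernel

/-- The rank separates all signed points except the two signs of the first point. So an automorphism
is the identity or the flip of that point, and the flip comes from exchanging the nodes `1''` and
`1`. -/
theorem autInvariant_quadric_six : quadric₆.AutInvariant := by
  intro (α : Fin 6 × Bool ≃ Fin 6 × Bool) hα a b
  have hL : ∀ x : Fin 6 × Bool, quadricRank 6 (α x) = quadricRank 6 x :=
    L_aut (m := quadric₆) α hα
  let σ : Fin 6 × Bool ≃ Fin 6 × Bool :=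
    ⟨quadricFlip, quadricFlip, quadricFlip_flip, quadricFlip_flip⟩
  have key : (∀ x, α x = x) ∨ ∀ x, α x = σ x := by
    rcases eq_of_quadricRank_eq _ _ (hL (0, false)) with h | h
    · left
      intro x
      rcases eq_of_quadricRank_eq _ _ (hL x) with h1 | ⟨h1, h2⟩
      · exact h1
      · by_contra h3
        have h4 : x.1 = 0 := by
          rw [h2]
          simp [quadricFlip, h1]
        obtain ⟨p, b⟩ := x
        obtain rfl : p = 0 := h4
        cases b
        · exact h3 h
        · have h5 := h2.symm
          have h6 : α (0, true) = (0, false) := by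
            rw [← quadricFlip_flip (α (0, true)), h5]
            rfl
          have := α.injective (h6.trans h.symm)
          simp at this
    · right
      intro x
      have h0 : α (0, false) = (0, true) := by
        rw [← quadricFlip_flip (α (0, false)), ← h.2]
        rfl
      rcases eq_of_quadricRank_eq _ _ (hL x) with h1 | ⟨h1, h2⟩
      · by_cases h4 : x.1 = 0
        · obtain ⟨p, b⟩ := x
          obtain rfl : p = 0 := h4
          cases b
          · exact h0
          · have := α.injective (h1.trans h0.symm)
            simp at this
        · rw [h1]
          simp [σ, quadricFlip, h4]
      · change _ = quadricFlip x
        nth_rw 2 [h2]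
        rw [quadricFlip_flip]
  rcases key with h | h
  · obtain rfl : α = Equiv.refl _ := Equiv.ext h
    rfl
  · obtain rfl : α = σ := Equiv.ext h
    exact P_symmetry (m := quadric₆) σ nodeFlip rfl quadricWeight_flip
      (fun x i => quadricPerm_flip x i) a b

/-! ### Contractions of the exceptional pairs -/

/-- The bijection `phi` between two walls, for weights given by the edges of the Bruhat graph. -/
def pairPhi {N r : ℕ} (e : Fin r → List (Fin N × Fin N)) (τ c : Fin r) (x : Fin N) : Fin N :=
  if pairSign (e c) x = 1 then pairSwap (e c) x else pairSwap (e τ) x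

/-- The reflection in the root `a + c + b`, on the wall of `c`. -/
def pairBranch {N r : ℕ} (e : Fin r → List (Fin N × Fin N)) (a b c : Fin r) (x : Fin N) : Fin N :=
  if pairSign (e a) x = 1 then pairSwap (e c) (pairSwap (e b) (pairSwap (e a) x))
  else pairSwap (e a) (pairSwap (e b) (pairSwap (e c) x))

/-- The node `1` is the leaf attached to the branching node `3`. The nodes not adjacent to it form
two segments `4 – 5` and `0 – 2`, which the root `α_1 + α_2 + 2α_3 + α_4`, orthogonal to `α_1`,
joins to the path `4 – 5 – * – 0 – 2` of type `A_5`. -/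
theorem contraction_e6 : ∃ g, Contraction e6 chain₆ (1 : Fin 6) g := by
  let g : Fin 6 → Fin 27 := ![4, 6, 8, 19, 21, 23]
  -- The middle entry is a dummy: that node is lifted by the branch word.
  let κ : Fin 5 → Fin 6 := ![4, 5, 3, 0, 2]
  refine ⟨g, .of_lift_thin thin_chain₆ ?_ ?_ ?_ (fun (j : Fin 5) => ?_) ?_⟩
  · change ∀ y : Fin 6, pairSign (e6Edges 1) (g y) = -1
    decide +kernel
  · change ∀ a b : Fin 6, g a = g b → a = b
    decide +kernel
  · change ∀ x : Fin 27, pairSign (e6Edges 1) x = -1 → ∃ y : Fin 6, g y = x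
    decide +kernel
  · by_cases hj : j = 2
    · subst hj
      refine ⟨_, .of_branch (m := e6) (m' := chain₆) (g := g) (j := (2 : Fin 5)) (τ := (1 : Fin 6))
        (c := (3 : Fin 6)) (a := (2 : Fin 6)) (b := (4 : Fin 6)) rfl rfl rfl rfl rfl rfl ?_ ?_ ?_⟩
      · change ∀ y : Fin 6, pairSign (e6Edges 1) (g y) = -1
        decide +kernel
      · change ∀ y : Fin 6, pairSign (chainEdges 2) y =
          pairSign (e6Edges 2) (pairPhi e6Edges 1 3 (g y)) +
            pairSign (e6Edges 4) (pairPhi e6Edges 1 3 (g y)) - 1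
        decide +kernel
      · change ∀ y : Fin 6, pairSign (chainEdges 2) y ≠ 0 →
          pairPhi e6Edges 1 3 (g (pairSwap (chainEdges 2) y)) =
            pairBranch e6Edges 2 4 3 (pairPhi e6Edges 1 3 (g y))
        decide +kernel
    · refine ⟨[κ j], .of_comm ?_ ?_⟩
      · revert j
        change ∀ j : Fin 5, j ≠ 2 → ∀ y : Fin 6, pairSign (chainEdges j) y =
          pairSign (e6Edges (κ j)) (g y)
        decide +kernel
      · revert j
        change ∀ j : Fin 5, j ≠ 2 → ∀ y : Fin 6, g (pairSwap (chainEdges j) y) =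
          pairSwap (e6Edges (κ j)) (g y)
        decide +kernel
  · change ∀ a b : Fin 6, (a.val : ℤ) = b.val → e6Rank (g a) = e6Rank (g b)
    decide +kernel

/-- As for `E_6`, with the nodes `4 – 5 – 6` and `0 – 2` and the same root, which is joined to `5`
and `0`. The result is of type `D_6`, with `6` and `4` as the two short legs at `5`. -/
theorem contraction_e7 : ∃ g, Contraction e7 quadric₆ (1 : Fin 7) g := by
  let g : Fin 6 × Bool → Fin 56 := fun x =>
    if x.2 then ![29, 32, 36, 48, 49, 51] x.1 else ![28, 25, 22, 9, 7, 5] x.1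
  let κ : Fin 6 → Fin 7 := ![6, 4, 5, 3, 0, 2]
  refine ⟨g, .of_lift_thin thin_quadric_six ?_ ?_ ?_ (fun (j : DNode 6) => ?_) ?_⟩
  · suffices h : ∀ p b, pairSign (e7Edges 1) (g (p, b)) = -1 from fun x => h x.1 x.2
    decide +kernel
  · suffices h : ∀ p b q c, g (p, b) = g (q, c) → p = q ∧ b = c from
      fun x y e => Prod.ext (h x.1 x.2 y.1 y.2 e).1 (h x.1 x.2 y.1 y.2 e).2
    decide +kernel
  · suffices h : ∀ x : Fin 56, pairSign (e7Edges 1) x = -1 → ∃ p b, g (p, b) = x from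
      fun x hx => let ⟨p, b, e⟩ := h x hx; ⟨(p, b), e⟩
    decide +kernel
  · obtain ⟨j, hj'⟩ := j
    by_cases hj : j = 3
    · subst hj
      refine ⟨_, .of_branch (m := e7) (m' := quadric₆) (g := g)
        (j := (⟨3, hj'⟩ : DNode 6)) (τ := (1 : Fin 7)) (c := (3 : Fin 7)) (a := (2 : Fin 7))
        (b := (4 : Fin 7)) rfl rfl rfl rfl rfl rfl ?_ ?_ ?_⟩
      · suffices h : ∀ p b, pairSign (e7Edges 1) (g (p, b)) = -1 from fun x => h x.1 x.2
        decide +kernel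
      · suffices h : ∀ p b, quadricWeight 6 (p, b) ⟨3, by decide⟩ =
          pairSign (e7Edges 2) (pairPhi e7Edges 1 3 (g (p, b))) +
            pairSign (e7Edges 4) (pairPhi e7Edges 1 3 (g (p, b))) - 1 from fun x => h x.1 x.2
        decide +kernel
      · suffices h : ∀ p b, quadricWeight 6 (p, b) ⟨3, by decide⟩ ≠ 0 →
          pairPhi e7Edges 1 3 (g (quadricPerm 6 ⟨3, by decide⟩ (p, b))) =
            pairBranch e7Edges 2 4 3 (pairPhi e7Edges 1 3 (g (p, b))) from fun x => h x.1 x.2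
        decide +kernel
    · refine ⟨[κ j], .of_comm ?_ ?_⟩
      · suffices h : ∀ j, j ≠ 3 → ∀ p b, quadricWeight 6 (p, b) ⟨j, by decide⟩ =
          pairSign (e7Edges (κ j)) (g (p, b)) from fun x => h j hj x.1 x.2
        decide +kernel
      · suffices h : ∀ j, j ≠ 3 → ∀ p b, g (quadricPerm 6 ⟨j, by decide⟩ (p, b)) =
          pairSwap (e7Edges (κ j)) (g (p, b)) from fun x => h j hj x.1 x.2
        decide +kernel
  · suffices h : ∀ p b q c, quadricRank 6 (p, b) = quadricRank 6 (q, c) →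
        e7Rank (g (p, b)) = e7Rank (g (q, c)) from fun x y => h x.1 x.2 y.1 y.2
    decide +kernel

theorem e6_reachable (τ : Fin 6) :
    Relation.ReflTransGen (fun i j : Fin 6 => coxeterEntry CoxeterMatrix.E₆ i j = 3) 1 τ := by
  have h3 : Relation.ReflTransGen (fun i j : Fin 6 => coxeterEntry CoxeterMatrix.E₆ i j = 3) 1 3 :=
    .single rfl
  fin_cases τ
  · exact (h3.tail (b := 3) (c := 2) rfl).tail rfl
  · exact .refl
  · exact h3.tail rfl
  · exact h3
  · exact h3.tail rfl
  · exact (h3.tail (b := 3) (c := 4) rfl).tail rfl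

theorem e7_reachable (τ : Fin 7) :
    Relation.ReflTransGen (fun i j : Fin 7 => coxeterEntry CoxeterMatrix.E₇ i j = 3) 1 τ := by
  have h3 : Relation.ReflTransGen (fun i j : Fin 7 => coxeterEntry CoxeterMatrix.E₇ i j = 3) 1 3 :=
    .single rfl
  have h5 := (h3.tail (b := 3) (c := 4) rfl).tail (c := 5) rfl
  fin_cases τ
  · exact (h3.tail (b := 3) (c := 2) rfl).tail rfl
  · exact .refl
  · exact h3.tail rfl
  · exact h3
  · exact h3.tail rfl
  · exact h5
  · exact h5.tail rfl

theorem exists_contraction_e6 (τ : Fin 6) : ∃ g, Contraction e6 chain₆ τ g := by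
  obtain ⟨g, hg⟩ := contraction_e6
  obtain ⟨g', hg', -⟩ := Contraction.transport_of_reachable (m := e6) (m' := chain₆)
    (fun _ _ _ => True) (fun _ _ _ _ _ _ _ => trivial) (e6_reachable τ) ⟨g, hg, fun _ => trivial⟩
  exact ⟨g', hg'⟩

theorem exists_contraction_e7 (τ : Fin 7) :
    ∃ g, Contraction e7 quadric₆ τ g := by
  obtain ⟨g, hg⟩ := contraction_e7
  obtain ⟨g', hg', -⟩ := Contraction.transport_of_reachable (m := e7)
    (m' := quadric₆) (fun _ _ _ => True) (fun _ _ _ _ _ _ _ => trivial)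
    (e7_reachable τ) ⟨g, hg, fun _ => trivial⟩
  exact ⟨g', hg'⟩

end Minuscule

/-! ### Decorated tangles and their northern halves -/

namespace Tangle

variable {n : ℕ}

/-- The strands of a tangle are the orbits of a fixed-point free involution, and a bead sits on a
whole strand. -/
structure Valid (d : Tangle n) : Prop where
  inv : ∀ x, d.partner (d.partner x) = x
  ne : ∀ x, d.partner x ≠ x
  bead : ∀ x, d.bead (d.partner x) = d.bead x

theorem valid_one (n : ℕ) : (one n).Valid :=
  ⟨by rintro (x | x) <;> rfl, by rintro (x | x) <;> simp [one], fun _ => rfl⟩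

theorem Valid.stack {d : Tangle n} (hd : d.Valid) {l r : Fin n} (h : l ≠ r) (c : Bool) :
    (d.stack l r c).Valid := by
  obtain ⟨h1, h2, h3⟩ := hd
  have h' : (Sum.inr l : Fin n ⊕ Fin n) ≠ Sum.inr r := fun e => h (Sum.inr_injective e)
  refine ⟨fun x => ?_, fun x => ?_, fun x => ?_⟩
  · simp only [Tangle.stack]
    grind
  · simp only [Tangle.stack]
    grind
  · simp only [Tangle.stack]
    grind

theorem stack_symm {d : Tangle n} (hd : d.Valid) {l r : Fin n} (h : l ≠ r) (c : Bool) :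
    d.stack l r c = d.stack r l c := by
  obtain ⟨h1, h2, h3⟩ := hd
  have h' : (Sum.inr l : Fin n ⊕ Fin n) ≠ Sum.inr r := fun e => h (Sum.inr_injective e)
  ext x
  · simp only [Tangle.stack]
    grind
  · simp only [Tangle.stack]
    have : ((d.bead (Sum.inr l)) ^^ c ^^ (d.bead (Sum.inr r))) =
      ((d.bead (Sum.inr r)) ^^ c ^^ (d.bead (Sum.inr l))) := by
      cases d.bead (Sum.inr l) <;> cases c <;> cases d.bead (Sum.inr r) <;> rfl
    rw [this]
    grind

/-- The composite with an arc from `l` to `r`, on partners. -/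
def reroute {α : Type*} [DecidableEq α] (p : α → α) (l r x : α) : α :=
  if x = l then r else if x = r then l else if x = p l then p r else if x = p r then p l else p x

/-- The composite with an arc from `l` to `r`, on beads. -/
def recount {α β : Type*} [DecidableEq α] (op : β → β → β) (p : α → α) (b : α → β)
    (l r : α) (c : β) (x : α) : β :=
  if x = l ∨ x = r then c else if x = p l ∨ x = p r then op (op (b l) c) (b r) else b x

section Commute

variable {α β : Type*} [DecidableEq α] {p : α → α} {L R L' R' : α}

/-- Stated for an abstract fixed-point free involution, since only the way in which it joins the
four points matters. The cases enumerate these ways. -/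
theorem reroute_comm (hi : ∀ x, p (p x) = x) (hn : ∀ x, p x ≠ x) (k : L ≠ R) (k' : L' ≠ R')
    (k1 : L ≠ L') (k2 : L ≠ R') (k3 : R ≠ L') (k4 : R ≠ R') (x : α) :
    reroute (reroute p L R) L' R' x = reroute (reroute p L' R') L R x := by
  have e : ∀ x y, p x = y ↔ x = p y := fun x y => ⟨fun h => by rw [← h, hi], fun h => by rw [h, hi]⟩
  simp only [reroute]
  by_cases a : p L = R
  · have a' : p R = L := by rw [← a, hi]
    by_cases b : p L' = R'
    · have b' : p R' = L' := by rw [← b, hi]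
      grind
    · grind
  · by_cases b : p L' = R'
    · have b' : p R' = L' := by rw [← b, hi]
      grind
    · by_cases c1 : p L = L'
      · have := hi L
        by_cases c2 : p R = R'
        · have := hi R
          clear e
          grind
        · grind
      · by_cases c1 : p L = R'
        · by_cases c2 : p R = L'
          · grind
          · grind
        · by_cases c2 : p R = L'
          · grind
          · by_cases c2 : p R = R'
            · grind
            · grind

theorem recount_comm {op : β → β → β} [Std.Commutative op] [Std.Associative op] {b : α → β} {c c' : β}
    (hi : ∀ x, p (p x) = x) (hn : ∀ x, p x ≠ x) (hb : ∀ x, b (p x) = b x) (k : L ≠ R) (k' : L' ≠ R')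
    (k1 : L ≠ L') (k2 : L ≠ R') (k3 : R ≠ L') (k4 : R ≠ R') (x : α) :
    recount op (reroute p L R) (recount op p b L R c) L' R' c' x =
      recount op (reroute p L' R') (recount op p b L' R' c') L R c x := by
  simp only [reroute, recount]
  by_cases a : p L = R
  · have a' : p R = L := by rw [← a, hi]
    by_cases b : p L' = R'
    · have b' : p R' = L' := by rw [← b, hi]
      grind
    · grind
  · by_cases b : p L' = R'
    · have b' : p R' = L' := by rw [← b, hi]
      grind
    · by_cases c1 : p L = L'
      · have := hi L
        by_cases c2 : p R = R'
        · have := hi R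
          grind
        · grind
      · by_cases c1 : p L = R'
        · by_cases c2 : p R = L'
          · grind
          · grind
        · by_cases c2 : p R = L'
          · grind
          · by_cases c2 : p R = R'
            · grind
            · grind

end Commute

theorem stack_comm {d : Tangle n} (hd : d.Valid) {l r l' r' : Fin n} (h : l ≠ r) (h' : l' ≠ r')
    (h1 : l ≠ l') (h2 : l ≠ r') (h3 : r ≠ l') (h4 : r ≠ r') (c c' : Bool) :
    (d.stack l r c).stack l' r' c' = (d.stack l' r' c').stack l r c := by
  obtain ⟨hi, hn, hb⟩ := hd
  have inj : ∀ {a b : Fin n}, a ≠ b → (Sum.inr a : Fin n ⊕ Fin n) ≠ Sum.inr b :=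
    fun h e => h (Sum.inr_injective e)
  ext x
  · exact reroute_comm hi hn (inj h) (inj h') (inj h1) (inj h2) (inj h3) (inj h4) x
  · have : Std.Commutative xor := ⟨Bool.xor_comm⟩
    have : Std.Associative xor := ⟨Bool.xor_assoc⟩
    exact recount_comm (op := xor) hi hn hb (inj h) (inj h') (inj h1) (inj h2) (inj h3) (inj h4) x

/-- The other end of the northern arc at a vertex. -/
def nb (d : Tangle n) (j : Fin n) : Option (Fin n) :=
  (d.partner (Sum.inr j)).elim (fun _ => none) some

/-- Whether the strand at a northern vertex has a bead. -/
def bd (d : Tangle n) (j : Fin n) : Bool := d.bead (Sum.inr j)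

theorem nb_eq_some {d : Tangle n} {j k : Fin n} :
    d.nb j = some k ↔ d.partner (Sum.inr j) = Sum.inr k := by
  unfold nb
  cases d.partner (Sum.inr j) <;> simp

theorem Valid.nb_symm {d : Tangle n} (hd : d.Valid) {j k : Fin n} (h : d.nb j = some k) :
    d.nb k = some j := by
  rw [nb_eq_some] at *
  rw [← h, hd.inv]

theorem Valid.nb_ne {d : Tangle n} (hd : d.Valid) {j : Fin n} : d.nb j ≠ some j := by
  rw [ne_eq, nb_eq_some]
  exact hd.ne _

theorem Valid.bd_nb {d : Tangle n} (hd : d.Valid) {j k : Fin n} (h : d.nb j = some k) :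
    d.bd k = d.bd j := by
  rw [nb_eq_some] at h
  unfold bd
  rw [← h, hd.bead]

theorem nb_stack {d : Tangle n} (hd : d.Valid) (l r : Fin n) (c : Bool) (j : Fin n) :
    (d.stack l r c).nb j = if j = l then some r else if j = r then some l
      else if d.nb j = some l then d.nb r else if d.nb j = some r then d.nb l else d.nb j := by
  simp only [nb_eq_some]
  have e : ∀ y, Sum.inr j = d.partner y ↔ d.partner (Sum.inr j) = y := fun y =>
    ⟨fun e => by rw [e, hd.inv], fun e => by rw [← e, hd.inv]⟩
  unfold nb
  simp only [Tangle.stack, e, Sum.inr.injEq]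
  split_ifs <;> rfl

theorem bd_stack {d : Tangle n} (hd : d.Valid) (l r : Fin n) (c : Bool) (j : Fin n) :
    (d.stack l r c).bd j = if j = l ∨ j = r then c
      else if d.nb j = some l ∨ d.nb j = some r then xor (xor (d.bd l) c) (d.bd r)
      else d.bd j := by
  simp only [nb_eq_some]
  have e : ∀ y, Sum.inr j = d.partner y ↔ d.partner (Sum.inr j) = y := fun y =>
    ⟨fun e => by rw [e, hd.inv], fun e => by rw [← e, hd.inv]⟩
  unfold bd
  simp only [Tangle.stack, e, Sum.inr.injEq]

/-- The northern half of `d'` is the restriction along `f` of that of `d`, up to a bead at every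
vertex where `z` is true. -/
def Restricts {k : ℕ} (d : Tangle n) (f : Fin k → Fin n) (z : Fin k → Bool) (d' : Tangle k) :
    Prop :=
  ∀ j, d.nb (f j) = (d'.nb j).map f ∧
    d.bd (f j) = xor (d'.bd j) (xor (z j) ((d'.nb j).elim false z))

section Restricts

variable {k : ℕ} {d : Tangle n} {f : Fin k → Fin n} {z : Fin k → Bool} {d' : Tangle k}

theorem Restricts.nb_iff (hf : Function.Injective f) (h : d.Restricts f z d') {j p : Fin k} :
    d.nb (f j) = some (f p) ↔ d'.nb j = some p := by
  rw [(h j).1, Option.map_eq_some_iff]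
  constructor
  · rintro ⟨q, hq, e⟩
    rwa [← hf e]
  · exact fun e => ⟨p, e, rfl⟩

theorem xor_slide : ∀ x u t c y v w : Bool, xor (xor (xor x (xor u t)) (xor c (xor u v)))
    (xor y (xor v w)) = xor (xor (xor x c) y) (xor t w) := by
  decide

theorem xor_slide' : ∀ c c' x t w : Bool, xor (xor c c') (xor x (xor t w)) =
    xor x (xor (xor t (xor c c')) w) := by
  decide

/-- The stacked arc absorbs the gauge beads of its two ends. On a strand that is joined through the
arc these beads occur twice and cancel. -/
theorem Restricts.stack (hd : d.Valid) (hd' : d'.Valid) (hf : Function.Injective f)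
    (h : d.Restricts f z d') {l r : Fin k} (hlr : l ≠ r) {c c' : Bool}
    (hc : c = xor c' (xor (z l) (z r))) :
    (d.stack (f l) (f r) c).Restricts f z (d'.stack l r c') := by
  intro j
  simp only [nb_stack hd, nb_stack hd', bd_stack hd, bd_stack hd', hf.eq_iff, h.nb_iff hf]
  have key : ∀ {l r}, l ≠ r → c = xor c' (xor (z l) (z r)) → j ≠ l → j ≠ r → d'.nb j = some l →
      xor (xor (d.bd (f l)) c) (d.bd (f r)) =
        xor (xor (xor (d'.bd l) c') (d'.bd r)) (xor (z j) ((d'.nb r).elim false z)) := by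
    intro l r hlr hc hjl hjr e
    have e' := hd'.nb_symm e
    rw [(h l).2, (h r).2, e', hc, Option.elim_some]
    generalize (d'.nb r).elim false z = w
    exact xor_slide _ _ _ _ _ _ _
  constructor
  · have h1 := (h j).1
    have h2 := (h l).1
    have h3 := (h r).1
    split_ifs <;> simp_all
  · by_cases e1 : j = l
    · subst e1
      simp [hc]
    by_cases e2 : j = r
    · subst e2
      simp only [e1, or_true, if_true, if_false, hc]
      simp [Bool.xor_comm]
    by_cases e3 : d'.nb j = some l
    · simp only [e1, e2, e3, or_self, true_or, if_true, if_false]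
      exact key hlr hc e1 e2 e3
    by_cases e4 : d'.nb j = some r
    · simp only [e1, e2, e4, or_self, or_true, if_true, if_false]
      have hc' : c = xor c' (xor (z r) (z l)) := by rw [hc, Bool.xor_comm (z l)]
      have := key hlr.symm hc' e2 e1 e4
      grind
    simp only [e1, e2, e3, e4, or_self, if_false]
    exact (h j).2

/-- Stacking an arc from `m` to `b` on a tangle with an arc from `a` to `m` moves the strand at `b`
to `a`. -/
theorem Restricts.slide (hd : d.Valid) (hf : Function.Injective f) (h : d.Restricts f z d')
    (hd' : d'.Valid)
    {a b m : Fin n} {c c' : Bool} (ham : d.nb a = some m) (hc : d.bd a = c)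
    {j₀ : Fin k} (hb : f j₀ = b) (hm : ∀ j, f j ≠ m) (ha : ∀ j, f j ≠ a)
    {f' : Fin k → Fin n} (hf' : ∀ j, f' j = if j = j₀ then a else f j)
    {z' : Fin k → Bool} (hz' : ∀ j, z' j = if j = j₀ then xor (z j) (xor c c') else z j) :
    (d.stack m b c').Restricts f' z' d' := by
  have hma := hd.nb_symm ham
  have hbm := hd.bd_nb ham
  intro j
  have hba : b ≠ a := fun e => ha j₀ (hb.trans e)
  have hma' : m ≠ a := fun e => hd.nb_ne (e ▸ ham)
  have hjb : j ≠ j₀ → f j ≠ b := fun e e' => e (hf (e'.trans hb.symm))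
  have hmap : d'.nb j ≠ some j₀ → (d'.nb j).map f' = (d'.nb j).map f := by
    intro e
    cases hj : d'.nb j with
    | none => rfl
    | some q =>
      have : q ≠ j₀ := fun e' => e (hj.trans (by rw [e']))
      simp [hf', this]
  have hel : d'.nb j ≠ some j₀ → (d'.nb j).elim false z' = (d'.nb j).elim false z := by
    intro e
    cases hj : d'.nb j with
    | none => rfl
    | some q =>
      have : q ≠ j₀ := fun e' => e (hj.trans (by rw [e']))
      simp [hz', this]
  rw [nb_stack hd, bd_stack hd]
  -- The vertex `j₀` moves from `b` to `a`. Its strand now runs through the stacked arc and the old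
  -- arc, and collects the beads of both.
  by_cases e : j = j₀
  · subst e
    have hne : d'.nb j ≠ some j := hd'.nb_ne
    rw [hf', hz', if_pos rfl, if_pos rfl, if_neg hma'.symm, if_neg hba.symm, if_pos ham, if_neg
      (by tauto), if_pos (Or.inl ham), hmap hne, hel hne, ← hb, (h j).1, (h j).2, hbm, hc]
    refine ⟨rfl, ?_⟩
    exact xor_slide' _ _ _ _ _
  · have hne : d.nb (f j) ≠ some m := by
      intro e'
      have := hd.nb_symm e'
      rw [hma, Option.some_inj] at this
      exact ha j this.symm
    rw [hf', hz', if_neg e, if_neg e, if_neg (hm j), if_neg (hjb e), if_neg hne]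
    have hiff : d.nb (f j) = some b ↔ d'.nb j = some j₀ := by rw [← hb, h.nb_iff hf]
    by_cases e2 : d'.nb j = some j₀
    · rw [if_pos (hiff.2 e2), if_neg (by have := hm j; have := hjb e; tauto),
        if_pos (Or.inr (hiff.2 e2)), hma, e2]
      refine ⟨by simp [hf'], ?_⟩
      have h1 := (h j).2
      rw [hd.bd_nb (hiff.2 e2), h1, e2, hbm, hc]
      simp only [Option.elim_some, hz', if_true]
      exact (xor_slide' _ _ _ _ _).trans (by
        rw [Bool.xor_assoc (z j), Bool.xor_comm (xor c c')])
    · rw [if_neg (fun e => e2 (hiff.1 e)), if_neg (by have := hm j; have := hjb e; tauto),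
        if_neg (by rw [hiff]; tauto), hmap e2, hel e2]
      exact h j

end Restricts

end Tangle

/-! ### Weight models from coset diagrams -/

namespace ArrowModel

variable {X : CoxeterPair} (m : ArrowModel X)

/-- The right action of a simple reflection on labellings. -/
def act (i : X.Node) (x : Fin m.size → Bool) : Fin m.size → Bool := fun p =>
  if p = m.left i then xor (x (m.right i)) (m.beaded i)
  else if p = m.right i then xor (x (m.left i)) (m.beaded i) else x p

/-- The label that a simple reflection moves to the right. -/
def incoming (i : X.Node) (x : Fin m.size → Bool) : Bool := xor (x (m.left i)) (m.beaded i)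

/-- The relative positions of the pairs of vertices of the simple reflections. -/
structure Regular : Prop where
  succ : ∀ i, (m.right i).val = (m.left i).val + 1
  zero : ∀ i, m.beaded i = true → (m.left i).val = 0
  comm : ∀ i j, X.M i j = 2 → (m.left i ≠ m.left j ∧ m.left i ≠ m.right j ∧
    m.right i ≠ m.left j ∧ m.right i ≠ m.right j) ∨
    (m.left i = m.left j ∧ m.right i = m.right j ∧ m.beaded i = !m.beaded j)
  adj : ∀ i j, X.M i j = 3 → (m.right i = m.left j ∧ m.beaded j = false) ∨
    (m.right j = m.left i ∧ m.beaded i = false)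
  simplyLaced : ∀ i j, i ≠ j → X.M i j = 2 ∨ X.M i j = 3

variable {m}

theorem Regular.ne (h : m.Regular) (i : X.Node) : m.left i ≠ m.right i := fun e => by
  have := h.succ i
  rw [e] at this
  omega

theorem act_left (i : X.Node) (x : Fin m.size → Bool) :
    m.act i x (m.left i) = xor (x (m.right i)) (m.beaded i) := if_pos rfl

theorem act_right (h : m.Regular) (i : X.Node) (x : Fin m.size → Bool) :
    m.act i x (m.right i) = m.incoming i x := by
  rw [act, if_neg (h.ne i).symm, if_pos rfl, incoming]

theorem act_of_ne {i : X.Node} {x : Fin m.size → Bool} {p : Fin m.size} (hl : p ≠ m.left i)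
    (hr : p ≠ m.right i) : m.act i x p = x p := by
  rw [act, if_neg hl, if_neg hr]

theorem signedSwap_apply_not {n : ℕ} (l r : Fin n) (c : Bool) (p : Fin n) (b : Bool) :
    signedSwap l r c (p, b) = ((signedSwap l r c (p, false)).1,
      xor (signedSwap l r c (p, false)).2 b) := by
  simp only [signedSwap, Equiv.coe_fn_mk]
  split_ifs <;> simp [Bool.xor_comm]

variable (m) in
/-- The action of the Coxeter group on signed points. -/
noncomputable def rep (w : X.W) : Equiv.Perm (Fin m.size × Bool) :=
  X.cs.lift ⟨_, m.liftable⟩ w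

theorem rep_mul_simple (w : X.W) (i : X.Node) (x : Fin m.size × Bool) :
    m.rep (w * X.cs.simple i) x = m.rep w (signedSwap (m.left i) (m.right i) (m.beaded i) x) := by
  rw [rep, map_mul, X.cs.lift_apply_simple]
  rfl

theorem rep_not (w : X.W) (p : Fin m.size) (b : Bool) :
    m.rep w (p, b) = ((m.rep w (p, false)).1, xor (m.rep w (p, false)).2 b) := by
  induction w using X.cs.simple_induction_right generalizing p b with
  | one => simp [rep]
  | mul_simple_right w i ih =>
    rw [rep_mul_simple, rep_mul_simple, signedSwap_apply_not, ih, ih _ (Prod.snd _)]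
    simp

theorem diagram_one : m.diagram 1 = m.start := by
  funext p
  simp [diagram]

theorem diagram_mul_simple (h : m.Regular) (w : X.W) (i : X.Node) :
    m.diagram (w * X.cs.simple i) = m.act i (m.diagram w) := by
  funext p
  change xor (m.start (m.rep _ (p, false)).1) (m.rep _ (p, false)).2 = m.act i (fun p =>
    xor (m.start (m.rep _ (p, false)).1) (m.rep _ (p, false)).2) p
  rw [rep_mul_simple]
  simp only [signedSwap, Equiv.coe_fn_mk, Bool.false_xor, act]
  rw [rep_not]
  by_cases e1 : p = m.left i
  · subst e1
    simp
  by_cases e2 : p = m.right i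
  · subst e2
    simp [(h.ne i).symm]
  simp [e1, e2, Equiv.swap_apply_of_ne_of_ne e1 e2]

/-- A weight model of the cosets by labellings. -/
structure Labelling (m : ArrowModel X) (M : Minuscule X) where
  lab : M.Ω → Fin m.size → Bool
  inj : Function.Injective lab
  lab_pt : ∀ w, lab (M.pt w) = m.diagram w
  lab_s : ∀ i x, lab (M.s i x) = m.act i (lab x)
  v_eq : ∀ i x, M.v x i = (m.incoming i (lab x)).toInt - (lab x (m.right i)).toInt

theorem toInt_eq : ∀ b : Bool, b.toInt = if b then 1 else 0 := by
  decide

section Labelling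

variable {M : Minuscule X} (l : m.Labelling M)

theorem Labelling.v_up {i : X.Node} {x : M.Ω} :
    M.v x i = 1 ↔ m.incoming i (l.lab x) = true ∧ l.lab x (m.right i) = false := by
  rw [l.v_eq]
  cases m.incoming i (l.lab x) <;> cases l.lab x (m.right i) <;> decide

theorem Labelling.v_down {i : X.Node} {x : M.Ω} :
    M.v x i = -1 ↔ m.incoming i (l.lab x) = false ∧ l.lab x (m.right i) = true := by
  rw [l.v_eq]
  cases m.incoming i (l.lab x) <;> cases l.lab x (m.right i) <;> decide

theorem Labelling.v_zero {i : X.Node} {x : M.Ω} :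
    M.v x i = 0 ↔ m.incoming i (l.lab x) = l.lab x (m.right i) := by
  rw [l.v_eq]
  cases m.incoming i (l.lab x) <;> cases l.lab x (m.right i) <;> decide

end Labelling

/-- Used with the positions as weights to compute ranks, and with constant weight to count the
labels `∧`. -/
theorem sum_act (h : m.Regular) (i : X.Node) (x : Fin m.size → Bool) (w : Fin m.size → ℤ) :
    ∑ p, (if m.act i x p then w p else 0) = ∑ p, (if x p then w p else 0) +
      (w (m.left i) * ((xor (x (m.right i)) (m.beaded i)).toInt - (x (m.left i)).toInt) +
      w (m.right i) * ((m.incoming i x).toInt - (x (m.right i)).toInt)) := by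
  rw [← sub_eq_iff_eq_add', ← Finset.sum_sub_distrib]
  rw [Finset.sum_eq_add (m.left i) (m.right i) (h.ne i)]
  · rw [act_left, act_right h]
    simp only [toInt_eq]
    split_ifs <;> ring
  · rintro p - ⟨h1, h2⟩
    rw [act_of_ne h1 h2, sub_self]
  · simp
  · simp

/-- The sum of the positions of the labels `∧`. -/
def height (x : Fin m.size → Bool) : ℤ := ∑ p, if x p then (p.val : ℤ) else 0

/-- An unbeaded reflection moves labels by one position. A beaded one acts on the positions `0` and
`1`, and the position `0` does not contribute to the height. -/
theorem height_act (h : m.Regular) (i : X.Node) (x : Fin m.size → Bool) :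
    height (m.act i x) =
      height x + ((m.incoming i x).toInt - (x (m.right i)).toInt) := by
  rw [height, sum_act h i x fun p => (p.val : ℤ), height, h.succ i]
  have := h.zero i
  unfold incoming
  cases hb : m.beaded i
  · push_cast
    simp only [Bool.xor_false]
    ring
  · rw [this hb]
    push_cast
    ring

theorem act_act (h : m.Regular) (i : X.Node) (x : Fin m.size → Bool) :
    m.act i (m.act i x) = x := by
  funext p
  by_cases e1 : p = m.left i
  · subst e1
    rw [act_left, act_right h, incoming, Bool.xor_assoc, Bool.xor_self, Bool.xor_false]
  by_cases e2 : p = m.right i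
  · subst e2
    rw [act_right h, incoming, act_left, Bool.xor_assoc, Bool.xor_self, Bool.xor_false]
  rw [act_of_ne e1 e2, act_of_ne e1 e2]

/-- The weight model of an arrow model, on the labellings that satisfy an invariant condition. -/
noncomputable def minuscule (h : m.Regular) (inv : (Fin m.size → Bool) → Prop)
    (inv_start : inv m.start) (inv_act : ∀ i x, inv x → inv (m.act i x))
    (mem : ∀ i ∈ X.inP, m.incoming i m.start = m.start (m.right i))
    (not_mem : ∀ i ∉ X.inP, m.incoming i m.start = true ∧ m.start (m.right i) = false)
    (desc : ∀ x, inv x → x ≠ m.start → ∃ i, m.incoming i x = false ∧ x (m.right i) = true) :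
    Minuscule X where
  Ω := {x // inv x}
  pt w := ⟨m.diagram w, by
    induction w using X.cs.simple_induction_right with
    | one => rwa [diagram_one]
    | mul_simple_right w i ih => rw [diagram_mul_simple h]; exact inv_act i _ ih⟩
  s i x := ⟨m.act i x.1, inv_act i _ x.2⟩
  v x i := (m.incoming i x.1).toInt - (x.1 (m.right i)).toInt
  L x := height x.1 - height m.start
  pt_mul w i := Subtype.ext (diagram_mul_simple h w i)
  s_s i x := Subtype.ext (act_act h i x.1)
  v_mem x i := by
    cases m.incoming i x.1 <;> cases x.1 (m.right i) <;> decide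
  s_fix x i hx := by
    refine Subtype.ext (funext fun p => ?_)
    have e : m.incoming i x.1 = x.1 (m.right i) := by
      revert hx
      cases m.incoming i x.1 <;> cases x.1 (m.right i) <;> decide
    change m.act i x.1 p = x.1 p
    by_cases e1 : p = m.left i
    · rw [e1, act_left, ← e, incoming, Bool.xor_assoc, Bool.xor_self, Bool.xor_false]
    by_cases e2 : p = m.right i
    · rw [e2, act_right h, e]
    rw [act_of_ne e1 e2]
  v_self x i := by
    dsimp only
    rw [act_right h, incoming, act_left, Bool.xor_assoc, Bool.xor_self, Bool.xor_false]
    ring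
  v_comm x i j hij := by
    dsimp only
    rcases h.comm i j hij with ⟨h1, h2, h3, h4⟩ | ⟨h1, h2, h3⟩
    · rw [incoming, act_of_ne h1.symm h3.symm, act_of_ne h2.symm h4.symm, incoming]
    · rw [incoming, ← h1, ← h2, act_left, act_right h, incoming, incoming, ← h1, h3]
      cases m.beaded j <;> cases x.1 (m.left i) <;> cases x.1 (m.right i) <;> decide
  v_adj x i j hij := by
    dsimp only
    have hi := h.succ i
    have hj := h.succ j
    rcases h.adj i j hij with ⟨h1, h2⟩ | ⟨h1, h2⟩
    · rw [h1] at hi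
      rw [incoming, ← h1, act_right h, act_of_ne (p := m.right j) (fun e => by
        rw [e] at hj; omega) (fun e => by rw [e, h1] at hj; omega), h2, incoming, incoming, ← h1, h2]
      simp only [Bool.xor_false]
      ring
    · rw [h1] at hj
      rw [incoming, h1, act_left, act_of_ne (p := m.left j) (fun e => by
        rw [e] at hj; omega) (fun e => by rw [e] at hj; omega), h2, incoming, incoming, h2]
      simp only [Bool.xor_false]
      ring
  simplyLaced := h.simplyLaced
  L_s x i := by
    rw [height_act h]
    ring
  L_one := by simp only [diagram_one, sub_self]
  L_bdd := ⟨- height m.start, fun x => by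
    have : 0 ≤ height x.1 := Finset.sum_nonneg fun p _ => by split_ifs <;> simp
    omega⟩
  v_one_mem i hi := by simp only [diagram_one, mem i hi, sub_self]
  v_one_not_mem i hi := by
    simp only [diagram_one, (not_mem i hi).1, (not_mem i hi).2]
    rfl
  desc x hx := by
    obtain ⟨i, h1, h2⟩ := desc x.1 x.2 fun e =>
      hx (Subtype.ext (e.trans diagram_one.symm))
    exact ⟨i, by rw [h1, h2]; rfl⟩

/-- The labelling of the weight model of an arrow model. -/
noncomputable def labelling (h : m.Regular) (inv : (Fin m.size → Bool) → Prop)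
    (inv_start : inv m.start) (inv_act : ∀ i x, inv x → inv (m.act i x))
    (mem : ∀ i ∈ X.inP, m.incoming i m.start = m.start (m.right i))
    (not_mem : ∀ i ∉ X.inP, m.incoming i m.start = true ∧ m.start (m.right i) = false)
    (desc : ∀ x, inv x → x ≠ m.start → ∃ i, m.incoming i x = false ∧ x (m.right i) = true) :
    m.Labelling (minuscule h inv inv_start inv_act mem not_mem desc) where
  lab x := x.1
  inj := Subtype.val_injective
  lab_pt _ := rfl
  lab_s _ _ := rfl
  v_eq _ _ := rfl

end ArrowModel

/-! ### Orientation, and tangles of reduced words -/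

namespace LabelledTangle

variable {n : ℕ}

theorem isOriented_iff (D : LabelledTangle n) : D.IsOriented ↔
    ∀ x, xor (xor (D.pointsIn x) (D.pointsIn (D.partner x))) (D.bead x) = true := by
  refine forall_congr' fun x => ?_
  cases D.bead x <;> cases D.pointsIn x <;> cases D.pointsIn (D.partner x) <;> simp

/-- Stacking an arc whose two ends are admissibly labelled before and after preserves
orientedness. -/
theorem IsOriented.stack {D D' : LabelledTangle n} (h : D.IsOriented) (hv : D.toTangle.Valid)
    {l r : Fin n} (hlr : l ≠ r) {c : Bool} (ht : D'.toTangle = D.toTangle.stack l r c)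
    (hs : D'.south = D.south) (hn : ∀ p, p ≠ l → p ≠ r → D'.north p = D.north p)
    (h1 : xor (xor (D.north l) (D.north r)) c = true)
    (h2 : xor (xor (D'.north l) (D'.north r)) c = true) : D'.IsOriented := by
  have hp : ∀ x, x ≠ .inr l → x ≠ .inr r → D'.pointsIn x = D.pointsIn x := by
    rintro (x | x) hl hr
    · exact congrFun hs x
    · simp only [pointsIn, Sum.elim_inr]
      rw [hn x (fun e => hl (e ▸ rfl)) (fun e => hr (e ▸ rfl))]
  have k1 : xor (xor (D.pointsIn (.inr l)) (D.pointsIn (.inr r))) c = true := by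
    simpa [pointsIn] using h1
  have k2 : xor (xor (D'.pointsIn (.inr l)) (D'.pointsIn (.inr r))) c = true := by
    simpa [pointsIn] using h2
  have hLR : (Sum.inr l : Fin n ⊕ Fin n) ≠ .inr r := fun e => hlr (Sum.inr_injective e)
  -- The parities of two strands and of the arc that joins them add up to the parity of the
  -- resulting strand.
  have key : ∀ a b c a' b' a'' b'', xor (xor a b) c = true → xor (xor a a'') a' = true →
      xor (xor b b'') b' = true → xor (xor a'' b'') (xor (xor a' c) b') = true := by
    decide
  rw [isOriented_iff] at *
  obtain ⟨hi, hne, hb⟩ := hv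
  intro x
  rw [ht]
  simp only [Tangle.stack]
  generalize (Sum.inr l : Fin n ⊕ Fin n) = L at *
  generalize (Sum.inr r : Fin n ⊕ Fin n) = R at *
  have hL := h L
  have hR := h R
  have hx := h x
  by_cases e1 : x = L
  · subst e1
    simpa using k2
  by_cases e2 : x = R
  · subst e2
    rw [if_neg e1, if_pos rfl, if_pos (.inr rfl), Bool.xor_comm (D'.pointsIn x)]
    exact k2
  rw [if_neg e1, if_neg e2, if_neg (not_or.2 ⟨e1, e2⟩), hp x e1 e2]
  by_cases e3 : x = D.partner L
  · have e4 : D.partner R ≠ L := fun e => e2 (by rw [e3, ← e, hi])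
    rw [if_pos e3, if_pos (.inl e3), hp _ e4 (hne R), e3]
    exact key _ _ _ _ _ _ _ k1 hL hR
  by_cases e5 : x = D.partner R
  · have e4 : D.partner L ≠ R := fun e => e1 (by rw [e5, ← e, hi])
    rw [if_neg e3, if_pos e5, if_pos (.inr e5), hp _ (hne L) e4, e5]
    rw [Bool.xor_comm (D.pointsIn (D.partner R))]
    exact key _ _ _ _ _ _ _ k1 hL hR
  rw [if_neg e3, if_neg e5, if_neg (not_or.2 ⟨e3, e5⟩), hp _ (fun e => e3 (by rw [← e, hi]))
    (fun e => e5 (by rw [← e, hi]))]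
  exact hx

end LabelledTangle

namespace ArrowModel

variable {X : CoxeterPair} {m : ArrowModel X}

theorem wordTangle_snoc (ω : List X.Node) (i : X.Node) : m.wordTangle (ω ++ [i]) =
    (m.wordTangle ω).stack (m.left i) (m.right i) (m.beaded i) := by
  simp [wordTangle]

theorem valid_wordTangle (h : m.Regular) (ω : List X.Node) : (m.wordTangle ω).Valid := by
  induction ω using List.reverseRecOn with
  | nil => exact Tangle.valid_one _
  | append_singleton ω i ih =>
    rw [wordTangle_snoc]
    exact ih.stack (h.ne i) _

variable {M : Minuscule X}

theorem Labelling.lab_wt (l : m.Labelling M) (c : X.Coset) :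
    l.lab (M.wt c) = m.diagram c.val := l.lab_pt _

theorem Labelling.xor_of_v_ne (l : m.Labelling M) {x : M.Ω} {i : X.Node} (h : M.v x i ≠ 0) :
    xor (xor (l.lab x (m.left i)) (l.lab x (m.right i))) (m.beaded i) = true := by
  rw [ne_eq, l.v_zero, incoming] at h
  revert h
  cases l.lab x (m.left i) <;> cases l.lab x (m.right i) <;> cases m.beaded i <;> decide

/-- Both ends of an edge have nonzero pairing with its label, which says that their labels are
admissible at the southern and the northern arc of the generator. -/
theorem isOriented_diagramOfPath (h : m.Regular) (l : m.Labelling M) {c : X.Coset}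
    (S : X.Path c) : (m.diagramOfPath S).IsOriented := by
  induction S with
  | nil =>
    rw [LabelledTangle.isOriented_iff]
    rintro (x | x)
    · change xor (xor (m.diagram 1 x) (!m.diagram 1 x)) false = true
      cases m.diagram 1 x <;> rfl
    · change xor (xor (!m.diagram 1 x) (m.diagram 1 x)) false = true
      cases m.diagram 1 x <;> rfl
  | @snoc x y S i e ih =>
    obtain ⟨h1, h2⟩ := (Minuscule.extEdge_iff (m := M)).1 e
    have hy : M.v (M.wt y) i ≠ 0 := by
      rcases h2 with h2 | h2
      · rwa [h2]
      · rw [h2, M.v_self]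
        omega
    refine ih.stack (D' := m.diagramOfPath (S.snoc i e)) (c := m.beaded i)
      (valid_wordTangle h S.weight) (h.ne i)
      (wordTangle_snoc S.weight i) rfl (fun p hl hr => ?_) ?_ ?_
    · change m.diagram y.val p = m.diagram x.val p
      rw [← l.lab_wt, ← l.lab_wt]
      rcases h2 with h2 | h2
      · rw [h2]
      · rw [h2, l.lab_s, act_of_ne hl hr]
    · have := l.xor_of_v_ne h1
      rwa [l.lab_wt] at this
    · have := l.xor_of_v_ne hy
      rwa [l.lab_wt] at this

/-- The tangle of the reduced words of a weight. -/
noncomputable def tangle (m : ArrowModel X) (x : M.Ω) : Tangle m.size := m.wordTangle (M.word x)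

theorem valid_tangle (h : m.Regular) (x : M.Ω) : (m.tangle x).Valid := valid_wordTangle h _

theorem wordTangle_eq (h : m.Regular) (l : m.Labelling M) {ω : List X.Node} {x : M.Ω}
    (hω : M.Climb ω x) : m.wordTangle ω = m.tangle x := by
  refine hω.foldl_eq _ _ (fun x i j ω _ hM hi hj _ => ?_) (M.climb_word x)
  change ((m.wordTangle ω).stack _ _ _).stack _ _ _ = ((m.wordTangle ω).stack _ _ _).stack _ _ _
  rcases h.comm i j hM with ⟨h1, h2, h3, h4⟩ | ⟨h1, h2, h3⟩
  · exact Tangle.stack_comm (valid_wordTangle h ω) (h.ne i) (h.ne j) h1 h2 h3 h4 _ _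
  -- The reflections `s_1` and `s_{1''}` share their positions. They are never both ascents, since
  -- that would require two different labels in the left position.
  · have hi := (l.v_up.1 hi).1
    have hj := (l.v_up.1 hj).1
    rw [incoming, h1, h3] at hi
    rw [incoming] at hj
    revert hi hj
    cases l.lab x (m.left j) <;> cases m.beaded j <;> simp

theorem tangle_s (h : m.Regular) (l : m.Labelling M) {x : M.Ω} {i : X.Node} (hv : M.v x i = 1) :
    m.tangle (M.s i x) = (m.tangle x).stack (m.left i) (m.right i) (m.beaded i) := by
  rw [← wordTangle_eq h l ((M.climb_word x).snoc i hv), wordTangle_snoc]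
  rfl

theorem tangle_o (h : m.Regular) (l : m.Labelling M) : m.tangle M.o = Tangle.one m.size :=
  (wordTangle_eq h l .nil).symm

/-- A reduced word may be chosen to end in any given descent, so the topmost generator supplies the
arc. -/
theorem tangle_arc (h : m.Regular) (l : m.Labelling M) {x : M.Ω} {i : X.Node}
    (hv : M.v x i = -1) : (m.tangle x).nb (m.left i) = some (m.right i) ∧
      (m.tangle x).bd (m.left i) = m.beaded i := by
  have := tangle_s h l (M.v_up hv)
  rw [M.s_s] at this
  rw [this, Tangle.nb_stack (valid_tangle h _), Tangle.bd_stack (valid_tangle h _), if_pos rfl,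
    if_pos (.inl rfl)]
  exact ⟨rfl, rfl⟩

end ArrowModel

/-! ### Sliding an arc to an adjacent pair of vertices -/

namespace Tangle

/-- Straightening a zigzag, as in `e_i e_j e_i = e_i`: the tangle `d` already ends in the arc from
`m` to `b` with the same bead. -/
theorem stack_stack {n : ℕ} {d : Tangle n} (hd : d.Valid) {a m b : Fin n} (ham : a ≠ m)
    (hab : a ≠ b) {c c' : Bool} (h : d.nb m = some b) (hc : d.bd m = c') :
    (d.stack a m c).stack m b c' = d := by
  have hmb : m ≠ b := fun e => hd.nb_ne (e ▸ h)
  rw [nb_eq_some] at h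
  unfold bd at hc
  have inj : ∀ {a b : Fin n}, a ≠ b → (Sum.inr a : Fin n ⊕ Fin n) ≠ Sum.inr b :=
    fun h e => h (Sum.inr_injective e)
  have k1 := inj ham
  have k2 := inj hab
  have k3 := inj hmb
  obtain ⟨hi, hn, hb⟩ := hd
  have hxor : ∀ x y z : Bool, xor (xor y z) (xor (xor x y) z) = x := by decide
  ext x
  · simp only [stack]
    grind
  · have hb' : d.bead (.inr b) = c' := by rw [← h, hb, hc]
    have e1 : (.inr b : Fin n ⊕ Fin n) ≠ d.partner (.inr a) := fun e => k1.symm (by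
      rw [← hi (.inr m), h, e, hi])
    simp only [stack, h, k1.symm, k2.symm, k3.symm, e1, or_true, or_false, if_true, if_false, hc,
      hxor]
    split_ifs with h1 h2 h3 h4
    · rcases h1 with rfl | rfl
      · exact hc.symm
      · exact hb'.symm
    · rcases h2 with rfl | rfl
      · rfl
      · exact (hb _).symm
    all_goals grind

end Tangle

namespace ArrowModel

variable {X X' : CoxeterPair} {m : ArrowModel X} {m' : ArrowModel X'}

/-- The positions `f τ` away from the pair of `τ`, with the gauge `z τ`, slide to those away from
the pair of `c`, which is next to the right. -/
def Slides (m : ArrowModel X) {k : ℕ} (f : X.Node → Fin k → Fin m.size)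
    (z : X.Node → Fin k → Bool) (τ c : X.Node) : Prop :=
  m.right τ = m.left c ∧ m.beaded c = false ∧ ∃ j₀, f τ j₀ = m.right c ∧
    ∀ j, f c j = (if j = j₀ then m.left τ else f τ j) ∧
      z c j = if j = j₀ then xor (z τ j) (m.beaded τ) else z τ j

/-- Enumerations of the positions away from the pair of a node. -/
structure IsDeletion (m : ArrowModel X) {k : ℕ} (f : X.Node → Fin k → Fin m.size)
    (z : X.Node → Fin k → Bool) : Prop where
  inj : ∀ τ, Function.Injective (f τ)
  range : ∀ τ p, (∃ j, f τ j = p) ↔ p ≠ m.left τ ∧ p ≠ m.right τ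
  adj : ∀ τ c, X.M τ c = 3 → Slides m f z τ c ∨ Slides m f z c τ

variable {M : Minuscule X} {M' : Minuscule X'} (l : m.Labelling M) (l' : m'.Labelling M')
  (f : X.Node → Fin m'.size → Fin m.size) (z : X.Node → Fin m'.size → Bool)

/-- The labelling and the northern half diagram of `y` are obtained from those of `x` by deletion
of the pair of `τ`. -/
def Deletes (τ : X.Node) (x : M.Ω) (y : M'.Ω) : Prop :=
  (∀ j, l.lab x (f τ j) = xor (l'.lab y j) (z τ j)) ∧
    (m.tangle x).Restricts (f τ) (z τ) (m'.tangle y)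

variable {l l' f z}

/-- The pair of `τ` is `{a, p}` and that of `c` is `{p, b}`; this covers `c` on either side of `τ`.
Stacking the arc of `c` moves the strand at `b` to `a` by `Restricts.slide`. If `phi` goes up, the
stacked tangle is the one of the image. If it goes down, the stacking completes a zigzag, and
straightening it returns the tangle of `s τ x`. -/
theorem Deletes.phi_aux (hm : m.Regular) (hm' : m'.Regular) (hf : IsDeletion m f z)
    {τ c : X.Node} {x : M.Ω} {y : M'.Ω} (hτc : X.M τ c = 3) (hx : M.v x τ = -1)
    (h : Deletes l l' f z τ x y) {a p b : Fin m.size} {j₀ : Fin m'.size}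
    (hτ : ∀ d : Tangle m.size, d.Valid →
      d.stack (m.left τ) (m.right τ) (m.beaded τ) = d.stack a p (m.beaded τ))
    (hc : ∀ d : Tangle m.size, d.Valid →
      d.stack (m.left c) (m.right c) (m.beaded c) = d.stack p b (m.beaded c))
    (hap : a ≠ p) (hab : a ≠ b) (hfa : ∀ j, f τ j ≠ a) (hfp : ∀ j, f τ j ≠ p)
    (hb : f τ j₀ = b) (hf' : ∀ j, f c j = if j = j₀ then a else f τ j)
    (hz' : ∀ j, z c j = if j = j₀ then xor (z τ j) (xor (m.beaded τ) (m.beaded c)) else z τ j)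
    (h1 : M.v x c = 1 → l.lab (M.s c x) a = xor (l.lab x b) (xor (m.beaded τ) (m.beaded c)))
    (h0 : M.v x c = 0 → l.lab (M.s τ x) a = xor (l.lab x b) (xor (m.beaded τ) (m.beaded c))) :
    Deletes l l' f z c (M.phi τ c x) y := by
  have hg := tangle_s hm l (M.v_up hx)
  rw [M.s_s, hτ _ (valid_tangle hm _)] at hg
  have harc : (m.tangle x).nb a = some p ∧ (m.tangle x).bd a = m.beaded τ := by
    rw [hg, Tangle.nb_stack (valid_tangle hm _), Tangle.bd_stack (valid_tangle hm _), if_pos rfl,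
      if_pos (.inl rfl)]
    exact ⟨rfl, rfl⟩
  have hs : ((m.tangle x).stack p b (m.beaded c)).Restricts (f c) (z c) (m'.tangle y) :=
    Tangle.Restricts.slide (valid_tangle hm x) (hf.inj τ) h.2 (valid_tangle hm' y) harc.1 harc.2
      hb hfp hfa hf' hz'
  have hlab : ∀ w : M.Ω, l.lab w a = xor (l.lab x b) (xor (m.beaded τ) (m.beaded c)) →
      (∀ j, j ≠ j₀ → l.lab w (f τ j) = l.lab x (f τ j)) →
      ∀ j, l.lab w (f c j) = xor (l'.lab y j) (z c j) := by
    intro w hw hw' j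
    rw [hf', hz']
    by_cases e : j = j₀
    · rw [if_pos e, if_pos e, hw, ← hb, h.1, e, Bool.xor_assoc]
    · rw [if_neg e, if_neg e, hw' j e, h.1]
  have hne : ∀ j, j ≠ j₀ → f τ j ≠ b := fun j e e' => e (hf.inj τ (e'.trans hb.symm))
  rcases Minuscule.v_adj_wall hτc hx with hv | hv
  · rw [Minuscule.phi_up hv]
    refine ⟨hlab _ (h1 hv) fun j hj => ?_, ?_⟩
    · rw [l.lab_s]
      have : f c j = f τ j := by rw [hf', if_neg hj]
      obtain ⟨e1, e2⟩ := (hf.range c (f τ j)).1 ⟨j, this⟩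
      rw [act_of_ne e1 e2]
    · rw [tangle_s hm l hv, hc _ (valid_tangle hm x)]
      exact hs
  · rw [Minuscule.phi_down hv]
    refine ⟨hlab _ (h0 hv) fun j hj => ?_, ?_⟩
    · rw [l.lab_s]
      obtain ⟨e1, e2⟩ := (hf.range τ (f τ j)).1 ⟨j, rfl⟩
      rw [act_of_ne e1 e2]
    · have hv' : M.v (M.s τ x) c = -1 := by rw [M.v_adj _ _ _ hτc]; omega
      have hg' := tangle_s hm l (M.v_up hv')
      rw [M.s_s, hc _ (valid_tangle hm _)] at hg'
      have harc' : (m.tangle (M.s τ x)).nb p = some b ∧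
          (m.tangle (M.s τ x)).bd p = m.beaded c := by
        rw [hg', Tangle.nb_stack (valid_tangle hm _), Tangle.bd_stack (valid_tangle hm _),
          if_pos rfl, if_pos (.inl rfl)]
        exact ⟨rfl, rfl⟩
      rwa [hg, Tangle.stack_stack (valid_tangle hm _) hap hab harc'.1 harc'.2] at hs

theorem Deletes.phi (hm : m.Regular) (hm' : m'.Regular) (hf : IsDeletion m f z)
    {τ c : X.Node} {x : M.Ω} {y : M'.Ω} (hτc : X.M τ c = 3) (hx : M.v x τ = -1)
    (h : Deletes l l' f z τ x y) : Deletes l l' f z c (M.phi τ c x) y := by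
  have hlτ := hm.succ τ
  have hlc := hm.succ c
  have hxτ := l.v_down.1 hx
  have hrange := fun j => (hf.range τ (f τ j)).1 ⟨j, rfl⟩
  unfold incoming at hxτ
  rcases hf.adj τ c hτc with ⟨e1, e2, j₀, e3, e4⟩ | ⟨e1, e2, j₀, e3, e4⟩
  · have n1 : m.left τ ≠ m.right c := fun e => by
      rw [e1] at hlτ
      rw [e] at hlτ
      omega
    refine h.phi_aux (a := m.left τ) (p := m.left c) (b := m.right c) hm hm' hf hτc hx
      (fun d _ => by rw [e1]) (fun d _ => rfl) (e1 ▸ hm.ne τ) n1 (fun j => (hrange j).1)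
      (fun j => e1 ▸ (hrange j).2) e3 (fun j => (e4 j).1)
      (fun j => by rw [(e4 j).2, e2, Bool.xor_false]) (fun hv => ?_) (fun hv => ?_)
    · have hv := l.v_up.1 hv
      rw [l.lab_s, act_of_ne (e1 ▸ hm.ne τ) n1, hv.2, e2]
      revert hxτ
      cases l.lab x (m.left τ) <;> cases m.beaded τ <;> simp
    · have hv := l.v_zero.1 hv
      rw [l.lab_s, act_left, ← hv, incoming, e1, e2]
      simp
  · have n1 : m.right τ ≠ m.left c := fun e => by
      rw [e1] at hlc
      rw [e] at hlτ
      omega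
    have n2 : m.left τ ≠ m.left c := fun e => by
      rw [e1, e] at hlc
      omega
    have k3 : f τ j₀ = m.left c := by rw [(e4 j₀).1, if_pos rfl]
    rw [e2, Bool.xor_false] at hxτ
    refine h.phi_aux (a := m.right τ) (p := m.left τ) (b := m.left c) hm hm' hf hτc hx
      (fun d hd => Tangle.stack_symm hd (hm.ne τ) _)
      (fun d hd => by rw [e1]; exact Tangle.stack_symm hd n2.symm _) (hm.ne τ).symm n1
      (fun j => (hrange j).2) (fun j => (hrange j).1) k3
      (fun j => ?_) (fun j => ?_) (fun hv => ?_) (fun hv => ?_)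
    · rw [(e4 j).1]
      by_cases e : j = j₀
      · rw [if_pos e, e, e3]
      · rw [if_neg e, if_neg e]
    · rw [(e4 j).2, e2]
      by_cases e : j = j₀
      · rw [if_pos e, if_pos e]
        simp
      · rw [if_neg e, if_neg e]
    · have hv := l.v_up.1 hv
      rw [incoming] at hv
      rw [l.lab_s, act_of_ne n1 (e1 ▸ (hm.ne τ).symm), hxτ.2, e2, Bool.false_xor, hv.1]
    · have hv := l.v_zero.1 hv
      rw [incoming, e1, hxτ.1] at hv
      rw [l.lab_s, act_right hm, incoming, hxτ.1, e2]
      simpa using hv.symm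

/-- On the wall the two labels at the pair of `τ` are forced. -/
theorem Labelling.ext_of_wall (hf : IsDeletion m f z) {τ : X.Node} {x x' : M.Ω}
    (hx : M.v x τ = -1) (hx' : M.v x' τ = -1)
    (h : ∀ j, l.lab x (f τ j) = l.lab x' (f τ j)) : x = x' := by
  refine l.inj (funext fun p => ?_)
  have h1 := l.v_down.1 hx
  have h2 := l.v_down.1 hx'
  by_cases e1 : p = m.left τ
  · have := h1.1.trans h2.1.symm
    rw [e1]
    exact Bool.xor_left_inj.1 this
  by_cases e2 : p = m.right τ
  · rw [e2, h1.2, h2.2]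
  obtain ⟨j, rfl⟩ := (hf.range τ p).2 ⟨e1, e2⟩
  exact h j

/-- The nodes of the smaller pair act on the positions away from the pair of `τ` like the nodes
`κ j`. -/
structure IsNodeLift (m : ArrowModel X) (m' : ArrowModel X') (f : X.Node → Fin m'.size → Fin m.size)
    (z : X.Node → Fin m'.size → Bool) (τ : X.Node) (κ : X'.Node → X.Node) : Prop where
  left : ∀ j, f τ (m'.left j) = m.left (κ j)
  right : ∀ j, f τ (m'.right j) = m.right (κ j)
  beaded : ∀ j, m.beaded (κ j) = xor (m'.beaded j) (z τ (m'.left j))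
  gauge : ∀ j, z τ (m'.right j) = false
  comm : ∀ j, X.M (κ j) τ = 2
  cover : ∀ i, (∃ j, κ j = i) ∨ i = τ ∨ m.right i = m.left τ

section Lift

variable {τ : X.Node} {κ : X'.Node → X.Node}

theorem IsNodeLift.act (hm : m.Regular) (hm' : m'.Regular) (hf : IsDeletion m f z)
    (hκ : IsNodeLift m m' f z τ κ) {x : Fin m.size → Bool} {y : Fin m'.size → Bool}
    (h : ∀ p, x (f τ p) = xor (y p) (z τ p)) (j : X'.Node) (p : Fin m'.size) :
    m.act (κ j) x (f τ p) = xor (m'.act j y p) (z τ p) := by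
  by_cases e1 : p = m'.left j
  · subst e1
    rw [act_left, hκ.left, act_left, ← hκ.right, h, hκ.gauge, hκ.beaded, Bool.xor_false,
      Bool.xor_assoc]
  by_cases e2 : p = m'.right j
  · subst e2
    rw [act_right hm', hκ.right, act_right hm, hκ.gauge, incoming, incoming, ← hκ.left, h,
      hκ.beaded]
    generalize y (m'.left j) = a
    generalize z τ (m'.left j) = b
    generalize m'.beaded j = c
    revert a b c
    decide
  rw [act_of_ne e1 e2, act_of_ne, h]
  · rw [← hκ.left]
    exact fun e => e1 (hf.inj τ e)
  · rw [← hκ.right]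
    exact fun e => e2 (hf.inj τ e)

theorem IsNodeLift.v_eq (hκ : IsNodeLift m m' f z τ κ) (l : m.Labelling M) (l' : m'.Labelling M')
    {x : M.Ω} {y : M'.Ω}
    (h : ∀ p, l.lab x (f τ p) = xor (l'.lab y p) (z τ p)) (j : X'.Node) :
    M'.v y j = M.v x (κ j) := by
  rw [l.v_eq, l'.v_eq, incoming, incoming, ← hκ.left, ← hκ.right, h, h, hκ.gauge, hκ.beaded]
  generalize l'.lab y (m'.left j) = a
  generalize z τ (m'.left j) = b
  generalize m'.beaded j = c
  cases a <;> cases b <;> cases c <;> simp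

theorem IsNodeLift.deletes (hm : m.Regular) (hm' : m'.Regular) (hf : IsDeletion m f z)
    (hκ : IsNodeLift m m' f z τ κ) {x : M.Ω} {y : M'.Ω} (h : Deletes l l' f z τ x y) {j : X'.Node}
    (hv : M'.v y j = 1) : Deletes l l' f z τ (M.s (κ j) x) (M'.s j y) := by
  refine ⟨fun p => ?_, ?_⟩
  · rw [l.lab_s, l'.lab_s]
    exact hκ.act hm hm' hf h.1 j p
  · rw [tangle_s hm' l' hv, tangle_s hm l (by rw [← hκ.v_eq l l' h.1, hv]), ← hκ.left, ← hκ.right]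
    exact h.2.stack (valid_tangle hm x) (valid_tangle hm' y) (hf.inj τ) (hm'.ne j)
      (by rw [hκ.beaded, hκ.gauge, Bool.xor_false])

/-- The preimage of `y` is found by lifting a climb to `y` letter by letter from the base case `h₀`.
It is independent of the climb because the remaining labels determine a point of the wall. -/
theorem IsNodeLift.exists_contraction (hm : m.Regular) (hm' : m'.Regular) (hf : IsDeletion m f z)
    (hκ : IsNodeLift m m' f z τ κ) (hb : m.beaded τ = false)
    (h₀ : ∃ x, M.v x τ = -1 ∧ Deletes l l' f z τ x M'.o)
    (surj : ∀ x, M.v x τ = -1 → ∃ y, ∀ j, l.lab x (f τ j) = xor (l'.lab y j) (z τ j)) :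
    ∃ g, Minuscule.Contraction M M' τ g ∧ ∀ y, Deletes l l' f z τ (g y) y := by
  have hex : ∀ y, ∃ x, M.v x τ = -1 ∧ Deletes l l' f z τ x y := by
    intro y
    obtain ⟨ω, hω⟩ := M'.exists_climb y
    induction hω with
    | nil => exact h₀
    | snoc j _ hv ih =>
      obtain ⟨x, hx, h⟩ := ih
      exact ⟨M.s (κ j) x, by rw [M.v_comm _ _ _ (hκ.comm j), hx], hκ.deletes hm hm' hf h hv⟩
  choose g hg hd using hex
  have hs : ∀ j y, g (M'.s j y) = M.s (κ j) (g y) := by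
    intro j y
    refine l.ext_of_wall hf (hg _) (by rw [M.v_comm _ _ _ (hκ.comm j), hg]) fun p => ?_
    rw [(hd _).1, l'.lab_s, l.lab_s, hκ.act hm hm' hf (hd y).1]
  have hv : ∀ j y, M'.v y j = M.v (g y) (κ j) := fun j y => hκ.v_eq l l' (hd y).1 j
  refine ⟨g, .of_lift hg (fun y y' e => l'.inj (funext fun j => ?_)) (fun x hx => ?_)
    (fun j => ⟨_, .of_comm (hv j) (hs j)⟩) (fun a b hab => ?_), hd⟩
  · have h1 := (hd y).1 j
    rw [e, (hd y').1 j] at h1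
    exact (Bool.xor_left_inj.1 h1).symm
  · obtain ⟨y, hy⟩ := surj x hx
    exact ⟨y, l.ext_of_wall hf (hg _) hx fun j => by rw [(hd y).1, hy]⟩
  -- A climb between elements of the wall never moves the labels at the pair of `τ`.
  let w : M.Ω → ℕ := fun x =>
    2 * (l.lab x (m.right τ)).toNat + (l.lab x (m.left τ)).toNat
  have hwg : ∀ y, w (g y) = 2 := by
    intro y
    have := l.v_down.1 (hg y)
    rw [incoming, hb, Bool.xor_false] at this
    simp only [w, this]
    rfl
  -- The quantity `w` reads the two labels at `τ` as binary digits. It never decreases along a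
  -- climb, and increases strictly at `τ` and at a node ending at its left position. Both end points
  -- have value `2`, so only lifted nodes occur between them.
  have key : ∀ x, M.Le (g a) x → 2 ≤ w x ∧ (w x = 2 → ∃ c, x = g c ∧ M'.Le a c) := by
    intro x hx
    induction hx with
    | refl => exact ⟨(hwg a).ge, fun _ => ⟨a, rfl, .refl⟩⟩
    | @step x i _ hi ih =>
      have hi' := l.v_up.1 hi
      have e1 := hm.succ i
      have e2 := hm.succ τ
      rcases hκ.cover i with ⟨j, rfl⟩ | rfl | hr
      · have n1 := (hf.range τ _).1 ⟨_, hκ.left j⟩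
        have n2 := (hf.range τ _).1 ⟨_, hκ.right j⟩
        have hw : w (M.s (κ j) x) = w x := by
          simp only [w, l.lab_s]
          rw [act_of_ne n1.1.symm n2.1.symm, act_of_ne n1.2.symm n2.2.symm]
        rw [hw]
        refine ⟨ih.1, fun h => ?_⟩
        obtain ⟨c, rfl, hc⟩ := ih.2 h
        exact ⟨M'.s j c, (hs j c).symm, hc.step j (by rw [hv, hi])⟩
      · have : w x < w (M.s i x) := by
          simp only [w, l.lab_s, act_right hm, act_left, hi'.1, hi'.2, hb]
          have : l.lab x (m.left i) = true := by simpa [incoming, hb] using hi'.1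
          simp [this]
        exact ⟨by omega, by omega⟩
      · have : w x < w (M.s i x) := by
          simp only [w, l.lab_s]
          rw [← hr, act_right hm, hi'.1, hi'.2, act_of_ne]
          · simp
          · intro e
            have := congrArg Fin.val e
            have := congrArg Fin.val hr
            omega
          · intro e
            have := congrArg Fin.val e
            have := congrArg Fin.val hr
            omega
        exact ⟨by omega, by omega⟩
  obtain ⟨c, hc, hac⟩ := (key _ hab).2 (hwg b)
  obtain rfl : b = c := l'.inj (funext fun j => by
    have h1 := (hd b).1 j
    rw [hc, (hd c).1 j] at h1
    exact (Bool.xor_left_inj.1 h1).symm)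
  exact hac

end Lift

/-- The tangle of `s_τ` is a single generator, and without its northern arc only vertical strands
remain in the northern half. -/
theorem deletes_start (hm : m.Regular) (hm' : m'.Regular) (hf : IsDeletion m f z) {τ : X.Node}
    (hv : M.v M.o τ = 1) (hz : ∀ j, z τ j = false) (h : ∀ j, m.start (f τ j) = m'.start j) :
    Deletes l l' f z τ (M.s τ M.o) M'.o := by
  have hr := fun j => (hf.range τ (f τ j)).1 ⟨j, rfl⟩
  refine ⟨fun j => ?_, ?_⟩
  · rw [l.lab_s, act_of_ne (hr j).1 (hr j).2, l.lab_pt, l'.lab_pt, diagram_one, diagram_one, h, hz,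
      Bool.xor_false]
  · intro j
    rw [tangle_s hm l hv, tangle_o hm l, tangle_o hm' l', Tangle.nb_stack (Tangle.valid_one _),
      Tangle.bd_stack (Tangle.valid_one _), if_neg (hr j).1, if_neg (hr j).2,
      if_neg (not_or.2 (hr j)), hz]
    exact ⟨rfl, rfl⟩

/-- Different nodes are convenient for different purposes. At `τ₀`, outside the parabolic, the
diagrams of the base point are explicit; they are slid to `τ₁`, where the nodes of the smaller pair
lift to single nodes, and the contraction found there is slid to `τ`. -/
theorem exists_contraction (hm : m.Regular) (hm' : m'.Regular) (hf : IsDeletion m f z)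
    (reach : ∀ σ τ : X.Node, Relation.ReflTransGen (fun i j => X.M i j = 3) σ τ)
    {τ₀ τ₁ : X.Node} (hv : M.v M.o τ₀ = 1) (hz : ∀ j, z τ₀ j = false)
    (h : ∀ j, m.start (f τ₀ j) = m'.start j) {κ : X'.Node → X.Node}
    (hκ : IsNodeLift m m' f z τ₁ κ) (hb : m.beaded τ₁ = false)
    (surj : ∀ x, M.v x τ₁ = -1 → ∃ y, ∀ j, l.lab x (f τ₁ j) = xor (l'.lab y j) (z τ₁ j))
    (τ : X.Node) : ∃ g, Minuscule.Contraction M M' τ g ∧ ∀ y, Deletes l l' f z τ (g y) y := by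
  have h₀ : ∀ σ, ∃ x, M.v x σ = -1 ∧ Deletes l l' f z σ x M'.o := by
    intro σ
    induction reach τ₀ σ with
    | refl => exact ⟨_, M.v_down hv, deletes_start hm hm' hf hv hz h⟩
    | tail _ hM ih =>
      obtain ⟨x, hx, hd⟩ := ih
      exact ⟨_, Minuscule.v_phi hM hx, hd.phi hm hm' hf hM hx⟩
  exact Minuscule.Contraction.transport_of_reachable (Deletes l l' f z)
    (fun τ c x y hM hx hd => hd.phi hm hm' hf hM hx) (reach τ₁ τ)
    (hκ.exists_contraction hm hm' hf hb (h₀ τ₁) surj)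

end ArrowModel

/-! ### Deleting a pair of neighbouring positions -/

namespace ArrowModel

variable {X X' : CoxeterPair} {m : ArrowModel X} {m' : ArrowModel X'}

theorem skipPair_val {n : ℕ} (l : ℕ) (j : Fin (n - 2)) :
    (skipPair (n := n) l j).val = if j.val < l then j.val else j.val + 2 := by
  unfold skipPair
  split_ifs <;> rfl

theorem isDeletion_skipPair (hm : m.Regular) (z : X.Node → Fin (m.size - 2) → Bool)
    (hz : ∀ τ c, m.right τ = m.left c → m.beaded c = false → ∀ j,
      z c j = if j.val = (m.left τ).val then xor (z τ j) (m.beaded τ) else z τ j) :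
    IsDeletion m (fun τ => skipPair (m.left τ).val) z := by
  have key : ∀ τ c, m.right τ = m.left c → m.beaded c = false →
      Slides m (fun τ => skipPair (m.left τ).val) z τ c := by
    intro τ c e hb
    have h1 := hm.succ τ
    have h2 := hm.succ c
    have h3 := (m.right c).2
    have h4 := congrArg Fin.val e
    -- The right position of `c` is two to the right of `m.left τ`, so after deletion of the pair of
    -- `τ` it has the index of `m.left τ`.
    refine ⟨e, hb, ⟨(m.left τ).val, by omega⟩, Fin.ext ?_, fun j => ⟨Fin.ext ?_, ?_⟩⟩
    · rw [skipPair_val, if_neg (by simp)]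
      simp only
      omega
    · simp only [Fin.ext_iff, apply_ite Fin.val, skipPair_val]
      split_ifs <;> omega
    · simp only [Fin.ext_iff]
      exact hz τ c e hb j
  refine ⟨fun τ a b e => Fin.ext ?_, fun τ p => ?_, fun τ c h => ?_⟩
  · have := congrArg Fin.val e
    simp only [skipPair_val] at this
    split_ifs at this <;> omega
  · have h1 := hm.succ τ
    have h2 := (m.right τ).2
    have h3 := p.2
    simp only [ne_eq, Fin.ext_iff, skipPair_val]
    constructor
    · rintro ⟨j, hj⟩
      split_ifs at hj <;> omega
    · rintro ⟨n1, n2⟩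
      by_cases e : p.val < (m.left τ).val
      · exact ⟨⟨p.val, by omega⟩, if_pos e⟩
      · exact ⟨⟨p.val - 2, by omega⟩, by simp only; rw [if_neg (by omega)]; omega⟩
  · exact (hm.adj τ c h).imp (fun h => key _ _ h.1 h.2) fun h => key _ _ h.1 h.2

theorem IsDeletion.sum_eq {k : ℕ} {f : X.Node → Fin k → Fin m.size} {z : X.Node → Fin k → Bool}
    (hm : m.Regular) (hf : IsDeletion m f z) (τ : X.Node) (w : Fin m.size → ℤ) :
    ∑ p, w p = w (m.left τ) + w (m.right τ) + ∑ j, w (f τ j) := by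
  rw [← Finset.sum_pair (hm.ne τ), ← Finset.sum_add_sum_compl {m.left τ, m.right τ} w,
    ← Finset.sum_image (s := Finset.univ) (g := f τ) (fun a _ b _ e => hf.inj τ e)]
  congr 2
  ext p
  have := hf.range τ p
  simp only [Finset.mem_compl, Finset.mem_insert, Finset.mem_singleton, Finset.mem_image,
    Finset.mem_univ, true_and, this, not_or]

variable {M : Minuscule X} {M' : Minuscule X'} {l : m.Labelling M} {l' : m'.Labelling M'}
  {f : X.Node → Fin m'.size → Fin m.size} {z : X.Node → Fin m'.size → Bool}

/-- The arc exists because `mu`, which determines the tangle, lies on the wall. Its degree is zero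
because `lam`, which determines the labels, lies on the wall and so has a `∧` at the right end. -/
theorem hasDegreeZeroArc (hm : m.Regular) (l : m.Labelling M) {τ : X.Node} {lam mu : X.Wall τ}
    {T : X.Path mu.1} (hT : T.IsReduced) (S : X.PathOfWeight lam.1 T) :
    (m.diagramOfPath S.1).northernHalf.HasDegreeZeroArc (m.left τ) (m.right τ) (m.beaded τ) := by
  have ht : m.wordTangle S.1.weight = m.tangle (M.wt mu.1) := by
    rw [S.2, wordTangle_eq hm l (Minuscule.climb_of_path_isReduced hT)]
  obtain ⟨h1, h2⟩ := tangle_arc hm l (Minuscule.bruhatLT_down_iff.1 mu.2)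
  rw [← ht] at h1 h2
  have hv := valid_wordTangle hm S.1.weight
  have h4 : (m.diagramOfPath S.1).northernHalf.label (m.right τ) = true := by
    have := (l.v_down.1 (Minuscule.bruhatLT_down_iff.1 lam.2)).2
    rwa [l.lab_wt] at this
  refine ⟨h1, hv.nb_symm h1, h2, (hv.bd_nb h1).trans h2, ?_⟩
  have h3 : (m.diagramOfPath S.1).northernHalf.partner (m.left τ) = some (m.right τ) := h1
  have h5 : max (m.left τ) (m.right τ) = m.right τ :=
    max_eq_right (Fin.le_def.2 (by have := hm.succ τ; omega))
  simp only [HalfDiagram.strandDegree, h3, h5, h4, if_true]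

theorem exists_orderIso_labels {τ : X.Node}
    (h : ∃ g, Minuscule.Contraction M M' τ g ∧ ∀ y, Deletes l l' f z τ (g y) y) :
    ∃ ψ : X.Wall τ ≃o X'.Coset, ∀ μ j,
      m'.diagram (ψ μ).val j = xor (m.diagram μ.1.val (f τ j)) (z τ j) := by
  obtain ⟨g, hg, hd⟩ := h
  obtain ⟨ψ, hψ⟩ := hg.exists_orderIso
  refine ⟨ψ, fun μ j => ?_⟩
  rw [← l.lab_wt, ← l'.lab_wt, ← hψ, (hd _).1, Bool.xor_assoc, Bool.xor_self, Bool.xor_false]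

/-- Label deletion determines `ψ` as the inverse of `g`. The restriction of tangles then holds for
any bijection, as all paths in a path set have the same weight. -/
theorem exists_equiv_deletes (hm : m.Regular) (hm' : m'.Regular) {τ : X.Node}
    (h : ∃ g, Minuscule.Contraction M M' τ g ∧ ∀ y, Deletes l l' f z τ (g y) y)
    {ψ : X.Wall τ ≃o X'.Coset}
    (hψ : ∀ μ j, m'.diagram (ψ μ).val j = xor (m.diagram μ.1.val (f τ j)) (z τ j))
    (lam mu : X.Wall τ) {T : X.Path mu.1} {T' : X'.Path (ψ mu)} (hT : T.IsReduced)
    (hT' : T'.IsReduced) :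
    ∃ Φ : X.PathOfWeight lam.1 T ≃ X'.PathOfWeight (ψ lam) T', ∀ S,
      (Φ S).1.deg = S.1.deg ∧ (m.wordTangle S.1.weight).Restricts (f τ) (z τ)
        (m'.wordTangle (Φ S).1.weight) := by
  obtain ⟨g, hg, hd⟩ := h
  have key : ∀ μ : X.Wall τ, g (M'.wt (ψ μ)) = M.wt μ.1 := by
    intro μ
    obtain ⟨y, hy⟩ := hg.surj _ (Minuscule.bruhatLT_down_iff.1 μ.2)
    rw [← hy]
    congr 1
    refine l'.inj (funext fun j => ?_)
    rw [l'.lab_wt, hψ, ← l.lab_wt, ← hy, (hd y).1, Bool.xor_assoc, Bool.xor_self, Bool.xor_false]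
  obtain ⟨Φ, hΦ⟩ := hg.exists_equiv_paths (key lam) (key mu) hT hT'
  refine ⟨Φ, fun S => ⟨hΦ S, ?_⟩⟩
  have hr := (hd (M'.wt (ψ mu))).2
  rwa [key, ← wordTangle_eq hm l (Minuscule.climb_of_path_isReduced hT),
    ← wordTangle_eq hm' l' (Minuscule.climb_of_path_isReduced hT'), ← S.2, ← (Φ S).2] at hr

end ArrowModel

namespace ArrowModel

/-! ### The type `A` models -/

theorem coxeterA_two {n : ℕ} {i j : Fin n} (h : CoxeterMatrix.A n i j = 2) :
    i.val ≠ j.val ∧ i.val + 1 ≠ j.val ∧ j.val + 1 ≠ i.val := by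
  change (if i = j then 1 else if (j : ℕ) + 1 = i ∨ (i : ℕ) + 1 = j then 3 else 2) = 2 at h
  simp only [Fin.ext_iff] at h
  split_ifs at h <;> omega

theorem coxeterA_three {n : ℕ} {i j : Fin n} :
    CoxeterMatrix.A n i j = 3 ↔ i.val + 1 = j.val ∨ j.val + 1 = i.val := by
  change (if i = j then 1 else if (j : ℕ) + 1 = i ∨ (i : ℕ) + 1 = j then 3 else 2) = 3 ↔ _
  simp only [Fin.ext_iff]
  split_ifs <;> omega

theorem coxeterA_eq_two {n : ℕ} {i j : Fin n}
    (h : i.val ≠ j.val ∧ i.val + 1 ≠ j.val ∧ j.val + 1 ≠ i.val) : CoxeterMatrix.A n i j = 2 := by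
  change (if i = j then 1 else if (j : ℕ) + 1 = i ∨ (i : ℕ) + 1 = j then 3 else 2) = 2
  simp only [Fin.ext_iff]
  split_ifs <;> omega

theorem regular_modelA (N k : ℕ) : (modelA N k).Regular where
  succ _ := rfl
  zero _ h := by cases h
  comm (i : Fin (N - 1)) (j : Fin (N - 1)) h := by
    have := coxeterA_two h
    exact .inl ⟨fun e => this.1 (congrArg Fin.val e :), fun e => this.2.2 (congrArg Fin.val e :).symm,
      fun e => this.2.1 (congrArg Fin.val e :),
      fun e => this.1 (Nat.succ_injective (congrArg Fin.val e :))⟩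
  adj (i : Fin (N - 1)) (j : Fin (N - 1)) h :=
    (coxeterA_three.1 h).imp (fun e => ⟨Fin.ext e, rfl⟩) fun e => ⟨Fin.ext e, rfl⟩
  simplyLaced (i : Fin (N - 1)) (j : Fin (N - 1)) hij := by
    have hij : i.val ≠ j.val := fun e => hij (Fin.ext e)
    by_cases h : i.val + 1 = j.val ∨ j.val + 1 = i.val
    · exact .inr (coxeterA_three.2 h)
    · exact .inl (coxeterA_eq_two ⟨hij, by omega⟩)

/-- The number of labels `∧`. -/
def count {n : ℕ} (x : Fin n → Bool) : ℤ := ∑ p, if x p then 1 else 0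

theorem count_act {X : CoxeterPair} {m : ArrowModel X} (h : m.Regular) (i : X.Node)
    (x : Fin m.size → Bool) : count (m.act i x) = count x +
      (((xor (x (m.right i)) (m.beaded i)).toInt - (x (m.left i)).toInt) +
      ((m.incoming i x).toInt - (x (m.right i)).toInt)) := by
  unfold count
  simpa only [one_mul] using sum_act h i x fun _ => 1

theorem count_eq_card {n : ℕ} (x : Fin n → Bool) :
    count x = (Finset.univ.filter fun p => x p = true).card := by
  simp [count]

theorem count_lt {n k : ℕ} (hk : k ≤ n) : count (fun p : Fin n => decide (p.val < k)) = k := by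
  rw [count_eq_card]
  simp [Fin.card_filter_val_lt, hk]

/-- A labelling in which no `∨` is followed by a `∧` is determined by the number of its `∧`. -/
theorem eq_decide_lt {n : ℕ} {x : Fin n → Bool} (h : ∀ p q : Fin n, p.val + 1 = q.val →
    x q = true → x p = true) {k : ℕ} (hk : count x = k) (p : Fin n) : x p = decide (p.val < k) := by
  have mono : ∀ p q : Fin n, p ≤ q → x q = true → x p = true := by
    intro p ⟨q, hq⟩ hpq
    induction q with
    | zero =>
      obtain rfl : p = ⟨0, hq⟩ := Fin.ext (Nat.le_zero.1 hpq)
      exact id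
    | succ q ih =>
      rcases hpq.eq_or_lt with rfl | hlt
      · exact id
      · intro hx
        exact ih (by omega) (Fin.le_def.2 (by have := Fin.lt_def.1 hlt; simp only at *; omega))
          (h _ _ rfl hx)
  rw [count_eq_card, Nat.cast_inj] at hk
  cases hx : x p
  · have : (Finset.univ.filter fun q => x q = true) ⊆ Finset.Iio p := by
      intro q hq
      rw [Finset.mem_filter] at hq
      rw [Finset.mem_Iio]
      by_contra hle
      rw [mono p q (not_lt.1 hle) hq.2] at hx
      cases hx
    have := Finset.card_le_card this
    rw [hk, Fin.card_Iio] at this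
    simpa using this
  · have : Finset.Iic p ⊆ Finset.univ.filter fun q => x q = true := by
      intro q hq
      rw [Finset.mem_filter]
      exact ⟨Finset.mem_univ _, mono q p (Finset.mem_Iic.1 hq) hx⟩
    have := Finset.card_le_card this
    rw [hk, Fin.card_Iic] at this
    simpa using this

theorem IsDeletion.count_eq {X : CoxeterPair} {m : ArrowModel X} {k : ℕ}
    {f : X.Node → Fin k → Fin m.size} {z : X.Node → Fin k → Bool} (hf : IsDeletion m f z)
    (hm : m.Regular) {τ : X.Node} {x : Fin m.size → Bool} (hl : x (m.left τ) = false)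
    (hr : x (m.right τ) = true) : count x = 1 + count fun j => x (f τ j) := by
  unfold count
  rw [hf.sum_eq hm τ, hl, hr]
  simp

theorem even_count_xor_first {n : ℕ} (hn : 0 < n) {x y : Fin n → Bool}
    (h : ∀ j, y j = xor (x j) (decide (j.val = 0))) : Even (count y + (1 + count x)) := by
  obtain ⟨n, rfl⟩ : ∃ k, n = k + 1 := ⟨n - 1, by omega⟩
  have h0 : y 0 = !x 0 := by simp [h]
  have h1 : ∀ i : Fin n, y i.succ = x i.succ := fun i => by simp [h]
  simp only [count, Fin.sum_univ_succ, h0, h1]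
  generalize (∑ i : Fin n, if x i.succ = true then (1 : ℤ) else 0) = S
  refine ⟨S + 1, ?_⟩
  cases x 0
  · simp only [Bool.not_false, if_true, Bool.false_eq_true, if_false]
    ring
  · simp only [Bool.not_true, if_true, Bool.false_eq_true, if_false]
    ring

section TypeA

variable (N k : ℕ)

theorem count_start_modelA (hk : k ≤ N) : count (modelA N k).start = k := count_lt hk

theorem count_act_modelA (i : (pairA N k).Node) (x : Fin (modelA N k).size → Bool) (h : count x = k) :
    count ((modelA N k).act i x) = k := by
  have := count_act (regular_modelA N k) i x
  rw [this, h]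
  simp only [incoming, show (modelA N k).beaded i = false from rfl, Bool.xor_false]
  ring

theorem start_modelA_mem (i : (pairA N k).Node) (hi : i ∈ (pairA N k).inP) :
    (modelA N k).incoming i (modelA N k).start =
      (modelA N k).start ((modelA N k).right i) := by
  have : i.val + 1 ≠ k := hi
  simp only [incoming, modelA, Bool.xor_false, decide_eq_decide]
  omega

theorem start_modelA_not_mem (i : (pairA N k).Node) (hi : i ∉ (pairA N k).inP) :
    (modelA N k).incoming i (modelA N k).start = true ∧
      (modelA N k).start ((modelA N k).right i) = false := by
  have : i.val + 1 = k := by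
    by_contra h
    exact hi h
  simp only [incoming, modelA, Bool.xor_false, decide_eq_true_eq, decide_eq_false_iff_not]
  omega

/-- Without a descent no `∨` is directly followed by a `∧`, so the `k` labels `∧` come first. -/
theorem desc_modelA (x : Fin (modelA N k).size → Bool) (h : count x = k) (hx : x ≠ (modelA N k).start) :
    ∃ i, (modelA N k).incoming i x = false ∧ x ((modelA N k).right i) = true := by
  by_contra! hd
  refine hx (funext (eq_decide_lt (fun p q hpq hq => ?_) h))
  by_contra hp
  refine hd (⟨p.val, by have : q.val < N := q.2; omega⟩ : Fin (N - 1)) ?_ ?_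
  · change xor (x p) false = false
    simpa using hp
  · rw [← hq]
    exact congrArg x (Fin.ext hpq)

/-- The weights of type `A`. -/
noncomputable def minusculeA (hk : k ≤ N) : Minuscule (pairA N k) :=
  minuscule (regular_modelA N k) (fun x => count x = k) (count_start_modelA N k hk)
    (count_act_modelA N k) (start_modelA_mem N k) (start_modelA_not_mem N k) (desc_modelA N k)

noncomputable def labellingA (hk : k ≤ N) : (modelA N k).Labelling (minusculeA N k hk) :=
  labelling _ _ _ _ _ _ _

end TypeA

theorem coxeterA_reachable {n : ℕ} (σ τ : Fin n) :
    Relation.ReflTransGen (fun i j => CoxeterMatrix.A n i j = 3) σ τ := by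
  have up : ∀ (d : ℕ) (σ τ : Fin n), σ.val + d = τ.val →
      Relation.ReflTransGen (fun i j => CoxeterMatrix.A n i j = 3) σ τ := by
    intro d
    induction d with
    | zero =>
      intro σ τ h
      obtain rfl : σ = τ := Fin.ext h
      exact .refl
    | succ d ih =>
      intro σ τ h
      have := τ.2
      exact (ih σ ⟨τ.val - 1, by omega⟩ (by simp only; omega)).tail
        (coxeterA_three.2 (.inl (by simp only; omega)))
  rcases le_total σ.val τ.val with h | h
  · exact up (τ.val - σ.val) σ τ (by omega)
  · exact Minuscule.reflTransGen_symm (fun i j h => by rw [(CoxeterMatrix.A n).symmetric]; exact h)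
      (up (σ.val - τ.val) τ σ (by omega))

/-- The positions away from the pair of a node. -/
def skip {X : CoxeterPair} (m : ArrowModel X) (τ : X.Node) : Fin (m.size - 2) → Fin m.size :=
  skipPair (m.left τ).val

theorem isDeletion_modelA (N k : ℕ) :
    IsDeletion (modelA N k) (modelA N k).skip (fun _ _ => false) :=
  isDeletion_skipPair (regular_modelA N k) _ fun τ c _ _ j => by
    rw [show (modelA N k).beaded τ = false from rfl]
    simp

/-- Deleting the last two positions leaves all others in place, so the nodes of the smaller pair
keep their indices. -/
theorem isNodeLift_modelA {N : ℕ} (k k' : ℕ) (hN : 2 ≤ N) :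
    IsNodeLift (modelA N k) (modelA (N - 2) k') (modelA N k).skip (fun _ _ => false)
      (⟨N - 2, by omega⟩ : Fin (N - 1))
      (fun j : Fin (N - 2 - 1) => (⟨j.val, by omega⟩ : Fin (N - 1))) where
  left (j : Fin (N - 2 - 1)) := by
    refine Fin.ext ((skipPair_val _ _).trans (if_pos ?_))
    change j.val < N - 2
    omega
  right (j : Fin (N - 2 - 1)) := by
    refine Fin.ext ((skipPair_val _ _).trans (if_pos ?_))
    change j.val + 1 < N - 2
    omega
  beaded _ := rfl
  gauge _ := rfl
  comm (j : Fin (N - 2 - 1)) := coxeterA_eq_two (by simp only; omega)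
  cover (i : Fin (N - 1)) := by
    by_cases h1 : i.val < N - 2 - 1
    · exact .inl ⟨(⟨i.val, h1⟩ : Fin (N - 2 - 1)), rfl⟩
    by_cases h2 : i.val = N - 2
    · exact .inr (.inl (Fin.ext h2))
    · refine .inr (.inr (Fin.ext ?_))
      change i.val + 1 = N - 2
      omega

theorem exists_contraction_A {N k : ℕ} (h1 : 1 ≤ k) (h2 : k + 1 ≤ N) (hk : k ≤ N)
    (hk' : k - 1 ≤ N - 2) (τ : (pairA N k).Node) :
    ∃ g : (minusculeA (N - 2) (k - 1) hk').Ω → (minusculeA N k hk).Ω,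
      Minuscule.Contraction (minusculeA N k hk) (minusculeA (N - 2) (k - 1) hk') τ g ∧
      ∀ y, Deletes (labellingA N k hk) (labellingA (N - 2) (k - 1) hk')
        (modelA N k).skip (fun _ _ => false) τ (g y) y := by
  refine exists_contraction (regular_modelA N k) (regular_modelA _ _) (isDeletion_modelA N k)
    coxeterA_reachable (τ₀ := (⟨k - 1, by omega⟩ : Fin (N - 1))) ?_ (fun _ => rfl)
    (fun (j : Fin (N - 2)) => ?_) (isNodeLift_modelA k (k - 1) (by omega)) rfl
    (fun (x : {x : Fin N → Bool // count x = k}) hx => ?_) τ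
  · refine (minusculeA N k hk).v_one_not_mem _ fun h => ?_
    have : k - 1 + 1 ≠ k := h
    omega
  · have e := skipPair_val (n := N) (k - 1) j
    change decide ((skipPair (n := N) (k - 1) j).val < k) = decide (j.val < k - 1)
    rw [e, decide_eq_decide]
    split_ifs <;> omega
  · have hv := (labellingA N k hk).v_down.1 hx
    have hs := (isDeletion_modelA N k).count_eq (regular_modelA N k) (x := x.1)
      ((Bool.xor_false _).symm.trans hv.1) hv.2
    have hx2 : count x.1 = k := x.2
    exact ⟨⟨fun j => x.1 ((modelA N k).skip (⟨N - 2, by omega⟩ : Fin (N - 1)) j), by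
      have := (hs.symm.trans hx2)
      push_cast [h1]
      exact eq_sub_of_add_eq' this⟩, fun j => (Bool.xor_false _).symm⟩

/-! ### The type `D` models -/

theorem regular_modelDA (n : ℕ) : (modelDA n).Regular where
  succ _ := rfl
  zero (i : DNode n) h := by
    have : i.1.val = 0 := of_decide_eq_true h
    change i.1.val - 1 = 0
    omega
  comm (i : DNode n) (j : DNode n) h := by
    have := Minuscule.coxeterD_two h
    by_cases e : i.1.val - 1 = j.1.val - 1
    · refine .inr ⟨Fin.ext e, Fin.ext (congrArg (· + 1) e), ?_⟩
      change decide (i.1.val = 0) = !decide (j.1.val = 0)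
      rw [← decide_not, decide_eq_decide]
      omega
    · refine .inl ⟨fun e' => e (congrArg Fin.val e' :), fun e' => ?_, fun e' => ?_,
        fun e' => e (Nat.succ_injective (congrArg Fin.val e' :))⟩
      · have : i.1.val - 1 = j.1.val - 1 + 1 := congrArg Fin.val e'
        omega
      · have : i.1.val - 1 + 1 = j.1.val - 1 := congrArg Fin.val e'
        omega
  adj (i : DNode n) (j : DNode n) h := by
    have := Minuscule.coxeterD_three h
    by_cases e : i.1.val - 1 + 1 = j.1.val - 1
    · exact .inl ⟨Fin.ext e, decide_eq_false (by omega)⟩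
    · refine .inr ⟨Fin.ext (?_ : j.1.val - 1 + 1 = i.1.val - 1), decide_eq_false ?_⟩ <;> omega
  simplyLaced := Minuscule.coxeterD_simplyLaced

section TypeD

variable (n : ℕ)

theorem even_count_act_modelDA (i : (pairDA n).Node) (x : Fin (modelDA n).size → Bool)
    (h : Even (count x)) : Even (count ((modelDA n).act i x)) := by
  rw [count_act (regular_modelDA n), incoming]
  refine h.add ?_
  cases x ((modelDA n).right i) <;> cases x ((modelDA n).left i) <;>
    cases (modelDA n).beaded i <;> decide

theorem start_modelDA_mem (i : (pairDA n).Node) (hi : i ∈ (pairDA n).inP) :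
    (modelDA n).incoming i (modelDA n).start = (modelDA n).start ((modelDA n).right i) := by
  have : i.1.val ≠ 0 := hi
  change xor false (decide (i.1.val = 0)) = false
  simpa using this

theorem start_modelDA_not_mem (i : (pairDA n).Node) (hi : i ∉ (pairDA n).inP) :
    (modelDA n).incoming i (modelDA n).start = true ∧
      (modelDA n).start ((modelDA n).right i) = false := by
  have : i.1.val = 0 := by
    by_contra h
    exact hi h
  refine ⟨?_, rfl⟩
  change xor false (decide (i.1.val = 0)) = true
  simpa using this

theorem desc_modelDA (x : Fin (modelDA n).size → Bool) (h : Even (count x))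
    (hx : x ≠ (modelDA n).start) :
    ∃ i, (modelDA n).incoming i x = false ∧ x ((modelDA n).right i) = true := by
  by_contra! hd
  have hanti : ∀ p q : Fin n, p.val + 1 = q.val → x q = true → x p = true := by
    intro p q hpq hq
    have hq2 := q.2
    by_contra hp
    refine hd (⟨⟨p.val + 1, by omega⟩, by omega⟩ : DNode n) ?_ ?_
    · change xor (x p) false = false
      simpa using hp
    · rw [← hq]
      exact congrArg x (Fin.ext hpq)
  obtain ⟨k, hk⟩ : ∃ k : ℕ, count x = k := ⟨_, count_eq_card x⟩
  have hlt := eq_decide_lt hanti hk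
  have hcard := Finset.card_le_univ (Finset.univ.filter fun p => x p = true)
  have hkn : k ≤ n := by
    rw [count_eq_card, Nat.cast_inj] at hk
    rw [hk] at hcard
    exact hcard.trans (Fintype.card_fin n).le
  rw [hk] at h
  -- The labelling is now `∧^k ∨^(n-k)` with `k` even. If `k` were positive, it would begin with two
  -- `∧`, which is a descent at `1''`.
  have hk0 : k = 0 := by
    by_contra h0
    have h2 : 2 ≤ k := by
      have : Even k := by exact_mod_cast h
      rcases this with ⟨r, hr⟩
      omega
    refine hd (⟨⟨0, by omega⟩, by omega⟩ : DNode n) ?_ ?_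
    · change xor (x (⟨0, by omega⟩ : Fin n)) true = false
      rw [hlt, Bool.xor_true, Bool.not_eq_false', decide_eq_true_eq]
      simp only
      omega
    · change x (⟨1, by omega⟩ : Fin n) = true
      rw [hlt, decide_eq_true_eq]
      simp only
      omega
  refine hx (funext fun p => ?_)
  exact (hlt p).trans (by rw [hk0]; rfl)

/-- The weights of `(D_n, A_{n-1})`. -/
noncomputable def minusculeDA : Minuscule (pairDA n) :=
  minuscule (regular_modelDA n) (fun x => Even (count x))
    (by
      have : count (modelDA n).start = 0 := by simp [count, modelDA]
      rw [this]
      exact Even.zero)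
    (even_count_act_modelDA n) (start_modelDA_mem n) (start_modelDA_not_mem n) (desc_modelDA n)

noncomputable def labellingDA : (modelDA n).Labelling (minusculeDA n) :=
  labelling _ _ _ _ _ _ _

end TypeD

/-- The flips of the first label after deletion of the pair of a node. -/
def gaugeDA (n : ℕ) (τ : DNode n) (j : Fin (n - 2)) : Bool :=
  !decide (τ.1.val = 0) && decide (j.val = 0)

theorem isDeletion_modelDA (n : ℕ) :
    IsDeletion (modelDA n) (modelDA n).skip (gaugeDA n) :=
  isDeletion_skipPair (regular_modelDA n) _ fun (τ : DNode n) (c : DNode n) e hb j => by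
    have e : τ.1.val - 1 + 1 = c.1.val - 1 := congrArg Fin.val e
    have hb : c.1.val ≠ 0 := of_decide_eq_false hb
    change gaugeDA n c j = if j.val = τ.1.val - 1 then xor (gaugeDA n τ j) (decide (τ.1.val = 0))
      else gaugeDA n τ j
    unfold gaugeDA
    -- There is no gauge at `1''`. Sliding away from its beaded pair creates the gauge at the first
    -- vertex, and later slides to the right keep it.
    by_cases h0 : τ.1.val = 0
    · simp only [h0, hb]
      by_cases h1 : j.val = 0 <;> simp [h1]
    · simp [h0, hb]

/-- Exchanges the nodes `1''` and `1`. -/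
def swapDA {n : ℕ} (hn : 3 ≤ n) (j : DNode (n - 2)) : DNode n :=
  ⟨⟨if j.1.val = 0 then 1 else if j.1.val = 1 then 0 else j.1.val, by
    have := j.1.2
    split_ifs <;> omega⟩, by omega⟩

/-- The gauge flips the first label, which turns the beaded reflection of the first two positions
into the unbeaded one and conversely. Hence the nodes `1''` and `1` are exchanged. -/
theorem isNodeLift_modelDA {n : ℕ} (hn : 3 ≤ n) :
    IsNodeLift (modelDA n) (modelDA (n - 2)) (modelDA n).skip (gaugeDA n)
      (⟨⟨n - 1, by omega⟩, by omega⟩ : DNode n) (swapDA hn) where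
  left (j : DNode (n - 2)) := by
    have h1 := j.1.2
    have h2 := j.2
    refine Fin.ext ((skipPair_val _ _).trans ((if_pos ?_).trans ?_))
    · change j.1.val - 1 < n - 1 - 1
      omega
    · change j.1.val - 1 = (if j.1.val = 0 then 1 else if j.1.val = 1 then 0 else j.1.val) - 1
      split_ifs <;> omega
  right (j : DNode (n - 2)) := by
    have h1 := j.1.2
    have h2 := j.2
    refine Fin.ext ((skipPair_val _ _).trans ((if_pos ?_).trans ?_))
    · change j.1.val - 1 + 1 < n - 1 - 1
      omega
    · change j.1.val - 1 + 1 =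
        (if j.1.val = 0 then 1 else if j.1.val = 1 then 0 else j.1.val) - 1 + 1
      split_ifs <;> omega
  beaded (j : DNode (n - 2)) := by
    change decide ((if j.1.val = 0 then 1 else if j.1.val = 1 then 0 else j.1.val) = 0) =
      xor (decide (j.1.val = 0)) (!decide (n - 1 = 0) && decide (j.1.val - 1 = 0))
    have : n - 1 ≠ 0 := by omega
    by_cases h0 : j.1.val = 0
    · simp [h0, this]
    by_cases h1 : j.1.val = 1
    · simp [h1, this]
    have : j.1.val - 1 ≠ 0 := by omega
    simp [h0, h1, this]
  gauge (j : DNode (n - 2)) := by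
    change (_ && decide (j.1.val - 1 + 1 = 0)) = false
    simp
  comm (j : DNode (n - 2)) := by
    have h1 := j.1.2
    have h2 := j.2
    refine (Minuscule.coxeterD_simplyLaced (swapDA hn j)
      ⟨⟨n - 1, by omega⟩, by omega⟩ ?_).resolve_right fun h => ?_
    · intro e
      have := congrArg (fun i : DNode n => i.1.val) e
      simp only [swapDA] at this
      split_ifs at this <;> omega
    · have := Minuscule.coxeterD_three h
      simp only [swapDA] at this
      grind
  cover (i : DNode n) := by
    have h1 := i.1.2
    by_cases h2 : i.1.val = n - 1
    · exact .inr (.inl (Subtype.ext (Fin.ext h2)))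
    by_cases h3 : i.1.val - 1 + 1 = n - 1 - 1
    · exact .inr (.inr (Fin.ext h3))
    refine .inl ⟨⟨⟨if i.1.val = 0 then 1 else if i.1.val = 1 then 0 else i.1.val, ?_⟩, ?_⟩, ?_⟩
    · split_ifs <;> omega
    · by_cases h4 : i.1.val = 0
      · omega
      · omega
    · refine Subtype.ext (Fin.ext ?_)
      simp only [swapDA]
      grind

theorem exists_contraction_DA {n : ℕ} (hn : 3 ≤ n) (τ : DNode n) :
    ∃ g : (minusculeDA (n - 2)).Ω → (minusculeDA n).Ω,
      Minuscule.Contraction (minusculeDA n) (minusculeDA (n - 2)) τ g ∧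
      ∀ y, Deletes (labellingDA n) (labellingDA (n - 2)) (modelDA n).skip (gaugeDA n) τ (g y) y := by
  refine exists_contraction (regular_modelDA n) (regular_modelDA _) (isDeletion_modelDA n)
    (Minuscule.coxeterD_reachable hn) (τ₀ := (⟨⟨0, by omega⟩, by omega⟩ : DNode n)) ?_ (fun _ => rfl)
    (fun (j : Fin (n - 2)) => rfl) (isNodeLift_modelDA hn) (decide_eq_false (by simp only; omega))
    (fun (x : {x : Fin n → Bool // Even (count x)}) hx => ?_) τ
  · exact (minusculeDA n).v_one_not_mem _ fun h => h rfl
  · have hv := (labellingDA n).v_down.1 hx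
    have hb : (modelDA n).beaded (⟨⟨n - 1, by omega⟩, by omega⟩ : DNode n) = false :=
      decide_eq_false (by simp only; omega)
    have e1 : x.1 ((modelDA n).left (⟨⟨n - 1, by omega⟩, by omega⟩ : DNode n)) = false := by
      have := hv.1
      unfold incoming at this
      rw [hb] at this
      exact (Bool.xor_false _).symm.trans this
    have hs := (isDeletion_modelDA n).count_eq (regular_modelDA n) (x := x.1) e1 hv.2
    have hx2 : Even (count x.1) := x.2
    refine ⟨⟨fun j => xor (x.1 ((modelDA n).skip (⟨⟨n - 1, by omega⟩, by omega⟩ : DNode n) j))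
      (gaugeDA n ⟨⟨n - 1, by omega⟩, by omega⟩ j), ?_⟩, fun j => ?_⟩
    -- The deleted labels contain exactly one `∧`, so an odd number remains, and flipping the first
    -- label makes it even again.
    · have he := even_count_xor_first (n := n - 2) (by omega)
        (x := fun j => x.1 ((modelDA n).skip (⟨⟨n - 1, by omega⟩, by omega⟩ : DNode n) j))
        (y := fun j => xor (x.1 ((modelDA n).skip (⟨⟨n - 1, by omega⟩, by omega⟩ : DNode n) j))
          (gaugeDA n ⟨⟨n - 1, by omega⟩, by omega⟩ j)) (fun j => by
            have : n - 1 ≠ 0 := by omega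
            simp [gaugeDA, this])
      exact (Int.even_add.1 he).2 (hs ▸ hx2)
    · change _ = xor (xor _ _) _
      rw [Bool.xor_assoc, Bool.xor_self, Bool.xor_false]
      rfl

end ArrowModel

/-! ### Assembly of the theorem -/

namespace Minuscule

variable {X X' : CoxeterPair} {m : Minuscule X} {m' : Minuscule X'}

theorem main_of_autInvariant {τ : X.Node} (h : ∃ g, Contraction m m' τ g)
    (inv : m'.AutInvariant) :
    Nonempty (X.Wall τ ≃o X'.Coset) ∧
    ∀ ψ : X.Wall τ ≃o X'.Coset, ∀ (lam mu : X.Wall τ) (T : X.Path mu.1) (T' : X'.Path (ψ mu)),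
      T.IsReduced → T'.IsReduced →
        ∃ Φ : X.PathOfWeight lam.1 T ≃ X'.PathOfWeight (ψ lam) T',
          ∀ S : X.PathOfWeight lam.1 T, (Φ S).1.deg = S.1.deg := by
  obtain ⟨g, hg⟩ := h
  refine ⟨?_, fun ψ lam mu T T' hT hT' =>
    hg.exists_equiv_paths_of_autInvariant inv ψ lam mu hT hT'⟩
  obtain ⟨ψ, -⟩ := hg.exists_orderIso
  exact ⟨ψ⟩

end Minuscule

namespace LabelledTangle

variable {n : ℕ} {D : LabelledTangle n} {D' : LabelledTangle (n - 2)} {l : ℕ}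
  {z : Fin (n - 2) → Bool}

theorem isArcDeletion (hz : ∀ j, z j = false)
    (h : D.toTangle.Restricts (skipPair l) z D'.toTangle)
    (hlab : ∀ j, D'.north j = xor (D.north (skipPair l j)) (z j)) :
    D.northernHalf.IsArcDeletion l D'.northernHalf := by
  obtain rfl : z = fun _ => false := funext hz
  intro j
  obtain ⟨h1, h2⟩ := h j
  refine ⟨(hlab j).trans (Bool.xor_false _), h1, ?_⟩
  change D'.toTangle.bd j = D.toTangle.bd (skipPair l j)
  rw [h2]
  cases D'.toTangle.nb j <;> simp

theorem isArcDeletion_flipFirst (hz : ∀ j, z j = decide (j.val = 0)) (hv : D'.toTangle.Valid)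
    (h : D.toTangle.Restricts (skipPair l) z D'.toTangle)
    (hlab : ∀ j, D'.north j = xor (D.north (skipPair l j)) (z j)) :
    D.northernHalf.IsArcDeletion l D'.northernHalf.flipFirst := by
  intro j
  obtain ⟨h1, h2⟩ := h j
  refine ⟨?_, h1, ?_⟩
  · change (if j.val = 0 then !D'.north j else D'.north j) = D.north (skipPair l j)
    rw [hlab, hz]
    by_cases e : j.val = 0 <;> simp [e]
  · change (if j.val = 0 ∨ ∃ q, D'.toTangle.nb j = some q ∧ q.val = 0 then !D'.toTangle.bd j
      else D'.toTangle.bd j) = D.toTangle.bd (skipPair l j)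
    rw [h2, hz]
    cases e : D'.toTangle.nb j with
    | none => by_cases h0 : j.val = 0 <;> simp [h0]
    | some q =>
      -- At most one end of an arc is the first vertex, so the gauge of the two ends amounts to a
      -- single change of the bead.
      have hne : j ≠ q := fun e' => hv.nb_ne (e.trans (congrArg some e'.symm))
      simp only [Option.elim_some, hz, Option.some_inj, exists_eq_left']
      by_cases h0 : j.val = 0
      · have hq : q.val ≠ 0 := fun hq => hne (Fin.ext (h0.trans hq.symm))
        simp [h0, hq]
      · by_cases hq : q.val = 0 <;> simp [h0, hq]

theorem isArcDeletion_ite {c : Bool} (hz : ∀ j, z j = (!c && decide (j.val = 0)))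
    (hv : D'.toTangle.Valid) (h : D.toTangle.Restricts (skipPair l) z D'.toTangle)
    (hlab : ∀ j, D'.north j = xor (D.north (skipPair l j)) (z j)) :
    D.northernHalf.IsArcDeletion l
      (if c then D'.northernHalf else D'.northernHalf.flipFirst) := by
  cases c
  · exact isArcDeletion_flipFirst hz hv h hlab
  · exact isArcDeletion hz h hlab

end LabelledTangle

namespace ArrowModel

theorem main_of_A {N k : ℕ} (h1 : 1 ≤ k) (h2 : k + 1 ≤ N) (τ : (pairA N k).Node) :
    (∃ ψ : (pairA N k).Wall τ ≃o (pairA (N - 2) (k - 1)).Coset, ∀ μ,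
      (modelA (N - 2) (k - 1)).diagram (ψ μ).val =
        fun j => (modelA N k).diagram μ.1.val ((modelA N k).skip τ j)) ∧
    ∀ ψ : (pairA N k).Wall τ ≃o (pairA (N - 2) (k - 1)).Coset, (∀ μ,
      (modelA (N - 2) (k - 1)).diagram (ψ μ).val =
        fun j => (modelA N k).diagram μ.1.val ((modelA N k).skip τ j)) →
      ∀ (lam mu : (pairA N k).Wall τ) (T : (pairA N k).Path mu.1)
        (T' : (pairA (N - 2) (k - 1)).Path (ψ mu)), T.IsReduced → T'.IsReduced →
        ∃ Φ : (pairA N k).PathOfWeight lam.1 T ≃ (pairA (N - 2) (k - 1)).PathOfWeight (ψ lam) T',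
          ∀ S, (Φ S).1.deg = S.1.deg ∧ ((modelA N k).diagramOfPath S.1).IsOriented ∧
            ((modelA (N - 2) (k - 1)).diagramOfPath (Φ S).1).IsOriented ∧
            ((modelA N k).diagramOfPath S.1).northernHalf.HasDegreeZeroArc ((modelA N k).left τ)
              ((modelA N k).right τ) ((modelA N k).beaded τ) ∧
            ((modelA N k).diagramOfPath S.1).northernHalf.IsArcDeletion ((modelA N k).left τ).val
              ((modelA (N - 2) (k - 1)).diagramOfPath (Φ S).1).northernHalf := by
  have h := exists_contraction_A h1 h2 (by omega) (by omega) τ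
  refine ⟨?_, fun ψ hψ lam mu T T' hT hT' => ?_⟩
  · obtain ⟨ψ, hψ⟩ := exists_orderIso_labels h
    exact ⟨ψ, fun μ => funext fun j => (hψ μ j).trans (Bool.xor_false _)⟩
  · obtain ⟨Φ, hΦ⟩ := exists_equiv_deletes (regular_modelA N k) (regular_modelA _ _) h (ψ := ψ)
      (fun μ j => (congrFun (hψ μ) j).trans (Bool.xor_false _).symm) lam mu hT hT'
    refine ⟨Φ, fun S => ⟨(hΦ S).1,
      isOriented_diagramOfPath (regular_modelA N k) (labellingA N k (by omega)) S.1,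
      isOriented_diagramOfPath (regular_modelA _ _) (labellingA _ _ (by omega)) (Φ S).1,
      hasDegreeZeroArc (regular_modelA N k) (labellingA N k (by omega)) hT S,
      LabelledTangle.isArcDeletion (n := N) (fun _ => rfl) (hΦ S).2
        fun j => (congrFun (hψ lam) j).trans (Bool.xor_false _).symm⟩⟩

theorem main_of_DA {n : ℕ} (hn : 3 ≤ n) (τ : (pairDA n).Node) :
    (∃ ψ : (pairDA n).Wall τ ≃o (pairDA (n - 2)).Coset,
      (HermitianType.DA n hn).IsLabelDeletion τ ψ) ∧
    ∀ ψ : (pairDA n).Wall τ ≃o (pairDA (n - 2)).Coset,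
      (HermitianType.DA n hn).IsLabelDeletion τ ψ →
      ∀ (lam mu : (pairDA n).Wall τ) (T : (pairDA n).Path mu.1)
        (T' : (pairDA (n - 2)).Path (ψ mu)), T.IsReduced → T'.IsReduced →
        ∃ Φ : (pairDA n).PathOfWeight lam.1 T ≃ (pairDA (n - 2)).PathOfWeight (ψ lam) T',
          ∀ S, (Φ S).1.deg = S.1.deg ∧
            (HermitianType.DA n hn).DeletesArc τ S.1 (Φ S).1 := by
  have h := exists_contraction_DA hn τ
  have hb : (modelDA n).beaded τ = decide (τ.1.val = 0) := rfl
  have key : ∀ (ψ : (pairDA n).Wall τ → (pairDA (n - 2)).Coset),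
      (HermitianType.DA n hn).IsLabelDeletion τ ψ ↔ ∀ μ j,
        (modelDA (n - 2)).diagram (ψ μ).val j =
          xor ((modelDA n).diagram μ.1.val ((modelDA n).skip τ j)) (gaugeDA n τ j) := by
    intro ψ
    refine forall_congr' fun μ => ?_
    rw [← funext_iff]
    refine Eq.congr_right (funext fun j => ?_)
    rw [hb]
    unfold gaugeDA
    by_cases h0 : τ.1.val = 0
    · rw [if_pos (decide_eq_true h0), decide_eq_true h0]
      exact (Bool.xor_false _).symm
    · rw [if_neg (by simpa using h0), decide_eq_false h0, flipFirstLabel]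
      by_cases hj : j.val = 0
      · rw [if_pos hj, decide_eq_true hj]
        exact (Bool.xor_true _).symm
      · rw [if_neg hj, decide_eq_false hj]
        exact (Bool.xor_false _).symm
  refine ⟨?_, fun ψ hψ lam mu T T' hT hT' => ?_⟩
  · obtain ⟨ψ, hψ⟩ := exists_orderIso_labels h
    exact ⟨ψ, (key ψ).2 hψ⟩
  · rw [key] at hψ
    obtain ⟨Φ, hΦ⟩ := exists_equiv_deletes (regular_modelDA n) (regular_modelDA _) h (ψ := ψ)
      hψ lam mu hT hT'
    refine ⟨Φ, fun S => ⟨(hΦ S).1,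
      isOriented_diagramOfPath (regular_modelDA n) (labellingDA n) S.1,
      isOriented_diagramOfPath (regular_modelDA _) (labellingDA _) (Φ S).1,
      hasDegreeZeroArc (regular_modelDA n) (labellingDA n) hT S, ?_⟩⟩
    exact LabelledTangle.isArcDeletion_ite (n := n) (c := (modelDA n).beaded τ) (fun _ => rfl)
      (valid_wordTangle (regular_modelDA (n - 2)) (Φ S).1.weight) (hΦ S).2 (hψ lam)

end ArrowModel

open Minuscule in
theorem mainTheorem10 (H : HermitianType) (τ : H.pair.Node) :
    (∃ ψ : H.pair.Wall τ ≃o H.contract.Coset, H.IsLabelDeletion τ ψ) ∧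
    ∀ ψ : H.pair.Wall τ ≃o H.contract.Coset, H.IsLabelDeletion τ ψ →
      ∀ (lam mu : H.pair.Wall τ)
        (T : H.pair.Path mu.1) (T' : H.contract.Path (ψ mu)), T.IsReduced → T'.IsReduced →
        ∃ Φ : H.pair.PathOfWeight lam.1 T ≃ H.contract.PathOfWeight (ψ lam) T',
          ∀ S : H.pair.PathOfWeight lam.1 T,
            (Φ S).1.deg = S.1.deg ∧ H.DeletesArc τ S.1 (Φ S).1 := by
  cases H with
  | A n k h1 h2 => exact ArrowModel.main_of_A (N := n + 1) h1 (by omega) τ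
  | DA n hn => exact ArrowModel.main_of_DA hn τ
  | DD n hn =>
    obtain ⟨⟨ψ⟩, h⟩ := main_of_autInvariant (exists_contraction_quadric n hn τ) autInvariant_chain₂
    refine ⟨⟨ψ, trivial⟩, fun ψ _ lam mu T T' hT hT' => ?_⟩
    obtain ⟨Φ, hΦ⟩ := h ψ lam mu T T' hT hT'
    exact ⟨Φ, fun S => ⟨hΦ S, trivial⟩⟩
  | E6 =>
    obtain ⟨⟨ψ⟩, h⟩ := main_of_autInvariant (exists_contraction_e6 τ) autInvariant_chain₆
    refine ⟨⟨ψ, trivial⟩, fun ψ _ lam mu T T' hT hT' => ?_⟩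
    obtain ⟨Φ, hΦ⟩ := h ψ lam mu T T' hT hT'
    exact ⟨Φ, fun S => ⟨hΦ S, trivial⟩⟩
  | E7 =>
    obtain ⟨⟨ψ⟩, h⟩ := main_of_autInvariant (exists_contraction_e7 τ) autInvariant_quadric_six
    refine ⟨⟨ψ, trivial⟩, fun ψ _ lam mu T T' hT hT' => ?_⟩
    obtain ⟨Φ, hΦ⟩ := h ψ lam mu T T' hT hT'
    exact ⟨Φ, fun S => ⟨hΦ S, trivial⟩⟩
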